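/- A smooth surface $S\subset\mathbb{R}^3$ (possibly with boundary) is called a self-shrinker if $H-\tfrac12\,\vec X\cdot\vec\nu=0$ at each of its points $\vec X$, where $\vec\nu$ is a unit normal and $H$ is the sum of the principal curvatures with respect to $\vec\nu$, with the sign for which $H=2$ on the unit sphere with outward normal. "Smooth" means $C^\infty$, up to the boundary if there is one (that is, with a $C^\infty$ extension to an open neighbourhood). **(A) Generating curves.** There are $\delta>0$ and positive functions $\rho_h:[0,\pi/2]\to\mathbb{R}$, $h\in(2-\delta,2+\delta)$, with $(h,\varphi)\mapsto\rho_h(\varphi)$ smooth, such that: - $\rho_2\equiv 2$, and $\rho_h(0)=h$, $\rho_h'(0)=0$ for all $h$. - The map $h\mapsto\rho_h(\pi/2)$ is an orientation-reversing diffeomorphism of $(2-\delta,2+\delta)$ onto a bounded open interval containing $2$, and $h\mapsto\rho_h'(\pi/2)$ is an orientation-reversing diffeomorphism of $(2-\delta,2+\delta)$ onto a bounded open interval containing $0$. - For each $h$, the curve $x=\rho_h(\varphi)\sin\varphi$, $z=\rho_h(\varphi)\cos\varphi$, $0<\varphi<\pi/2$, in the $xz$-plane generates by revolution about the $z$-axis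 a smooth embedded surface that is a self-shrinker. **(B) Caps.** There are $\delta_\theta>0$ and a family of smooth embedded surfaces with boundary $\mathcal K[\theta]\subset\mathbb{R}^3$, $|\theta|\le\delta_\theta$, such that: 0. Each $\mathcal K[\theta]$ is a self-shrinker. 1. $\mathcal K[0]$ is the hemisphere $\{|\vec X|=2,\ y\ge0\}$, and $\mathcal K[\theta]=\{\vec X+f_\theta(\vec X)\tfrac{\vec X}{2}:\vec X\in\mathcal K[0]\}$ is the normal graph of a function $f_\theta$ on $\mathcal K[0]$ with $|f_\theta|<2$, where $(\theta,\vec X)\mapsto f_\theta(\vec X)$ is smooth on $[-\delta_\theta,\delta_\theta]\times\mathcal K[0]$. 2. $\mathcal K[\theta]$ is invariant under rotations about the $y$-axis. 3. The boundary $\partial\mathcal K[\theta]$ is the circle in the plane $\mathcal P_{xz}=\{y=0\}$ with centre $0$ and some radius $r[\theta]>0$, and the inward pointing unit co-normal $\eta_\theta$ of $\mathcal K[\theta]$ at the point $(r[\theta],0,0)$ satisfies $\eta_\theta\cdot\vec e_x=\sin\theta$, and the angle between $\eta_\theta$ and $\vec e_x$ is $\pi/2-\theta$; so $\mathcal K[\theta]$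 meets $\mathcal P_{xz}$ at the angle $\pi/2-\theta$. 4. There are conformal parametrizations $\kappa[\theta]:\mathcal C\to\mathcal K[\theta]\setminus\{y\text{-axis}\}$, bijective and smooth in $(\theta,s,z)$, where $\mathcal C=\{(s,z):s\ge0\}/(z\mapsto z+2\pi)$ is the flat half-cylinder of radius $1$, such that: - (i) for each $s\ge0$ the image of $\{s=\text{const}\}$ is a circle of positive radius with centre on the $y$-axis, parallel to the $xz$-plane; - (ii) $\kappa[\theta](\{s=0\})=\partial\mathcal K[\theta]$; - (iii) the pullback by $\kappa[\theta]$ of the Euclidean metric is $\varrho^2(ds^2+dz^2)$ with $\varrho^2=x^2+z^2$, where $x$ and $z$ in $\varrho^2$ are the Euclidean coordinates of the point $\kappa[\theta](s,z)$; - (iv) for each $k\ge0$ there is a constant $C(k)$, independent of $\theta$ and of the point of $\mathcal C$, with $|\nabla^k\kappa[\theta]|\le C(k)$ and $|\nabla^k\dot\kappa[\theta]|\le C(k)$ on $\mathcal C$, where the dot is the derivative in $\theta$. -/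

import Mathlib

open Set
open scoped ContDiff RealInnerProductSpace

namespace ShrinkerCaps

noncomputable section

/-- The Euclidean plane, with coordinates `(s, z) = (u 0, u 1)`. -/
abbrev E2 := EuclideanSpace ℝ (Fin 2)

/-- Euclidean 3-space, with coordinates `(x, y, z) = (X 0, X 1, X 2)`. -/
abbrev E3 := EuclideanSpace ℝ (Fin 3)

/-- The closed half plane `{(s, z) : s ≥ 0}`. -/
def halfPlane : Set E2 := {u | 0 ≤ u 0}

/-- The boundary line `{s = 0}` of the half plane. -/
def edge : Set E2 := {u | u 0 = 0}

/-- The `i`-th partial derivative of a map from the plane to space. -/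
def pd (i : Fin 2) (φ : E2 → E3) (u : E2) : E3 :=
  fderiv ℝ φ u (EuclideanSpace.single i 1)

/-- Mean curvature at the parameter value `u` of the surface parametrized by `φ`, with respect to
the unit normal `ν` at that point, through the first and second fundamental forms.
The sign is such that `H` is the sum of the principal curvatures and that `H = 2` for the unit
sphere with its outward normal. -/
def meanCurvature (φ : E2 → E3) (ν : E3) (u : E2) : ℝ :=
  let E := ⟪pd 0 φ u, pd 0 φ u⟫
  let F := ⟪pd 0 φ u, pd 1 φ u⟫
  let G := ⟪pd 1 φ u, pd 1 φ u⟫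
  let L := ⟪pd 0 (pd 0 φ) u, ν⟫
  let M := ⟪pd 0 (pd 1 φ) u, ν⟫
  let N := ⟪pd 1 (pd 1 φ) u, ν⟫
  (2 * M * F - L * G - N * E) / (E * G - F ^ 2)

/-- `ν` is one of the two unit normals at the parameter value `u` of the surface parametrized
by `φ`. -/
def IsUnitNormal (φ : E2 → E3) (u : E2) (ν : E3) : Prop :=
  ‖ν‖ = 1 ∧ ⟪ν, pd 0 φ u⟫ = 0 ∧ ⟪ν, pd 1 φ u⟫ = 0

/-- The self-shrinker equation `H - (1/2) X · ν = 0` at the parameter value `u`. Both terms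
change sign with `ν`, so that it does not depend on the choice of the unit normal. -/
def ShrinkerEquationAt (φ : E2 → E3) (u : E2) : Prop :=
  ∀ ν : E3, IsUnitNormal φ u ν → meanCurvature φ ν u - (1 / 2) * ⟪φ u, ν⟫ = 0

/-- `φ`, on the open set `U` of the plane, is a local parametrization of the surface `S` with
boundary `B`: it is a smooth embedding of `U` into space, and it maps `U ∩ {s ≥ 0}` onto a
relatively open subset of `S`, and the part on the line `{s = 0}` onto the points of `B`
in that subset. -/
structure IsLocalParam (S B : Set E3) (φ : E2 → E3) (U : Set E2) : Prop where
  isOpen : IsOpen U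
  smooth : ContDiffOn ℝ ∞ φ U
  immersion : ∀ u ∈ U, Function.Injective (fderiv ℝ φ u)
  embedding : Topology.IsEmbedding (U.domRestrict φ)
  image : ∃ V : Set E3, IsOpen V ∧ S ∩ V = φ '' (U ∩ halfPlane) ∧ B ∩ V = φ '' (U ∩ edge)

/-- `S` is a smooth embedded surface in space whose (possibly empty) boundary is `B`. -/
def IsSurfaceWithBoundary (S B : Set E3) : Prop :=
  B ⊆ S ∧ ∀ p ∈ S, ∃ (φ : E2 → E3) (U : Set E2),
    IsLocalParam S B φ U ∧ p ∈ φ '' (U ∩ halfPlane)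

/-- The surface `S` with boundary `B` satisfies the self-shrinker equation at each of its points.
The equation is invariant under reparametrization, so that it is enough to have it in one local
parametrization around each point. -/
def IsSelfShrinker (S B : Set E3) : Prop :=
  ∀ p ∈ S, ∃ (φ : E2 → E3) (U : Set E2),
    IsLocalParam S B φ U ∧ p ∈ φ '' (U ∩ halfPlane) ∧
      ∀ u ∈ U ∩ halfPlane, ShrinkerEquationAt φ u

/-- `η` is the inward pointing unit co-normal at the boundary point `p` of the surface `S` with
boundary `B`: a unit vector tangent to `S`, orthogonal to the boundary, pointing into `S`.
These properties do not depend on the local parametrization and determine `η`. -/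
def IsInwardConormal (S B : Set E3) (p η : E3) : Prop :=
  ∃ (φ : E2 → E3) (U : Set E2) (u : E2),
    IsLocalParam S B φ U ∧ u ∈ U ∩ edge ∧ φ u = p ∧
      (∃ a b : ℝ, 0 < a ∧ η = a • pd 0 φ u + b • pd 1 φ u) ∧
      ⟪η, pd 1 φ u⟫ = 0 ∧ ‖η‖ = 1

/-- The graph `{X + f(X) ν(X) : X ∈ S}` of `f` over `S` in the direction of the normal
field `ν`. -/
def normalGraph (S : Set E3) (ν : E3 → E3) (f : E3 → ℝ) : Set E3 :=
  (fun X => X + f X • ν X) '' S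

/-- The closed hemisphere of radius 2 about the origin in `{y ≥ 0}`. -/
def hemisphere : Set E3 := {X | ‖X‖ = 2 ∧ 0 ≤ X 1}

/-- The outward unit normal `X / 2` of the sphere of radius 2 about the origin. -/
def sphereNormal (X : E3) : E3 := (1 / 2 : ℝ) • X

/-- The circle with centre on the `y`-axis and radius `r` in the plane `{y = c}`, which is
parallel to the `xz`-plane. -/
def circleY (c r : ℝ) : Set E3 := {X | X 1 = c ∧ (X 0) ^ 2 + (X 2) ^ 2 = r ^ 2}

/-- The `y`-axis. -/
def yAxis : Set E3 := {X | X 0 = 0 ∧ X 2 = 0}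

/-- Rotation by the angle `α` about the `y`-axis. -/
def rotY (α : ℝ) (X : E3) : E3 :=
  !₂[Real.cos α * X 0 - Real.sin α * X 2, X 1, Real.sin α * X 0 + Real.cos α * X 2]

/-- The surface obtained by revolving about the `z`-axis the curve in the `xz`-plane which in
polar coordinates `x = ρ sin φ`, `z = ρ cos φ` is the graph `ρ = ρ(φ)`, `0 < φ < π / 2`. -/
def revolution (ρ : ℝ → ℝ) : Set E3 :=
  {X | ∃ φ ∈ Ioo 0 (Real.pi / 2), ∃ α : ℝ,
    X = !₂[ρ φ * Real.sin φ * Real.cos α, ρ φ * Real.sin φ * Real.sin α, ρ φ * Real.cos φ]}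

/-- `f` is an orientation-reversing diffeomorphism of the open interval `I` onto the open
interval `J`: a smooth bijection with negative derivative (so that its inverse is smooth). -/
def IsOrientationReversingDiffeo (f : ℝ → ℝ) (I J : Set ℝ) : Prop :=
  ContDiffOn ℝ ∞ f I ∧ BijOn f I J ∧ ∀ h ∈ I, deriv f h < 0

/-- A function of several variables is smooth on a set (up to its boundary, if any) if it is
smooth on an open neighbourhood of the set. -/
def SmoothOnNhd {V W : Type*} [NormedAddCommGroup V] [NormedSpace ℝ V]
    [NormedAddCommGroup W] [NormedSpace ℝ W] (f : V → W) (A : Set V) : Prop :=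
  ∃ O : Set V, IsOpen O ∧ A ⊆ O ∧ ContDiffOn ℝ ∞ f O

end

end ShrinkerCaps

open ShrinkerCaps

/-! Describe a rotational surface near the sphere of radius 2 by its squared radius `q` as a
function of `w = 1 - cos φ`, with `φ` the angle from the axis. The shrinker equation becomes the
polynomial relation `ProfileEquation`, singular at `w = 0`. A solution smooth in `w` there closes up
smoothly across the axis. One family of profiles `q t` with `q t 0 = 4 + t` therefore yields both
the curves of (A), by revolution about the `z`-axis, and the caps of (B), about the `y`-axis.

The family comes from the implicit function theorem in the Banach algebra of power series in `x = 2
w / 3` with summable coefficients, which converge for `|w| ≤ 3 / 2` and so reach beyond the rim `w =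
1`. The unknown is not `q` but `v = (x q_x)_x`. From `v` one recovers `q - q(0)`, `q_x` and the
whole second order part of the equation by bounded operators (shifts, and division of the `n`-th
coefficient by `n + 1`), so the singular equation is a polynomial map `eqn` on `ℝ × Coeff`. Its
derivative in `v` is a multiple of `1 - (3/4) wshift`, invertible because the square of the weighted
shift is small (`isUnit_linearization`); this gives `exists_solution_curve`.

The derivative of the family at `t = 0` obeys a two-term recurrence. Its first two terms decide the
signs of the `t`-derivatives of `q` and `q'` at the rim, the tail being dominated by a geometric
series (`ev_shift_avg_avg_lt`, `ev_avg_neg`). Both signs are negative. This is the orientation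
reversal in (A), and since the contact angle satisfies `tan θ = -q'(1) / (2 q(1))`, it also permits
`θ` as the parameter in (B) (`exists_angle`).

Conformality requires `dw/ds = -w (2 - w) / stretch`. This integrates to `w exp(B(w)) = exp(-2 s)`
with `B` smooth across `w = 0`, so that `w` is a smooth function of `exp(-2 s)`
(`exists_conformalMeridian`). Hence the parametrization factors as a map smooth near the closed unit
disc after the covering `cyl` of the punctured disc, and the uniform derivative bounds reduce to
compactness (`exists_bound_iteratedFDeriv`). -/

namespace ShrinkerCaps
noncomputable section

/-- The Banach space of absolutely summable sequences of coefficients of power series. -/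
abbrev Coeff := lp (fun _ : ℕ => ℝ) 1

/-! ### Power series with summable coefficients: shifts, products, evaluation. -/

namespace Coeff

lemma summable_abs (v : Coeff) : Summable fun n => |v n| := by
  have h := (lp.memℓp v).summable (by simp)
  simpa using h

lemma norm_eq (v : Coeff) : ‖v‖ = ∑' n, |v n| := by
  rw [lp.norm_eq_tsum_rpow (by simp)]
  simp

/-- An absolutely summable sequence as an element of `Coeff`. -/
def mk (a : ℕ → ℝ) (h : Summable fun n => |a n|) : Coeff :=
  ⟨a, memℓp_gen (by simpa using h)⟩

@[simp] lemma mk_apply (a : ℕ → ℝ) (h : Summable fun n => |a n|) (n : ℕ) : mk a h n = a n := rfl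

lemma summable_mul_bdd {c : ℕ → ℝ} {C : ℝ} (hc : ∀ n, |c n| ≤ C) (v : Coeff) :
    Summable fun n => |c n * v n| := by
  refine Summable.of_nonneg_of_le (fun n => abs_nonneg _) (fun n => ?_)
    ((summable_abs v).mul_left C)
  rw [abs_mul]
  exact mul_le_mul_of_nonneg_right (hc n) (abs_nonneg _)

/-- Multiplication of the coefficients by a bounded sequence. -/
def diag (c : ℕ → ℝ) (C : ℝ) (hc : ∀ n, |c n| ≤ C) : Coeff →L[ℝ] Coeff :=
  LinearMap.mkContinuous
    { toFun := fun v => mk (fun n => c n * v n) (summable_mul_bdd hc v)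
      map_add' := fun v w => by
        apply lp.ext; funext n
        simp [mul_add]
      map_smul' := fun a v => by
        apply lp.ext; funext n
        simp; ring }
    C (fun v => by
      rw [norm_eq, norm_eq, ← tsum_mul_left]
      refine Summable.tsum_le_tsum (fun n => ?_) (summable_mul_bdd hc v)
        ((summable_abs v).mul_left C)
      simp only [LinearMap.coe_mk, AddHom.coe_mk, mk_apply, abs_mul]
      exact mul_le_mul_of_nonneg_right (hc n) (abs_nonneg _))

@[simp] lemma diag_apply {c : ℕ → ℝ} {C : ℝ} (hc : ∀ n, |c n| ≤ C) (v : Coeff) (n : ℕ) :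
    diag c C hc v n = c n * v n := rfl

lemma norm_diag_le {c : ℕ → ℝ} {C : ℝ} (hc : ∀ n, |c n| ≤ C) : ‖diag c C hc‖ ≤ C :=
  LinearMap.mkContinuous_norm_le _ ((abs_nonneg _).trans (hc 0)) _

lemma summable_shift (v : Coeff) :
    Summable fun n : ℕ => |(match n with | 0 => 0 | k + 1 => v k : ℝ)| := by
  rw [← summable_nat_add_iff 1]
  simpa using summable_abs v

/-- The right shift: multiplication of a power series by the variable. -/
def shift : Coeff →L[ℝ] Coeff :=
  LinearMap.mkContinuous
    { toFun := fun v => mk (fun n => match n with | 0 => 0 | k + 1 => v k) (summable_shift v)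
      map_add' := fun v w => by
        apply lp.ext; funext n
        cases n <;> simp
      map_smul' := fun a v => by
        apply lp.ext; funext n
        cases n <;> simp }
    1 (fun v => by
      rw [norm_eq, norm_eq, one_mul]
      exact ((summable_shift v).tsum_eq_zero_add.trans (by simp)).le)

@[simp] lemma shift_zero (v : Coeff) : shift v 0 = 0 := rfl
@[simp] lemma shift_succ (v : Coeff) (n : ℕ) : shift v (n + 1) = v n := rfl

lemma norm_shift_le : ‖shift‖ ≤ 1 := LinearMap.mkContinuous_norm_le _ zero_le_one _

/-- The left shift. -/
def lshift : Coeff →L[ℝ] Coeff :=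
  LinearMap.mkContinuous
    { toFun := fun v => mk (fun n => v (n + 1)) ((summable_nat_add_iff 1).2 (summable_abs v))
      map_add' := fun v w => by apply lp.ext; funext n; simp
      map_smul' := fun a v => by apply lp.ext; funext n; simp }
    1 (fun v => by
      rw [norm_eq, norm_eq, one_mul, Summable.tsum_eq_zero_add (summable_abs v)]
      simp)

@[simp] lemma lshift_apply (v : Coeff) (n : ℕ) : lshift v n = v (n + 1) := rfl

lemma norm_lshift_le : ‖lshift‖ ≤ 1 := LinearMap.mkContinuous_norm_le _ zero_le_one _

/-- The `n`-th coefficient. -/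
def coord (n : ℕ) : Coeff →L[ℝ] ℝ :=
  LinearMap.mkContinuous
    { toFun := fun v => v n
      map_add' := fun v w => by simp
      map_smul' := fun a v => by simp }
    1 (fun v => by rw [one_mul]; exact lp.norm_apply_le_norm one_ne_zero v n)

@[simp] lemma coord_apply (n : ℕ) (v : Coeff) : coord n v = v n := rfl

/-- The coefficients of the Cauchy product of power series. -/
def cauchyProduct (v w : Coeff) : Coeff :=
  mk (fun n => ∑ kl ∈ Finset.HasAntidiagonal.antidiagonal n, v kl.1 * w kl.2) (by
    simpa using summable_norm_sum_mul_antidiagonal_of_summable_norm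
      (f := fun n => v n) (g := fun n => w n)
      (by simpa using summable_abs v) (by simpa using summable_abs w))

lemma cauchyProduct_apply (v w : Coeff) (n : ℕ) : cauchyProduct v w n =
    ∑ kl ∈ Finset.HasAntidiagonal.antidiagonal n, v kl.1 * w kl.2 := rfl

lemma norm_cauchyProduct_le (v w : Coeff) : ‖cauchyProduct v w‖ ≤ ‖v‖ * ‖w‖ := by
  have hv : Summable fun n => ‖|v n|‖ := by simpa using summable_abs v
  have hw : Summable fun n => ‖|w n|‖ := by simpa using summable_abs w
  rw [norm_eq, norm_eq v, norm_eq w,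
    tsum_mul_tsum_eq_tsum_sum_antidiagonal_of_summable_norm hv hw]
  refine Summable.tsum_le_tsum (fun n => ?_) (summable_abs _)
    (summable_norm_sum_mul_antidiagonal_of_summable_norm hv hw).of_norm
  rw [cauchyProduct_apply]
  refine (Finset.abs_sum_le_sum_abs _ _).trans (le_of_eq ?_)
  simp [abs_mul]

/-- The Cauchy product of power series. -/
def mul : Coeff →L[ℝ] Coeff →L[ℝ] Coeff :=
  LinearMap.mkContinuous₂
    (LinearMap.mk₂ ℝ cauchyProduct
      (fun u v w => by
        apply lp.ext; funext n; simp [cauchyProduct_apply, add_mul, Finset.sum_add_distrib])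
      (fun a v w => by
        apply lp.ext; funext n; simp [cauchyProduct_apply, Finset.mul_sum, mul_assoc])
      (fun u v w => by
        apply lp.ext; funext n; simp [cauchyProduct_apply, mul_add, Finset.sum_add_distrib])
      (fun a v w => by
        apply lp.ext; funext n; simp [cauchyProduct_apply, Finset.mul_sum, mul_left_comm]))
    1 (fun v w => by rw [one_mul]; exact norm_cauchyProduct_le v w)

lemma mul_apply (v w : Coeff) (n : ℕ) :
    mul v w n = ∑ kl ∈ Finset.HasAntidiagonal.antidiagonal n, v kl.1 * w kl.2 := rfl

/-- The sum of a power series. -/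
def ev (x : ℝ) (v : Coeff) : ℝ := ∑' n, v n * x ^ n

lemma summable_abs_ev {x : ℝ} (hx : |x| ≤ 1) (v : Coeff) : Summable fun n => ‖v n * x ^ n‖ := by
  refine Summable.of_nonneg_of_le (fun n => norm_nonneg _) (fun n => ?_) (summable_abs v)
  rw [norm_mul, norm_pow, Real.norm_eq_abs, Real.norm_eq_abs]
  exact mul_le_of_le_one_right (abs_nonneg _) (pow_le_one₀ (abs_nonneg _) hx)

lemma summable_ev {x : ℝ} (hx : |x| ≤ 1) (v : Coeff) : Summable fun n => v n * x ^ n :=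
  (summable_abs_ev hx v).of_norm

lemma ev_add {x : ℝ} (hx : |x| ≤ 1) (v w : Coeff) : ev x (v + w) = ev x v + ev x w := by
  unfold ev
  rw [← (summable_ev hx v).tsum_add (summable_ev hx w)]
  simp [add_mul]

lemma ev_smul (x a : ℝ) (v : Coeff) : ev x (a • v) = a * ev x v := by
  unfold ev
  rw [← tsum_mul_left]
  simp [mul_assoc]

lemma ev_sub {x : ℝ} (hx : |x| ≤ 1) (v w : Coeff) : ev x (v - w) = ev x v - ev x w := by
  have := ev_add hx (v - w) w
  rw [sub_add_cancel] at this
  linarith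

lemma ev_mul {x : ℝ} (hx : |x| ≤ 1) (v w : Coeff) : ev x (mul v w) = ev x v * ev x w := by
  unfold ev
  rw [tsum_mul_tsum_eq_tsum_sum_antidiagonal_of_summable_norm (summable_abs_ev hx v)
    (summable_abs_ev hx w)]
  refine tsum_congr fun n => ?_
  rw [mul_apply, Finset.sum_mul]
  refine Finset.sum_congr rfl fun kl hkl => ?_
  rw [← Finset.HasAntidiagonal.mem_antidiagonal.1 hkl, pow_add]
  ring

lemma ev_shift {x : ℝ} (hx : |x| ≤ 1) (v : Coeff) : ev x (shift v) = x * ev x v := by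
  unfold ev
  rw [(summable_ev hx (shift v)).tsum_eq_zero_add, ← tsum_mul_left]
  simp only [shift_zero, shift_succ, zero_mul, zero_add]
  exact tsum_congr fun n => by ring

/-- The constant power series `1`. -/
def one : Coeff := lp.single 1 0 1

lemma one_zero : one 0 = 1 := lp.single_apply_self _ _ _
lemma one_succ (n : ℕ) : one (n + 1) = 0 := lp.single_apply_ne _ _ _ (by simp)

lemma ev_one (x : ℝ) : ev x one = 1 := by
  unfold ev
  rw [tsum_eq_single 0]
  · simp [one_zero]
  · intro n hn
    obtain ⟨k, rfl⟩ := Nat.exists_eq_succ_of_ne_zero hn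
    simp [one_succ]

lemma ev_zero (v : Coeff) : ev 0 v = v 0 := by
  unfold ev
  rw [tsum_eq_single 0]
  · simp
  · intro n hn
    simp [hn]

lemma inv_succ_le (n : ℕ) : |1 / ((n : ℝ) + 1)| ≤ 1 := by
  rw [abs_of_pos (by positivity)]
  rw [div_le_one (by positivity)]
  linarith [(Nat.cast_nonneg n : (0 : ℝ) ≤ n)]

/-- The averaging operator, which divides the `n`-th coefficient by `n + 1`. -/
def avg : Coeff →L[ℝ] Coeff := diag (fun n => 1 / ((n : ℝ) + 1)) 1 inv_succ_le

@[simp] lemma avg_apply (v : Coeff) (n : ℕ) : avg v n = v n / (n + 1) := by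
  simp [avg, div_eq_inv_mul]

/-- `shift ∘ avg` is integration from `0`. The termwise derivatives are dominated by `|v n|`,
uniformly on the open unit interval. -/
lemma hasDerivAt_ev_shift_avg {x : ℝ} (hx : |x| < 1) (v : Coeff) :
    HasDerivAt (fun y => ev y (shift (avg v))) (ev x v) x := by
  have hopen : IsOpen (Ioo (-1 : ℝ) 1) := isOpen_Ioo
  have hmem : x ∈ Ioo (-1 : ℝ) 1 := abs_lt.1 hx
  have key := hasDerivAt_tsum_of_isPreconnected (𝕜 := ℝ) (F := ℝ) (summable_abs v) hopen
    isPreconnected_Ioo (g := fun n y => v n / (n + 1) * y ^ (n + 1)) (g' := fun n y => v n * y ^ n)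
    (fun n y _ => by
      have h := (hasDerivAt_pow (n + 1) y).const_mul (v n / (n + 1))
      have h0 : (n : ℝ) + 1 ≠ 0 := by positivity
      have h1 : v n / (n + 1) * (((n + 1 : ℕ) : ℝ) * y ^ (n + 1 - 1)) = v n * y ^ n := by
        rw [Nat.add_sub_cancel]
        push_cast
        field_simp
      rwa [h1] at h)
    (fun n y hy => by
      rw [norm_mul, norm_pow, Real.norm_eq_abs, Real.norm_eq_abs]
      exact mul_le_of_le_one_right (abs_nonneg _) (pow_le_one₀ (abs_nonneg _)
        (abs_lt.2 hy).le))
    (y₀ := 0) (by simp) (by simp) hmem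
  refine key.congr_of_eventuallyEq ?_
  filter_upwards [hopen.mem_nhds hmem] with y hy
  unfold ev
  rw [(summable_ev (abs_lt.2 hy).le (shift (avg v))).tsum_eq_zero_add]
  simp

lemma isUnit_resolvent {x : ℝ} (hx : |x| < 1) :
    IsUnit (1 - x • lshift : Coeff →L[ℝ] Coeff) := by
  apply isUnit_one_sub_of_norm_lt_one
  rw [norm_smul, Real.norm_eq_abs]
  exact (mul_le_of_le_one_right (abs_nonneg _) norm_lshift_le).trans_lt hx

lemma ev_sub_resolvent {x : ℝ} (hx : |x| ≤ 1) (v : Coeff) :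
    ev x ((1 - x • lshift : Coeff →L[ℝ] Coeff) v) = v 0 := by
  have h1 : ev x v = v 0 + x * ev x (lshift v) := by
    unfold ev
    rw [(summable_ev hx v).tsum_eq_zero_add, ← tsum_mul_left]
    simp only [pow_zero, mul_one, lshift_apply]
    congr 1
    exact tsum_congr fun n => by ring
  have : (1 - x • lshift : Coeff →L[ℝ] Coeff) v = v - x • lshift v := by simp
  rw [this, ev_sub hx, ev_smul, h1]
  ring

/-- Evaluating `(1 - x L) u`, with `L` the left shift, telescopes to `u 0`; take `u` to be the
preimage of `v`. In this form the joint regularity of evaluation in `x` and `v` is that of inversion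
in a Banach algebra. -/
lemma ev_eq_resolvent {x : ℝ} (hx : |x| < 1) (v : Coeff) :
    ev x v = coord 0 (Ring.inverse (1 - x • lshift : Coeff →L[ℝ] Coeff) v) := by
  have h := Ring.mul_inverse_cancel _ (isUnit_resolvent hx)
  have h2 : (1 - x • lshift : Coeff →L[ℝ] Coeff)
      (Ring.inverse (1 - x • lshift : Coeff →L[ℝ] Coeff) v) = v :=
    DFunLike.congr_fun h v
  conv_lhs => rw [← h2]
  rw [ev_sub_resolvent hx.le, coord_apply]

lemma contDiffAt_ev {n : WithTop ℕ∞} {x : ℝ} (hx : |x| < 1) (v : Coeff) :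
    ContDiffAt ℝ n (fun p : ℝ × Coeff => ev p.1 p.2) (x, v) := by
  have h : ContDiffAt ℝ n (fun p : ℝ × Coeff =>
      coord 0 (Ring.inverse (1 - p.1 • lshift : Coeff →L[ℝ] Coeff) p.2)) (x, v) := by
    refine (coord 0).contDiff.contDiffAt.comp _ ?_
    refine ContDiffAt.clm_apply ?_ contDiffAt_snd
    obtain ⟨u, hu⟩ := isUnit_resolvent hx
    have h1 : ContDiffAt ℝ n (Ring.inverse : (Coeff →L[ℝ] Coeff) → _)
        ((fun p : ℝ × Coeff => (1 - p.1 • lshift : Coeff →L[ℝ] Coeff)) (x, v)) := by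
      simp only
      rw [← hu]
      exact contDiffAt_ringInverse ℝ u
    exact h1.comp (x, v) (contDiffAt_const.sub (contDiffAt_fst.smul contDiffAt_const))
  refine h.congr_of_eventuallyEq ?_
  have : ∀ᶠ p : ℝ × Coeff in nhds (x, v), |p.1| < 1 :=
    (continuous_fst.abs).continuousAt.eventually_lt continuousAt_const hx
  filter_upwards [this] with p hp
  exact ev_eq_resolvent hp p.2

end Coeff

/-! ### The shrinker equation as a polynomial map on coefficients, its linearization and the curve
of solutions. -/

namespace Coeff

lemma add_coord (v w : Coeff) (n : ℕ) : (v + w) n = v n + w n := rfl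
lemma sub_coord (v w : Coeff) (n : ℕ) : (v - w) n = v n - w n := rfl
lemma smul_coord (a : ℝ) (v : Coeff) (n : ℕ) : (a • v) n = a * v n := rfl

/-- Evaluation of power series at a point as a continuous linear functional. -/
def evCLM (x : ℝ) : Coeff →L[ℝ] ℝ :=
  (coord 0).comp (Ring.inverse (1 - x • lshift : Coeff →L[ℝ] Coeff))

lemma evCLM_apply {x : ℝ} (hx : |x| < 1) (v : Coeff) : evCLM x v = ev x v :=
  (ev_eq_resolvent hx v).symm

/-- The weights of the linearized equation. -/
def weight (n : ℕ) : ℝ := 1 + 1 / ((n : ℝ) + 1) - 4 / ((n : ℝ) + 1) ^ 2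

lemma weight_zero : weight 0 = -2 := by norm_num [weight]

lemma weight_one : weight 1 = 1 / 2 := by norm_num [weight]

lemma weight_nonneg (n : ℕ) : 0 ≤ weight (n + 1) := by
  unfold weight
  push_cast
  have hn : (0 : ℝ) ≤ n := Nat.cast_nonneg n
  have : 1 + 1 / ((n : ℝ) + 1 + 1) - 4 / ((n : ℝ) + 1 + 1) ^ 2
      = ((n : ℝ) ^ 2 + 5 * n + 2) / (n + 1 + 1) ^ 2 := by
    field_simp; ring
  rw [this]
  positivity

/-- Complete the square in `1 / (n + 1)`; the maximum is at `n = 7`. -/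
lemma weight_le (n : ℕ) : weight n ≤ 17 / 16 := by
  have : weight n = 17 / 16 - (1 / 4 - 2 / ((n : ℝ) + 1)) ^ 2 := by
    unfold weight
    have : (n : ℝ) + 1 ≠ 0 := by positivity
    field_simp; ring
  rw [this]
  linarith [sq_nonneg (1 / 4 - 2 / ((n : ℝ) + 1))]

/-- This makes the terms of the averaged series at `x = 2/3` shrink by at least the factor `1/2`;
see `term_bounds`. -/
lemma weight_succ_mul_le (n : ℕ) : weight (n + 1) * ((n : ℝ) + 2) ≤ (n : ℝ) + 3 := by
  unfold weight
  push_cast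
  have hn : (0 : ℝ) ≤ n := Nat.cast_nonneg n
  have : (1 + 1 / ((n : ℝ) + 1 + 1) - 4 / ((n : ℝ) + 1 + 1) ^ 2) * ((n : ℝ) + 2)
      = (n : ℝ) + 3 - 4 / (n + 2) := by
    have : (n : ℝ) + 2 ≠ 0 := by positivity
    rw [show (n : ℝ) + 1 + 1 = n + 2 by ring]
    field_simp; ring
  rw [this]
  have : (0 : ℝ) ≤ 4 / (n + 2) := by positivity
  linarith

lemma abs_weight_le (n : ℕ) : |weight n| ≤ 2 := by
  rcases n with _ | n
  · rw [weight_zero]; norm_num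
  · rw [abs_of_nonneg (weight_nonneg n)]
    linarith [weight_le (n + 1)]

/-- The one large weight, `weight 0 = -2`, is followed by `weight 1 = 1/2`; all later products are
at most `(17/16) ^ 2`. -/
lemma abs_weight_mul_le (n : ℕ) : |weight (n + 1) * weight n| ≤ 3 / 2 := by
  rcases n with _ | n
  · rw [weight_zero, weight_one]; norm_num
  · rw [abs_of_nonneg (mul_nonneg (weight_nonneg _) (weight_nonneg _))]
    nlinarith [weight_le (n + 1), weight_le (n + 1 + 1), weight_nonneg n, weight_nonneg (n + 1)]

/-- The weighted shift `v ↦ X (1 + P - 4 P²) v`, where `P` is `avg`. -/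
def wshift : Coeff →L[ℝ] Coeff := shift.comp (diag weight 2 abs_weight_le)

lemma wshift_zero (v : Coeff) : wshift v 0 = 0 := rfl
lemma wshift_succ (v : Coeff) (n : ℕ) : wshift v (n + 1) = weight n * v n := rfl

lemma wshift_sq : wshift * wshift =
    (shift.comp shift).comp (diag (fun n => weight (n + 1) * weight n) (3 / 2)
      abs_weight_mul_le) := by
  refine ContinuousLinearMap.ext fun v => lp.ext (funext fun n => ?_)
  rcases n with _ | _ | n
  · rfl
  · simp [wshift]
  · simp [wshift, mul_assoc]

lemma norm_wshift_sq_le : ‖wshift * wshift‖ ≤ 3 / 2 := by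
  rw [wshift_sq]
  refine (ContinuousLinearMap.opNorm_comp_le _ _).trans ?_
  have h1 : ‖shift.comp shift‖ ≤ 1 := (ContinuousLinearMap.opNorm_comp_le _ _).trans
    (mul_le_one₀ norm_shift_le (norm_nonneg _) norm_shift_le)
  calc _ ≤ 1 * (3 / 2 : ℝ) := mul_le_mul h1 (norm_diag_le _) (norm_nonneg _) zero_le_one
    _ = _ := one_mul _

/-- The linearized operator, up to a constant, is invertible. -/
lemma isUnit_linearization :
    IsUnit (1 - (3 / 4 : ℝ) • wshift : Coeff →L[ℝ] Coeff) := by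
  set N : Coeff →L[ℝ] Coeff := (3 / 4 : ℝ) • wshift with hN
  -- The norm bound for `N` itself is only `3/4 * 2`, too large for a Neumann series. But `N * N`
  -- has norm at most `9/16 * 3/2 < 1`, and `1 - N` is a commuting factor of `1 - N * N`.
  have hu : IsUnit (1 - N * N) := by
    apply isUnit_one_sub_of_norm_lt_one
    rw [hN, smul_mul_smul_comm, norm_smul]
    have := norm_wshift_sq_le
    rw [Real.norm_eq_abs]
    rw [show |(3 / 4 * (3 / 4) : ℝ)| = 9 / 16 by norm_num]
    linarith
  have hc : (1 - N) * (1 + N) = 1 - N * N := by noncomm_ring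
  have hcomm : Commute (1 - N) (1 + N) := by
    show (1 - N) * (1 + N) = (1 + N) * (1 - N)
    noncomm_ring
  rw [← hc] at hu
  exact (hcomm.isUnit_mul_iff.1 hu).1

/-! The unknown of the equation is `z = (η, v)`; then `q = 4 + η + X P² v`. -/

/-- The deviation `q - 4` of the squared radius. -/
def dev : ℝ × Coeff →L[ℝ] Coeff :=
  (ContinuousLinearMap.fst ℝ ℝ Coeff).smulRight one +
    (shift.comp (avg.comp avg)).comp (ContinuousLinearMap.snd ℝ ℝ Coeff)

lemma dev_apply (z : ℝ × Coeff) : dev z = z.1 • one + shift (avg (avg z.2)) := rfl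

/-- The operator `m q'' + c q'`. -/
def lead : ℝ × Coeff →L[ℝ] Coeff :=
  ((4 / 3 : ℝ) • ContinuousLinearMap.id ℝ Coeff - (2 / 3 : ℝ) • avg - shift).comp
    (ContinuousLinearMap.snd ℝ ℝ Coeff)

lemma lead_apply (z : ℝ × Coeff) :
    lead z = (4 / 3 : ℝ) • z.2 - (2 / 3 : ℝ) • avg z.2 - shift z.2 := rfl

/-- The operator `c q'`. -/
def first : ℝ × Coeff →L[ℝ] Coeff :=
  ((2 / 3 : ℝ) • avg - shift.comp avg).comp (ContinuousLinearMap.snd ℝ ℝ Coeff)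

lemma first_apply (z : ℝ × Coeff) :
    first z = (2 / 3 : ℝ) • avg z.2 - shift (avg z.2) := rfl

/-- The operator `m q'`, up to scaling. -/
def mfirst : ℝ × Coeff →L[ℝ] Coeff :=
  (shift.comp ((4 / 3 : ℝ) • avg - shift.comp avg)).comp (ContinuousLinearMap.snd ℝ ℝ Coeff)

lemma mfirst_apply (z : ℝ × Coeff) :
    mfirst z = shift ((4 / 3 : ℝ) • avg z.2 - shift (avg z.2)) := rfl

/-- The operator `v ↦ P v`, up to scaling the derivative `q'`. -/
def slope : ℝ × Coeff →L[ℝ] Coeff := avg.comp (ContinuousLinearMap.snd ℝ ℝ Coeff)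

lemma slope_apply (z : ℝ × Coeff) : slope z = avg z.2 := rfl

/-- The linear part of the equation. -/
def linPart : ℝ × Coeff →L[ℝ] Coeff := (64 : ℝ) • (lead + first + (4 : ℝ) • dev)

/-- The square of the deviation. -/
def devSq (z : ℝ × Coeff) : Coeff := mul (dev z) (dev z)

/-- The term `m (q')²`. -/
def quad (z : ℝ × Coeff) : Coeff := mul (mfirst z) (slope z)

/-- The term `c q' - 4 q + q²`. -/
def zeroth (z : ℝ × Coeff) : Coeff := first z + (4 : ℝ) • dev z + devSq z

/-- The part of the equation of order at least two. -/
def nonlinPart (z : ℝ × Coeff) : Coeff :=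
  (64 : ℝ) • devSq z + mul ((32 : ℝ) • dev z + (4 : ℝ) • devSq z) (lead z + zeroth z)
    - (16 : ℝ) • quad z - (4 : ℝ) • mul (dev z) (quad z) + mul (quad z) (zeroth z)

/-- The self-shrinker equation for the coefficients of the power series. -/
def eqn (z : ℝ × Coeff) : Coeff := linPart z + nonlinPart z

lemma contDiff_eqn {n : WithTop ℕ∞} : ContDiff ℝ n eqn := by
  unfold eqn nonlinPart zeroth quad devSq
  fun_prop

/-- In the product rule each summand keeps one undifferentiated factor, which vanishes at the
origin. Every term of `nonlinPart` is such a product. -/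
lemma hasFDerivAt_mul_zero {f g : ℝ × Coeff → Coeff} (hf : DifferentiableAt ℝ f 0)
    (hg : DifferentiableAt ℝ g 0) (hf0 : f 0 = 0) (hg0 : g 0 = 0) :
    HasFDerivAt (fun z => mul (f z) (g z)) (0 : ℝ × Coeff →L[ℝ] Coeff) 0 := by
  have h := mul.hasFDerivAt_of_bilinear hf.hasFDerivAt hg.hasFDerivAt
  rw [hf0, hg0] at h
  simpa using h

lemma hasFDerivAt_nonlinPart : HasFDerivAt nonlinPart (0 : ℝ × Coeff →L[ℝ] Coeff) 0 := by
  have d0 : devSq 0 = 0 := by simp [devSq]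
  have q0 : quad 0 = 0 := by simp [quad]
  have z0 : zeroth 0 = 0 := by simp [zeroth, d0]
  have dd : Differentiable ℝ devSq := by unfold devSq; fun_prop
  have dq : Differentiable ℝ quad := by unfold quad; fun_prop
  have dz : Differentiable ℝ zeroth := by unfold zeroth; fun_prop
  have h1 : HasFDerivAt devSq (0 : ℝ × Coeff →L[ℝ] Coeff) 0 :=
    hasFDerivAt_mul_zero (by fun_prop) (by fun_prop) (by simp) (by simp)
  have h2 : HasFDerivAt quad (0 : ℝ × Coeff →L[ℝ] Coeff) 0 :=
    hasFDerivAt_mul_zero (by fun_prop) (by fun_prop) (by simp) (by simp)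
  have h3 : HasFDerivAt (fun z => mul ((32 : ℝ) • dev z + (4 : ℝ) • devSq z) (lead z + zeroth z))
      (0 : ℝ × Coeff →L[ℝ] Coeff) 0 :=
    hasFDerivAt_mul_zero (by fun_prop) (by fun_prop) (by simp [d0]) (by simp [z0])
  have h4 : HasFDerivAt (fun z => mul (dev z) (quad z)) (0 : ℝ × Coeff →L[ℝ] Coeff) 0 :=
    hasFDerivAt_mul_zero (by fun_prop) (by fun_prop) (by simp) (by simp [q0])
  have h5 : HasFDerivAt (fun z => mul (quad z) (zeroth z)) (0 : ℝ × Coeff →L[ℝ] Coeff) 0 :=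
    hasFDerivAt_mul_zero (by fun_prop) (by fun_prop) (by simp [q0]) (by simp [z0])
  have := ((((h1.const_smul (64 : ℝ)).add h3).sub (h2.const_smul (16 : ℝ))).sub
    (h4.const_smul (4 : ℝ))).add h5
  simp only [smul_zero, add_zero, sub_zero] at this
  exact this

lemma hasFDerivAt_eqn : HasFDerivAt eqn linPart 0 := by
  have := linPart.hasFDerivAt.add hasFDerivAt_nonlinPart
  simpa using! this

lemma eqn_zero : eqn 0 = 0 := by
  have d0 : devSq 0 = 0 := by simp [devSq]
  have q0 : quad 0 = 0 := by simp [quad]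
  have z0 : zeroth 0 = 0 := by simp [zeroth, d0]
  simp [eqn, nonlinPart, d0, q0, z0]

/-- The terms `∓(2/3) P v` of `lead` and `first` cancel, where `P` is `avg`. What remains is `(4/3)
v - X (1 + P - 4 P²) v + 4 η`, with `X` the shift. -/
lemma linPart_apply (z : ℝ × Coeff) : linPart z = (256 / 3 : ℝ) •
    ((1 - (3 / 4 : ℝ) • wshift : Coeff →L[ℝ] Coeff) z.2 + (3 * z.1) • one) := by
  refine lp.ext (funext fun n => ?_)
  simp only [linPart, _root_.smul_apply, _root_.add_apply, dev_apply, lead_apply, first_apply,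
    _root_.sub_apply, one_apply_eq_self, smul_coord, add_coord, sub_coord]
  rcases n with _ | n
  · simp only [wshift_zero, one_zero, shift_zero, avg_apply]
    ring
  · simp only [wshift_succ, one_succ, shift_succ, avg_apply, weight]
    push_cast
    have : (n : ℝ) + 1 ≠ 0 := by positivity
    have : (n : ℝ) + 1 + 1 ≠ 0 := by positivity
    field_simp
    ring

lemma linPart_isInvertible :
    (linPart.comp (ContinuousLinearMap.inr ℝ ℝ Coeff)).IsInvertible := by
  have h : linPart.comp (ContinuousLinearMap.inr ℝ ℝ Coeff) =
      (256 / 3 : ℝ) • (1 - (3 / 4 : ℝ) • wshift : Coeff →L[ℝ] Coeff) := by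
    refine ContinuousLinearMap.ext fun v => ?_
    rw [ContinuousLinearMap.comp_apply, linPart_apply]
    simp
  rw [h]
  obtain ⟨u, hu⟩ := isUnit_linearization
  refine ⟨(ContinuousLinearEquiv.smulLeft (Units.mk0 (256 / 3 : ℝ) (by norm_num))).trans (ContinuousLinearEquiv.unitsEquiv ℝ Coeff u) , ?_⟩
  ext v
  simp [← hu]

/-- There is a curve of solutions of the equation through the origin. -/
lemma exists_solution_curve : ∃ v : ℝ → Coeff, v 0 = 0 ∧ (∀ᶠ t in nhds 0, ContDiffAt ℝ ∞ v t) ∧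
    ∀ᶠ t in nhds 0, eqn (t, v t) = 0 := by
  -- Analyticity is used because it passes from a point to a neighbourhood. Being `∞`-smooth at a
  -- point would only give `C^n` on neighbourhoods depending on `n`.
  have cdf : ContDiffAt ℝ ω eqn (0, 0) := contDiff_eqn.contDiffAt
  have pn : (ω : WithTop ℕ∞) ≠ 0 := by simp
  have hinv : (fderiv ℝ eqn (0, 0) ∘L .inr ℝ ℝ Coeff).IsInvertible := by
    rw [show ((0, 0) : ℝ × Coeff) = 0 from rfl, hasFDerivAt_eqn.fderiv]
    exact linPart_isInvertible
  refine ⟨cdf.implicitFunction pn hinv, cdf.implicitFunction_apply_self pn hinv, ?_, ?_⟩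
  · have h := (cdf.contDiffAt_implicitFunction pn hinv).eventually (by simp)
    filter_upwards [h] with t ht
    exact ht.of_le le_top
  · have h := cdf.eventually_apply_implicitFunction pn hinv
    filter_upwards [h] with t ht
    rw [ht]
    exact eqn_zero

end Coeff

/-! ### Evaluation of the equation, and the signs of the first variation at the rim. -/

namespace Coeff

/-- The equation in terms of the sums of the power series. -/
lemma ev_eqn {x : ℝ} (hx : |x| ≤ 1) (z : ℝ × Coeff) :
    let Q := 4 + ev x (dev z)
    let K := ev x (quad z)
    let α := ev x (lead z)
    let Γ := ev x (first z) - 4 * Q + Q ^ 2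
    ev x (eqn z) = 4 * Q ^ 2 * α - 4 * Q * K + (4 * Q ^ 2 + K) * Γ := by
  simp only [eqn, linPart, nonlinPart, zeroth, devSq, _root_.smul_apply, _root_.add_apply,
    ev_add hx, ev_sub hx, ev_smul, ev_mul hx]
  ring

/-- The coefficients at `η = 0` of the derivative of the solution with respect to `η`. -/
lemma eq_of_linPart_eq_zero {V : Coeff} (h : linPart (1, V) = 0) :
    V 0 = -3 ∧ ∀ n, V (n + 1) = 3 / 4 * (weight n * V n) := by
  rw [linPart_apply] at h
  have h2 := (smul_eq_zero.1 h).resolve_left (by norm_num)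
  have h3 : ∀ n, V n - 3 / 4 * wshift V n + 3 * 1 * one n = 0 := fun n =>
    congrArg (fun v : Coeff => v n) h2
  refine ⟨?_, fun n => ?_⟩
  · have := h3 0
    rw [wshift_zero, one_zero] at this
    linarith
  · have := h3 (n + 1)
    rw [wshift_succ, one_succ] at this
    linarith

/-- The recurrence gives `V 2 = 27/16`, so the term with `n = 0` is exactly `1/4`. The ratio of
consecutive terms is `(3/4) (2/3) = 1/2` times a factor which `weight_succ_mul_le` bounds by `1`. -/
lemma term_bounds {V : Coeff} (h0 : V 0 = -3) (h : ∀ n, V (n + 1) = 3 / 4 * (weight n * V n))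
    (n : ℕ) : 0 ≤ avg V (n + 2) * (2 / 3) ^ (n + 2) ∧
      avg V (n + 2) * (2 / 3) ^ (n + 2) ≤ 1 / 4 * (1 / 2) ^ n := by
  induction n with
  | zero =>
    have h1 := h 0
    have h2 := h 1
    rw [weight_zero, h0] at h1
    simp only [zero_add] at h1
    rw [weight_one, h1] at h2
    norm_num at h2
    simp only [avg_apply, zero_add, h2]
    norm_num
  | succ n ih =>
    have h1 := h (n + 2)
    have h2 := weight_succ_mul_le (n + 1)
    have h3 := weight_nonneg (n + 1)
    simp only [avg_apply] at ih ⊢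
    push_cast at ih h2 ⊢
    have hn : (0 : ℝ) ≤ n := Nat.cast_nonneg n
    have key : V (n + 1 + 2) / ((n : ℝ) + 1 + 2 + 1) * (2 / 3) ^ (n + 1 + 2) =
        1 / 2 * (weight (n + 1 + 1) * ((n : ℝ) + 1 + 2) / ((n : ℝ) + 1 + 3)) *
        (V (n + 2) / ((n : ℝ) + 2 + 1) * (2 / 3) ^ (n + 2)) := by
      rw [show n + 1 + 2 = n + 2 + 1 by ring, h1, show n + 1 + 1 = n + 2 by ring,
        show (n : ℝ) + 1 + 2 = n + 3 by ring, show (n : ℝ) + 2 + 1 = n + 3 by ring,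
        show (n : ℝ) + 3 + 1 = n + 4 by ring, show (n : ℝ) + 1 + 3 = n + 4 by ring]
      have : (n : ℝ) + 3 ≠ 0 := by positivity
      have : (n : ℝ) + 4 ≠ 0 := by positivity
      field_simp
      ring
    rw [key]
    have hr1 : weight (n + 1 + 1) * ((n : ℝ) + 1 + 2) / ((n : ℝ) + 1 + 3) ≤ 1 :=
      (div_le_one (by positivity)).2 h2
    have hr0 : 0 ≤ weight (n + 1 + 1) * ((n : ℝ) + 1 + 2) / ((n : ℝ) + 1 + 3) := by positivity
    refine ⟨mul_nonneg (by positivity) ih.1, ?_⟩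
    calc _ ≤ 1 / 2 * 1 * (1 / 4 * (1 / 2) ^ n : ℝ) :=
          mul_le_mul (by gcongr) ih.2 ih.1 (by norm_num)
      _ = _ := by ring

lemma first_terms {V : Coeff} (h0 : V 0 = -3) (h : ∀ n, V (n + 1) = 3 / 4 * (weight n * V n)) :
    V 1 = 9 / 2 := by
  have h1 := h 0
  rw [weight_zero, h0] at h1
  norm_num at h1
  exact h1

/-- The first two terms are `-3` and `3/2`, and the tail is at most `1/2`. The point `x = 2/3` is
the rim `w = 1`. -/
lemma ev_avg_neg {V : Coeff} (h0 : V 0 = -3) (h : ∀ n, V (n + 1) = 3 / 4 * (weight n * V n)) :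
    ev (2 / 3) (avg V) < 0 := by
  have hs := summable_ev (x := 2 / 3) (by norm_num [abs_le]) (avg V)
  unfold ev
  rw [← hs.sum_add_tsum_nat_add 2]
  have hg : Summable fun n : ℕ => (1 / 4 : ℝ) * (1 / 2) ^ n :=
    (summable_geometric_of_lt_one (by norm_num) (by norm_num)).mul_left _
  have h1 : ∑' n : ℕ, avg V (n + 2) * (2 / 3) ^ (n + 2) ≤ ∑' n : ℕ, (1 / 4 : ℝ) * (1 / 2) ^ n :=
    Summable.tsum_le_tsum (fun n => (term_bounds h0 h n).2)
      ((summable_nat_add_iff 2).2 hs) hg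
  rw [tsum_mul_left, tsum_geometric_two] at h1
  simp only [Finset.sum_range_succ, Finset.sum_range_zero, avg_apply, h0, first_terms h0 h] at h1 ⊢
  norm_num at h1 ⊢
  linarith

/-- The second averaging divides the tail terms by at least `3`, hence the constant `1/12`. The sum
is at most `1 + (2/3) (-3 + 3/4 + 1/6) < 0`. -/
lemma ev_shift_avg_avg_lt {V : Coeff} (h0 : V 0 = -3)
    (h : ∀ n, V (n + 1) = 3 / 4 * (weight n * V n)) :
    1 + ev (2 / 3) (shift (avg (avg V))) < 0 := by
  have hx : |(2 / 3 : ℝ)| ≤ 1 := by norm_num [abs_le]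
  have hs := summable_ev (x := 2 / 3) hx (avg (avg V))
  rw [ev_shift hx]
  unfold ev
  rw [← hs.sum_add_tsum_nat_add 2]
  have hg : Summable fun n : ℕ => (1 / 12 : ℝ) * (1 / 2) ^ n :=
    (summable_geometric_of_lt_one (by norm_num) (by norm_num)).mul_left _
  have h1 : ∑' n : ℕ, avg (avg V) (n + 2) * (2 / 3) ^ (n + 2)
      ≤ ∑' n : ℕ, (1 / 12 : ℝ) * (1 / 2) ^ n := by
    refine Summable.tsum_le_tsum (fun n => ?_) ((summable_nat_add_iff 2).2 hs) hg
    obtain ⟨b0, b1⟩ := term_bounds h0 h n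
    rw [avg_apply (avg V), div_mul_eq_mul_div]
    push_cast
    have hn : (0 : ℝ) ≤ n := Nat.cast_nonneg n
    rw [div_le_iff₀ (by positivity)]
    have hp : (0 : ℝ) ≤ (1 / 2) ^ n := by positivity
    nlinarith [mul_nonneg hn hp]
  rw [tsum_mul_left, tsum_geometric_two] at h1
  simp only [Finset.sum_range_succ, Finset.sum_range_zero, avg_apply, h0, first_terms h0 h] at h1 ⊢
  norm_num at h1 ⊢
  linarith

end Coeff

/-! ### From coefficients to solutions of the profile equation. -/

open Coeff

/-- The equation of rotational self-shrinkers for the squared distance `q` to the origin as a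
function of `w = 1 - cos φ`, where `φ` is the angle with the axis; `q₁` and `q₂` stand for the
first two derivatives of `q`. -/
def ProfileEquation (w q q₁ q₂ : ℝ) : Prop :=
  4 * q ^ 2 * (w * (2 - w) * q₂ + (1 - w) * q₁) - 4 * q * (w * (2 - w) * q₁ ^ 2) +
    (4 * q ^ 2 + w * (2 - w) * q₁ ^ 2) * ((1 - w) * q₁ - 4 * q + q ^ 2) = 0

/-- The family of solutions of the profile equation near the constant solution `4`. -/
theorem exists_profile : ∃ (ε : ℝ) (q q₁ q₂ : ℝ → ℝ → ℝ), 0 < ε ∧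
    ContDiffOn ℝ ∞ (fun p : ℝ × ℝ => q p.1 p.2) (Ioo (-ε) ε ×ˢ Ioo (-(3 / 2)) (3 / 2)) ∧
    ContDiffOn ℝ ∞ (fun p : ℝ × ℝ => q₁ p.1 p.2) (Ioo (-ε) ε ×ˢ Ioo (-(3 / 2)) (3 / 2)) ∧
    (∀ t ∈ Ioo (-ε) ε, ∀ w ∈ Ioo (-(3 / 2) : ℝ) (3 / 2), HasDerivAt (q t) (q₁ t w) w ∧
      HasDerivAt (q₁ t) (q₂ t w) w ∧ ProfileEquation w (q t w) (q₁ t w) (q₂ t w)) ∧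
    (∀ w, q 0 w = 4) ∧ (∀ w, q₁ 0 w = 0) ∧ (∀ t, q t 0 = 4 + t) ∧
    (∃ c < 0, HasDerivAt (fun t => q t 1) c 0) ∧ (∃ c < 0, HasDerivAt (fun t => q₁ t 1) c 0) := by
  obtain ⟨v, hv0, hvs, hve⟩ := exists_solution_curve
  obtain ⟨ε, hε, hball⟩ := Metric.eventually_nhds_iff_ball.1 (hvs.and hve)
  have hI : ∀ t ∈ Ioo (-ε) ε, ContDiffAt ℝ ∞ v t ∧ eqn (t, v t) = 0 := fun t ht =>
    hball t (by rw [Metric.mem_ball, Real.dist_eq, sub_zero]; exact abs_lt.2 ht)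
  -- The scaling by `2/3` carries this interval, which contains `[0, 1]` with room to spare, onto
  -- the open unit interval where evaluation is smooth.
  have hX : ∀ w ∈ Ioo (-(3 / 2) : ℝ) (3 / 2), |2 / 3 * w| < 1 := fun w hw => by
    rw [abs_lt]; constructor <;> linarith [hw.1, hw.2]
  have hsub : ∀ f : Coeff →L[ℝ] Coeff, ContDiffOn ℝ ∞
      (fun p : ℝ × ℝ => ev (2 / 3 * p.2) (f (v p.1)))
      (Ioo (-ε) ε ×ˢ Ioo (-(3 / 2)) (3 / 2)) := by
    rintro f ⟨t, w⟩ ⟨ht, hw⟩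
    have h1 := contDiffAt_ev (n := ∞) (hX w hw) (f (v t))
    have h2 : ContDiffAt ℝ ∞ (fun p : ℝ × ℝ => v p.1) (t, w) :=
      (hI t ht).1.comp (t, w) contDiffAt_fst
    have h3 : ContDiffAt ℝ ∞ (fun p : ℝ × ℝ => (2 / 3 * p.2, f (v p.1))) (t, w) :=
      (contDiffAt_const.mul contDiffAt_snd).prodMk (f.contDiff.contDiffAt.comp _ h2)
    exact (h1.comp (t, w) h3).contDiffWithinAt
  have hx23 : |(2 / 3 : ℝ)| < 1 := by norm_num [abs_lt]
  set q : ℝ → ℝ → ℝ := fun t w => 4 + t + ev (2 / 3 * w) (shift (avg (avg (v t)))) with hq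
  set q₁ : ℝ → ℝ → ℝ := fun t w => 2 / 3 * ev (2 / 3 * w) (avg (v t)) with hq₁
  have hd1 : ∀ t ∈ Ioo (-ε) ε, ∀ w ∈ Ioo (-(3 / 2) : ℝ) (3 / 2), HasDerivAt (q t) (q₁ t w) w := by
    intro t ht w hw
    have h := (hasDerivAt_ev_shift_avg (hX w hw) (avg (v t))).comp w
      ((hasDerivAt_id w).const_mul (2 / 3))
    have h' := h.const_add (4 + t)
    rw [mul_one, mul_comm] at h'
    exact h'
  have hdiff : ∀ t ∈ Ioo (-ε) ε, ∀ w ∈ Ioo (-(3 / 2) : ℝ) (3 / 2),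
      DifferentiableAt ℝ (q₁ t) w := by
    intro t ht w hw
    have h1 := (contDiffAt_ev (n := ∞) (hX w hw) (avg (v t))).differentiableAt (by simp)
    have h2 : DifferentiableAt ℝ (fun y : ℝ => ((2 / 3 * y, avg (v t)) : ℝ × Coeff)) w := by
      fun_prop
    exact (h1.comp w h2).const_mul _
  have hv : HasDerivAt v (deriv v 0) 0 :=
    ((hI 0 (by simp [hε])).1.differentiableAt (by simp)).hasDerivAt
  -- Differentiate `eqn (t, v t) = 0` at `t = 0`.
  have hlin : linPart (1, deriv v 0) = 0 := by
    have h1 : HasDerivAt (fun t : ℝ => ((t, v t) : ℝ × Coeff)) (1, deriv v 0) 0 :=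
      (hasDerivAt_id 0).prodMk hv
    have h2 : HasFDerivAt eqn linPart ((fun t : ℝ => ((t, v t) : ℝ × Coeff)) 0) := by
      simp only [hv0]
      exact hasFDerivAt_eqn
    have h3 := h2.comp_hasDerivAt 0 h1
    have h4 : (eqn ∘ fun t : ℝ => ((t, v t) : ℝ × Coeff)) =ᶠ[nhds 0] fun _ => 0 := by
      filter_upwards [hve] with t ht using ht
    exact (h3.congr_of_eventuallyEq h4.symm).unique (hasDerivAt_const 0 0)
  obtain ⟨hV0, hV⟩ := eq_of_linPart_eq_zero hlin
  have hevd : ∀ f : Coeff →L[ℝ] Coeff, HasDerivAt (fun t => ev (2 / 3) (f (v t)))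
      (ev (2 / 3) (f (deriv v 0))) 0 := by
    intro f
    have h := ((evCLM (2 / 3)).comp f).hasFDerivAt.comp_hasDerivAt 0 hv
    rw [ContinuousLinearMap.comp_apply, evCLM_apply hx23] at h
    refine h.congr_of_eventuallyEq (Filter.Eventually.of_forall fun t => ?_)
    exact (evCLM_apply hx23 _).symm
  refine ⟨ε, q, q₁, fun t w => deriv (q₁ t) w, hε, ?_, ?_, fun t ht w hw => ⟨hd1 t ht w hw,
    (hdiff t ht w hw).hasDerivAt, ?_⟩, ?_, ?_, ?_, ?_, ?_⟩
  · exact ((contDiff_const.add contDiff_fst).contDiffOn).add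
      (hsub (shift.comp (avg.comp avg)))
  · exact contDiffOn_const.mul (hsub avg)
  · have hx := hX w hw
    have key := ev_eqn hx.le (t, v t)
    rw [(hI t ht).2] at key
    have hz : ev (2 / 3 * w) 0 = 0 := by simp [ev]
    have hdq : 4 + ev (2 / 3 * w) (dev (t, v t)) = q t w := by
      rw [dev_apply, ev_add hx.le, ev_smul, ev_one, hq]
      ring
    -- The second derivative occurs in the equation only with the factor `w`. So it is read off from
    -- the derivative of `w q₁(w)`, whose series is `shift (avg v)`, and no division by `w` is
    -- needed.
    have hq2 : w * deriv (q₁ t) w =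
        2 / 3 * (ev (2 / 3 * w) (v t) - ev (2 / 3 * w) (avg (v t))) := by
      have h1 : HasDerivAt (fun y => ev (2 / 3 * y) (shift (avg (v t))))
          (2 / 3 * ev (2 / 3 * w) (v t)) w := by
        have h := (hasDerivAt_ev_shift_avg hx (v t)).comp w
          ((hasDerivAt_id w).const_mul (2 / 3))
        rw [mul_one, mul_comm] at h
        exact h
      have h2 : HasDerivAt (fun y => y * q₁ t y) (1 * q₁ t w + w * deriv (q₁ t) w) w :=
        (hasDerivAt_id w).mul (hdiff t ht w hw).hasDerivAt
      have h3 : (fun y => y * q₁ t y) =ᶠ[nhds w] fun y => ev (2 / 3 * y) (shift (avg (v t))) := by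
        filter_upwards [isOpen_Ioo.mem_nhds hw] with y hy
        rw [ev_shift (hX y hy).le, hq₁]
        ring
      have h4 := (h1.congr_of_eventuallyEq h3).unique h2
      simp only [hq₁] at h4 ⊢
      linarith
    have hK : ev (2 / 3 * w) (quad (t, v t)) = w * (2 - w) * q₁ t w ^ 2 := by
      rw [quad, ev_mul hx.le, mfirst_apply, slope_apply, ev_shift hx.le, ev_sub hx.le, ev_smul,
        ev_shift hx.le]
      simp only [hq₁]
      ring
    have hF : ev (2 / 3 * w) (first (t, v t)) = (1 - w) * q₁ t w := by
      rw [first_apply, ev_sub hx.le, ev_smul, ev_shift hx.le]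
      simp only [hq₁]
      ring
    have hL : ev (2 / 3 * w) (lead (t, v t)) =
        w * (2 - w) * deriv (q₁ t) w + (1 - w) * q₁ t w := by
      rw [lead_apply, ev_sub hx.le, ev_sub hx.le, ev_smul, ev_smul, ev_shift hx.le]
      rw [show w * (2 - w) * deriv (q₁ t) w = (2 - w) * (w * deriv (q₁ t) w) by ring, hq2]
      simp only [hq₁]
      ring
    simp only [hz, hdq, hK, hF, hL] at key
    exact key.symm
  · intro w
    simp [hq, hv0, ev]
  · intro w
    simp [hq₁, hv0, ev]
  · intro t
    simp [hq, ev_zero]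
  · refine ⟨_, ev_shift_avg_avg_lt hV0 hV, ?_⟩
    have h := (((hasDerivAt_id (0 : ℝ)).const_add 4).add (hevd (shift.comp (avg.comp avg))))
    refine h.congr_of_eventuallyEq (Filter.Eventually.of_forall fun t => ?_)
    simp [hq]
  · refine ⟨2 / 3 * _, mul_neg_of_pos_of_neg (by norm_num) (ev_avg_neg hV0 hV), ?_⟩
    have h := (hevd avg).const_mul (2 / 3)
    refine h.congr_of_eventuallyEq (Filter.Eventually.of_forall fun t => ?_)
    simp [hq₁]

/-! ### Integrals depending on a parameter -/

section ParametricIntegral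

variable {P : Type} [NormedAddCommGroup P] [NormedSpace ℝ P]

/-- Dominated differentiation with a constant bound: as `[0, 1]` is compact, the derivative of `F`
is bounded on `{x} × [0, 1]` uniformly for `x` near `p`. -/
lemma hasFDerivAt_integral_of_contDiffAt {E : Type} [NormedAddCommGroup E] [NormedSpace ℝ E]
    [CompleteSpace E] {F : P × ℝ → E} {O : Set P} (hO : IsOpen O)
    (hF : ∀ p ∈ O, ∀ s ∈ Icc (0 : ℝ) 1, ContDiffAt ℝ ∞ F (p, s)) {p : P} (hp : p ∈ O) :
    HasFDerivAt (fun p => ∫ s in (0 : ℝ)..1, F (p, s))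
      (∫ s in (0 : ℝ)..1, (fderiv ℝ F (p, s)).comp (ContinuousLinearMap.inl ℝ P ℝ)) p := by
  have hcont : ∀ p ∈ O, ContinuousOn (fun s => F (p, s)) (Icc 0 1) := fun p hp s hs =>
    ((hF p hp s hs).continuousAt.comp (f := fun s => (p, s))
      (by fun_prop)).continuousWithinAt
  have hcont' : ∀ s ∈ Icc (0 : ℝ) 1, ContinuousAt (fderiv ℝ F) (p, s) := fun s hs =>
    ((hF p hp s hs).fderiv_right (m := 0) (by simp)).continuousAt
  have hslice : ContinuousOn (fun s => fderiv ℝ F (p, s)) (Icc 0 1) := fun s hs =>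
    ((hcont' s hs).comp (f := fun s => (p, s)) (by fun_prop)).continuousWithinAt
  obtain ⟨C, hC⟩ := isCompact_Icc.exists_bound_of_continuousOn hslice
  have hev : ∀ᶠ x in nhds p, ∀ s ∈ Icc (0 : ℝ) 1, ‖fderiv ℝ F (x, s)‖ ≤ C + 1 := by
    refine isCompact_Icc.eventually_forall_of_forall_eventually fun s hs => ?_
    have : ‖fderiv ℝ F (p, s)‖ < C + 1 := (hC s hs).trans_lt (by linarith)
    filter_upwards [(hcont' s hs).norm.eventually_lt continuousAt_const this] with z hz using hz.le
  have hu : uIoc (0 : ℝ) 1 ⊆ Icc 0 1 := by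
    rw [uIoc_of_le zero_le_one]; exact Ioc_subset_Icc_self
  have hmeas : ∀ {Y : Type} [NormedAddCommGroup Y] {g : ℝ → Y}, ContinuousOn g (Icc 0 1) →
      MeasureTheory.AEStronglyMeasurable g (MeasureTheory.volume.restrict (uIoc 0 1)) :=
    fun hg => (hg.mono hu).aestronglyMeasurable_of_isSeparable measurableSet_uIoc
        (TopologicalSpace.IsSeparable.of_separableSpace _)
  refine intervalIntegral.hasFDerivAt_integral_of_dominated_of_fderiv_le
    (F := fun p s => F (p, s)) (bound := fun _ => C + 1)
    (F' := fun p s => (fderiv ℝ F (p, s)).comp (ContinuousLinearMap.inl ℝ P ℝ))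
    (Filter.inter_mem hev (hO.mem_nhds hp)) ?_ ?_ ?_ ?_ ?_ ?_
  · filter_upwards [hO.mem_nhds hp] with x hx using hmeas (hcont x hx)
  · exact (hcont p hp).intervalIntegrable_of_Icc zero_le_one
  · exact hmeas (hslice.clm_comp continuousOn_const)
  · refine Filter.Eventually.of_forall fun s hs x hx => ?_
    refine (ContinuousLinearMap.opNorm_comp_le _ _).trans ?_
    calc _ ≤ (C + 1) * 1 := mul_le_mul (hx.1 s (hu hs)) (ContinuousLinearMap.norm_inl_le_one ℝ P ℝ)
          (norm_nonneg _) ((norm_nonneg _).trans (hx.1 s (hu hs)))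
      _ = _ := mul_one _
  · exact intervalIntegrable_const
  · refine Filter.Eventually.of_forall fun s hs x hx => ?_
    have h1 := ((hF x hx.2 s (hu hs)).differentiableAt (by simp)).hasFDerivAt
    have h2 : HasFDerivAt (fun x : P => (x, s)) (ContinuousLinearMap.inl ℝ P ℝ) x :=
      hasFDerivAt_prodMk_left x s
    exact h1.comp x h2

/-- The derivative is again an integral of this kind, with values in `P →L[ℝ] E`; hence the target
space varies in the induction. -/
lemma contDiffOn_integral_nat (n : ℕ) : ∀ {E : Type} [NormedAddCommGroup E] [NormedSpace ℝ E]
    [CompleteSpace E] {F : P × ℝ → E} {O : Set P} (_ : IsOpen O)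
    (_ : ∀ p ∈ O, ∀ s ∈ Icc (0 : ℝ) 1, ContDiffAt ℝ ∞ F (p, s)),
    ContDiffOn ℝ n (fun p => ∫ s in (0 : ℝ)..1, F (p, s)) O := by
  induction n with
  | zero =>
    intro E _ _ _ F O hO hF
    rw [Nat.cast_zero, contDiffOn_zero]
    exact fun p hp =>
      (hasFDerivAt_integral_of_contDiffAt hO hF hp).continuousAt.continuousWithinAt
  | succ n ih =>
    intro E _ _ _ F O hO hF
    rw [Nat.cast_succ, contDiffOn_succ_iff_fderiv_of_isOpen hO]
    refine ⟨fun p hp => (hasFDerivAt_integral_of_contDiffAt hO hF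
      hp).differentiableAt.differentiableWithinAt, by simp, ?_⟩
    refine (ih (F := fun z => (fderiv ℝ F z).comp (ContinuousLinearMap.inl ℝ P ℝ)) hO
      fun p hp s hs => ?_).congr fun p hp =>
        (hasFDerivAt_integral_of_contDiffAt hO hF hp).fderiv
    exact ((hF p hp s hs).fderiv_right (by simp)).clm_comp contDiffAt_const

lemma contDiffOn_integral {E : Type} [NormedAddCommGroup E] [NormedSpace ℝ E]
    [CompleteSpace E] {F : P × ℝ → E} {O : Set P} (hO : IsOpen O)
    (hF : ∀ p ∈ O, ∀ s ∈ Icc (0 : ℝ) 1, ContDiffAt ℝ ∞ F (p, s)) :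
    ContDiffOn ℝ ∞ (fun p => ∫ s in (0 : ℝ)..1, F (p, s)) O :=
  contDiffOn_infty.2 fun n => contDiffOn_integral_nat n hO hF

end ParametricIntegral

/-! ### Smooth inverse maps -/

/-- A smooth injective map with injective derivative on an open set of a finite-dimensional space
has an open image and a smooth inverse. -/
lemma exists_smooth_inverse {E : Type*} [NormedAddCommGroup E] [NormedSpace ℝ E]
    [FiniteDimensional ℝ E] {G : E → E} {s : Set E} (hs : IsOpen s) (hG : ContDiffOn ℝ ∞ G s)
    (hinj : InjOn G s) (hd : ∀ x ∈ s, Function.Injective (fderiv ℝ G x)) :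
    IsOpen (G '' s) ∧ ∃ g : E → E, ContDiffOn ℝ ∞ g (G '' s) ∧ ∀ x ∈ s, g (G x) = x := by
  have : CompleteSpace E := FiniteDimensional.complete ℝ E
  rcases s.eq_empty_or_nonempty with rfl | ⟨x₀, hx₀⟩
  · exact ⟨by simp, id, by simp, by simp⟩
  have : Nonempty E := ⟨x₀⟩
  have hleft : ∀ x ∈ s, Function.invFunOn G s (G x) = x := fun x hx => hinj.leftInvOn_invFunOn hx
  -- The local inverses take values in `s`, where `G` is injective. So each of them coincides near
  -- `G x` with the global inverse, which inherits its smoothness.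
  have key : ∀ x ∈ s, ∃ l : E → E, ContDiffAt ℝ ∞ l (G x) ∧
      ∀ᶠ y in nhds (G x), l y ∈ s ∧ G (l y) = y := by
    intro x hx
    have hGx : ContDiffAt ℝ ∞ G x := hG.contDiffAt (hs.mem_nhds hx)
    let e : E ≃L[ℝ] E := (LinearEquiv.ofInjectiveEndo (fderiv ℝ G x : E →ₗ[ℝ] E)
      (hd x hx)).toContinuousLinearEquiv
    have he : HasFDerivAt G (e : E →L[ℝ] E) x := by
      have : (e : E →L[ℝ] E) = fderiv ℝ G x := by ext v; rfl
      rw [this]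
      exact (hGx.differentiableAt (by simp)).hasFDerivAt
    have hl := hGx.to_localInverse he (by simp)
    have hst := hGx.hasStrictFDerivAt' he (by simp)
    refine ⟨hGx.localInverse he (by simp), hl, ?_⟩
    have h1 := hst.eventually_right_inverse
    have h2 : ∀ᶠ y in nhds (G x), hGx.localInverse he (by simp) y ∈ s := by
      apply hl.continuousAt.eventually_mem
      rw [hGx.localInverse_apply_image he (by simp)]
      exact hs.mem_nhds hx
    filter_upwards [h1, h2] with y hy1 hy2 using ⟨hy2, hy1⟩
  refine ⟨?_, Function.invFunOn G s, ?_, hleft⟩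
  · rw [isOpen_iff_mem_nhds]
    rintro _ ⟨x, hx, rfl⟩
    obtain ⟨l, -, hl⟩ := key x hx
    filter_upwards [hl] with y hy using ⟨l y, hy.1, hy.2⟩
  · rintro _ ⟨x, hx, rfl⟩
    obtain ⟨l, hl, hev⟩ := key x hx
    refine ContDiffAt.contDiffWithinAt (hl.congr_of_eventuallyEq ?_)
    filter_upwards [hev] with y hy
    conv_lhs => rw [← hy.2]
    exact hleft _ hy.1

/-! ### Orientation-reversing diffeomorphisms -/

/-- All radii below `δ₁` are allowed, so that two functions can later be given a common domain. The
image is the interval between the values at the endpoints, by monotonicity and the intermediate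
value theorem. -/
lemma exists_isOrientationReversingDiffeo {f : ℝ → ℝ} {x δ₀ : ℝ} (hδ₀ : 0 < δ₀)
    (hf : ContDiffOn ℝ ∞ f (Ioo (x - δ₀) (x + δ₀))) (hneg : deriv f x < 0) :
    ∃ δ₁ > 0, ∀ δ, 0 < δ → δ ≤ δ₁ → ∃ a > 0, ∃ b > 0,
      IsOrientationReversingDiffeo f (Ioo (x - δ) (x + δ)) (Ioo (f x - a) (f x + b)) := by
  have hmem : Ioo (x - δ₀) (x + δ₀) ∈ nhds x := Ioo_mem_nhds (by linarith) (by linarith)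
  have hc : ContinuousAt (deriv f) x :=
    (((contDiffOn_infty_iff_deriv_of_isOpen isOpen_Ioo).1 hf).2.continuousOn).continuousAt hmem
  have hev : ∀ᶠ y in nhds x, deriv f y < 0 ∧ y ∈ Ioo (x - δ₀) (x + δ₀) :=
    (hc.eventually_lt continuousAt_const hneg).and hmem
  obtain ⟨r, hr, hball⟩ := Metric.eventually_nhds_iff_ball.1 hev
  refine ⟨r / 2, by linarith, fun δ hδ hδr => ?_⟩
  have hI : ∀ y ∈ Icc (x - δ) (x + δ), deriv f y < 0 ∧ y ∈ Ioo (x - δ₀) (x + δ₀) := by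
    intro y hy
    apply hball
    rw [Metric.mem_ball, Real.dist_eq, abs_lt]
    constructor <;> linarith [hy.1, hy.2]
  have hcont : ContinuousOn f (Icc (x - δ) (x + δ)) :=
    hf.continuousOn.mono fun y hy => (hI y hy).2
  have hanti : StrictAntiOn f (Icc (x - δ) (x + δ)) := by
    refine strictAntiOn_of_deriv_neg (convex_Icc _ _) hcont fun y hy => ?_
    rw [interior_Icc] at hy
    exact (hI y (Ioo_subset_Icc_self hy)).1
  have hx : x ∈ Icc (x - δ) (x + δ) := ⟨by linarith, by linarith⟩
  have hl : x - δ ∈ Icc (x - δ) (x + δ) := ⟨le_rfl, by linarith⟩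
  have hr' : x + δ ∈ Icc (x - δ) (x + δ) := ⟨by linarith, le_rfl⟩
  refine ⟨f x - f (x + δ), sub_pos.2 (hanti hx hr' (by linarith)), f (x - δ) - f x,
    sub_pos.2 (hanti hl hx (by linarith)), ?_, ?_, fun y hy => (hI y (Ioo_subset_Icc_self hy)).1⟩
  · exact hf.mono fun y hy => (hI y (Ioo_subset_Icc_self hy)).2
  · rw [sub_sub_cancel, add_sub_cancel]
    refine ⟨fun y hy => ⟨hanti (Ioo_subset_Icc_self hy) hr' hy.2,
      hanti hl (Ioo_subset_Icc_self hy) hy.1⟩, (hanti.mono Ioo_subset_Icc_self).injOn, ?_⟩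
    exact intermediate_value_Ioo' (by linarith) hcont

/-! ### Bounds for derivatives on the cylinder -/

/-- The covering of the punctured disc by the half plane. -/
def cyl (u : E2) : ℂ := Complex.exp (-(u 0 : ℂ) + u 1 * Complex.I)

lemma cyl_zero : cyl 0 = 1 := by simp [cyl]

lemma cyl_add (u v : E2) : cyl (u + v) = cyl u * cyl v := by
  rw [cyl, cyl, cyl, ← Complex.exp_add]
  congr 1
  simp
  ring

lemma norm_cyl (u : E2) : ‖cyl u‖ = Real.exp (-u 0) := by
  rw [cyl, Complex.norm_exp]
  simp

lemma norm_cyl_le {u : E2} (hu : u ∈ halfPlane) : ‖cyl u‖ ≤ 1 := by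
  rw [norm_cyl, Real.exp_le_one_iff]
  have : 0 ≤ u 0 := hu
  linarith

lemma contDiff_cyl : ContDiff ℝ ∞ cyl := by
  have h0 : ContDiff ℝ ∞ fun u : E2 => (u 0 : ℂ) :=
    Complex.ofRealCLM.contDiff.comp (EuclideanSpace.proj (𝕜 := ℝ) (0 : Fin 2)).contDiff
  have h1 : ContDiff ℝ ∞ fun u : E2 => (u 1 : ℂ) :=
    Complex.ofRealCLM.contDiff.comp (EuclideanSpace.proj (𝕜 := ℝ) (1 : Fin 2)).contDiff
  exact (h0.neg.add (h1.mul contDiff_const)).cexp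

/-- All derivatives of the composition with `cyl` of a map which is smooth near the closed disc are
bounded. -/
lemma exists_bound_iteratedFDeriv {F : ℝ × ℂ → E3} {O : Set (ℝ × ℂ)} {δ : ℝ} (hO : IsOpen O)
    (hF : ContDiffOn ℝ ∞ F O) (hsub : Icc (-δ) δ ×ˢ Metric.closedBall 0 1 ⊆ O) (k : ℕ) :
    ∃ C, ∀ θ ∈ Icc (-δ) δ, ∀ p ∈ halfPlane,
      ‖iteratedFDeriv ℝ k (fun u => F (θ, cyl u)) p‖ ≤ C := by
  -- Since `cyl (p + u) = cyl p * cyl u`, the derivatives at a point `p` of the unbounded half plane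
  -- are derivatives in `u` at `u = 0` of one map, with `cyl p` as a parameter in the compact disc.
  set g : (ℝ × ℂ) × E2 → ℝ × ℂ := fun z => (z.1.1, z.1.2 * cyl z.2) with hg
  have hgs : ContDiff ℝ ∞ g := by
    have := contDiff_cyl
    rw [hg]
    fun_prop
  set O' := g ⁻¹' O with hO'def
  have hO' : IsOpen O' := hO.preimage hgs.continuous
  have hΦ : ContDiffOn ℝ ∞ (F ∘ g) O' := hF.comp hgs.contDiffOn fun z hz => hz
  have hcont : ContinuousOn (iteratedFDeriv ℝ k (F ∘ g)) O' :=
    (hΦ.continuousOn_iteratedFDerivWithin (m := k) (by exact_mod_cast le_top)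
      hO'.uniqueDiffOn).congr fun z hz => (iteratedFDerivWithin_of_isOpen k hO' hz).symm
  have hK : (Icc (-δ) δ ×ˢ Metric.closedBall (0 : ℂ) 1) ×ˢ ({0} : Set E2) ⊆ O' := by
    rintro ⟨⟨θ, l⟩, u⟩ ⟨h, hu⟩
    rw [mem_singleton_iff] at hu
    simp only at hu h
    simp only [hO'def, mem_preimage, hg, hu, cyl_zero, mul_one]
    exact hsub h
  obtain ⟨C, hC⟩ := ((isCompact_Icc.prod (isCompact_closedBall (0 : ℂ) 1)).prod
    isCompact_singleton).exists_bound_of_continuousOn (hcont.mono hK)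
  refine ⟨C, fun θ hθ p hp => ?_⟩
  have hmem : (((θ, cyl p), 0) : (ℝ × ℂ) × E2) ∈
      (Icc (-δ) δ ×ˢ Metric.closedBall (0 : ℂ) 1) ×ˢ ({0} : Set E2) :=
    ⟨⟨hθ, by simpa using norm_cyl_le hp⟩, rfl⟩
  set z₀ : (ℝ × ℂ) × E2 := ((θ, cyl p), 0) with hz₀
  have h1 : (fun u => F (θ, cyl u)) =
      fun u => ((fun z => (F ∘ g) (z₀ + z)) ∘ ContinuousLinearMap.inr ℝ (ℝ × ℂ) E2) (u - p) := by
    funext u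
    simp only [Function.comp_apply, ContinuousLinearMap.inr_apply, hz₀, hg]
    simp [← cyl_add]
  rw [h1, iteratedFDeriv_comp_sub, sub_self]
  set O'' : Set ((ℝ × ℂ) × E2) := (fun z => z₀ + z) ⁻¹' O' with hO''def
  have hO'' : IsOpen O'' := hO'.preimage (by fun_prop)
  have hΨ : ContDiffOn ℝ ∞ (fun z => (F ∘ g) (z₀ + z)) O'' :=
    hΦ.comp (by fun_prop) fun z hz => hz
  have h0 : (0 : (ℝ × ℂ) × E2) ∈ O'' := by
    rw [hO''def, mem_preimage, add_zero]
    exact hK hmem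
  have hpre : IsOpen (ContinuousLinearMap.inr ℝ (ℝ × ℂ) E2 ⁻¹' O'') :=
    hO''.preimage (ContinuousLinearMap.continuous _)
  have h2 := (ContinuousLinearMap.inr ℝ (ℝ × ℂ) E2).iteratedFDerivWithin_comp_right hΨ
    hO''.uniqueDiffOn hpre.uniqueDiffOn (x := 0) (by rw [map_zero]; exact h0) (i := k)
    (by exact_mod_cast le_top)
  rw [iteratedFDerivWithin_of_isOpen k hpre (by rw [mem_preimage, map_zero]; exact h0), map_zero,
    iteratedFDerivWithin_of_isOpen k hO'' h0, iteratedFDeriv_comp_add_left, add_zero] at h2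
  rw [h2]
  refine (ContinuousMultilinearMap.norm_compContinuousLinearMap_le _ _).trans ?_
  refine le_trans ?_ (hC z₀ hmem)
  refine mul_le_of_le_one_right (norm_nonneg _) ?_
  exact Finset.prod_le_one (fun _ _ => norm_nonneg _)
    fun _ _ => ContinuousLinearMap.norm_inr_le_one ℝ (ℝ × ℂ) E2

/-! ### Partial derivatives of explicit parametrizations -/

lemma pd_eq_of_hasDerivAt {i : Fin 2} {φ : E2 → E3} {u : E2} {v : E3}
    (hφ : DifferentiableAt ℝ φ u)
    (h : ∀ j, HasDerivAt (fun t : ℝ => φ (u + t • EuclideanSpace.single i 1) j) (v j) 0) :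
    pd i φ u = v := by
  have hl : HasDerivAt (fun t : ℝ => u + t • (EuclideanSpace.single i 1 : E2))
      (EuclideanSpace.single i 1) 0 := by
    simpa using ((hasDerivAt_id (0 : ℝ)).smul_const (EuclideanSpace.single i 1 : E2)).const_add u
  have hφ' : HasFDerivAt φ (fderiv ℝ φ u)
      ((fun t : ℝ => u + t • (EuclideanSpace.single i 1 : E2)) 0) := by
    simpa using hφ.hasFDerivAt
  have hc := hφ'.comp_hasDerivAt 0 hl
  ext j
  have hj := (EuclideanSpace.proj (𝕜 := ℝ) j : E3 →L[ℝ] ℝ).hasFDerivAt.comp_hasDerivAt 0 hc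
  exact hj.unique (h j)

lemma pd_congr {i : Fin 2} {φ ψ : E2 → E3} {u : E2} (h : φ =ᶠ[nhds u] ψ) :
    pd i φ u = pd i ψ u := by
  rw [pd, pd, h.fderiv_eq]

lemma contDiffAt_pd {i : Fin 2} {φ : E2 → E3} {u : E2} (h : ContDiffAt ℝ ∞ φ u) :
    ContDiffAt ℝ ∞ (pd i φ) u :=
  (h.fderiv_right (m := ∞) (by simp)).clm_apply contDiffAt_const

lemma inner_E3 (v w : E3) : ⟪v, w⟫ = v 0 * w 0 + v 1 * w 1 + v 2 * w 2 := by
  rw [PiLp.inner_apply, Fin.sum_univ_three]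
  simp [mul_comm]

lemma norm_sq_E3 (v : E3) : ‖v‖ ^ 2 = v 0 ^ 2 + v 1 ^ 2 + v 2 ^ 2 := by
  rw [← real_inner_self_eq_norm_sq, inner_E3]; ring

lemma contDiffAt_mk3 {V : Type*} [NormedAddCommGroup V] [NormedSpace ℝ V] {n : WithTop ℕ∞}
    {f g h : V → ℝ} {u : V}
    (hf : ContDiffAt ℝ n f u) (hg : ContDiffAt ℝ n g u) (hh : ContDiffAt ℝ n h u) :
    ContDiffAt ℝ n (fun u => (!₂[f u, g u, h u] : E3)) u := by
  rw [contDiffAt_euclidean]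
  intro i
  fin_cases i
  exacts [hf, hg, hh]

lemma contDiff_coord {n : WithTop ℕ∞} {ι : Type*} [Fintype ι] (i : ι) :
    ContDiff ℝ n fun u : EuclideanSpace ℝ ι => u i :=
  (EuclideanSpace.proj (𝕜 := ℝ) i).contDiff

/-! ### Surfaces of revolution in polar coordinates -/

/-- The surface of revolution about the `y`-axis with profile curve `(x, y)`. -/
def revParam (x y : ℝ → ℝ) (u : E2) : E3 :=
  !₂[x (u 0) * Real.cos (u 1), y (u 0), x (u 0) * Real.sin (u 1)]

lemma contDiffAt_revParam {x y : ℝ → ℝ} {u : E2} (hx : ContDiffAt ℝ ∞ x (u 0))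
    (hy : ContDiffAt ℝ ∞ y (u 0)) : ContDiffAt ℝ ∞ (revParam x y) u := by
  have h0 : ContDiffAt ℝ ∞ (fun u : E2 => u 0) u := (contDiff_coord 0).contDiffAt
  have h1 : ContDiffAt ℝ ∞ (fun u : E2 => u 1) u := (contDiff_coord 1).contDiffAt
  have hx' : ContDiffAt ℝ ∞ (fun u : E2 => x (u 0)) u := hx.comp u h0
  exact contDiffAt_mk3 (hx'.mul h1.cos) (hy.comp u h0) (hx'.mul h1.sin)

lemma pd_zero_revParam {x y : ℝ → ℝ} {x₁ y₁ : ℝ} {u : E2} (h : DifferentiableAt ℝ (revParam x y) u)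
    (hx : HasDerivAt x x₁ (u 0)) (hy : HasDerivAt y y₁ (u 0)) :
    pd 0 (revParam x y) u = !₂[x₁ * Real.cos (u 1), y₁, x₁ * Real.sin (u 1)] := by
  have hx' : HasDerivAt x x₁ (u 0 + 0) := by rwa [add_zero]
  have hy' : HasDerivAt y y₁ (u 0 + 0) := by rwa [add_zero]
  have hxt : HasDerivAt (fun t : ℝ => x (u 0 + t)) x₁ 0 := hx'.comp_const_add _ _
  have hyt : HasDerivAt (fun t : ℝ => y (u 0 + t)) y₁ 0 := hy'.comp_const_add _ _
  refine pd_eq_of_hasDerivAt h fun j => ?_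
  fin_cases j
  · simpa [revParam] using hxt.mul_const (Real.cos (u 1))
  · simpa [revParam] using hyt
  · simpa [revParam] using hxt.mul_const (Real.sin (u 1))

lemma pd_one_revParam {x y : ℝ → ℝ} {u : E2} (h : DifferentiableAt ℝ (revParam x y) u) :
    pd 1 (revParam x y) u = !₂[-(x (u 0) * Real.sin (u 1)), 0, x (u 0) * Real.cos (u 1)] := by
  have hl : HasDerivAt (fun t : ℝ => u 1 + t) 1 0 := (hasDerivAt_id (0 : ℝ)).const_add _
  refine pd_eq_of_hasDerivAt h fun j => ?_
  fin_cases j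
  · simpa [revParam] using hl.cos.const_mul (x (u 0))
  · simpa [revParam] using hasDerivAt_const (0 : ℝ) (y (u 0))
  · simpa [revParam] using hl.sin.const_mul (x (u 0))

/-- The self-shrinker equation for a surface of revolution, in terms of its profile curve. -/
lemma shrinkerEquationAt_revParam {x y x₁ y₁ : ℝ → ℝ} {x₂ y₂ : ℝ} {u : E2} {J : Set ℝ}
    (hJ : IsOpen J) (hu : u 0 ∈ J) (hx : ContDiffOn ℝ ∞ x J) (hy : ContDiffOn ℝ ∞ y J)
    (hx₁ : ∀ s ∈ J, HasDerivAt x (x₁ s) s) (hy₁ : ∀ s ∈ J, HasDerivAt y (y₁ s) s)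
    (hx₂ : HasDerivAt x₁ x₂ (u 0)) (hy₂ : HasDerivAt y₁ y₂ (u 0)) (hx0 : x (u 0) ≠ 0)
    (hE : x₁ (u 0) ^ 2 + y₁ (u 0) ^ 2 ≠ 0)
    (heq : -2 * x (u 0) * (x₂ * y₁ (u 0) - y₂ * x₁ (u 0)) +
      (x₁ (u 0) ^ 2 + y₁ (u 0) ^ 2) * (2 * y₁ (u 0) -
        x (u 0) * (x (u 0) * y₁ (u 0) - y (u 0) * x₁ (u 0))) = 0) :
    ShrinkerEquationAt (revParam x y) u := by
  have hev : ∀ᶠ v : E2 in nhds u, v 0 ∈ J :=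
    (contDiff_coord (n := 0) (0 : Fin 2)).continuous.continuousAt.eventually_mem (hJ.mem_nhds hu)
  have hsm : ∀ v : E2, v 0 ∈ J → ContDiffAt ℝ ∞ (revParam x y) v := fun v hv =>
    contDiffAt_revParam (hx.contDiffAt (hJ.mem_nhds hv)) (hy.contDiffAt (hJ.mem_nhds hv))
  have hdf : ∀ v : E2, v 0 ∈ J → DifferentiableAt ℝ (revParam x y) v := fun v hv =>
    (hsm v hv).differentiableAt (by simp)
  have e0 : pd 0 (revParam x y) =ᶠ[nhds u] revParam x₁ y₁ := by
    filter_upwards [hev] with v hv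
    exact pd_zero_revParam (hdf v hv) (hx₁ _ hv) (hy₁ _ hv)
  have e1 : pd 1 (revParam x y) =ᶠ[nhds u]
      fun v => !₂[-(x (v 0) * Real.sin (v 1)), 0, x (v 0) * Real.cos (v 1)] := by
    filter_upwards [hev] with v hv
    exact pd_one_revParam (hdf v hv)
  have d0 := ((contDiffAt_pd (i := 0) (hsm u hu)).congr_of_eventuallyEq e0.symm).differentiableAt
    (by simp)
  have d1 := ((contDiffAt_pd (i := 1) (hsm u hu)).congr_of_eventuallyEq e1.symm).differentiableAt
    (by simp)
  have p0 := e0.eq_of_nhds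
  have p1 := e1.eq_of_nhds
  have p00 : pd 0 (pd 0 (revParam x y)) u = !₂[x₂ * Real.cos (u 1), y₂, x₂ * Real.sin (u 1)] := by
    rw [pd_congr e0, pd_zero_revParam d0 hx₂ hy₂]
  have hl1 : HasDerivAt (fun t : ℝ => u 1 + t) 1 0 := (hasDerivAt_id (0 : ℝ)).const_add _
  have hx' : HasDerivAt x (x₁ (u 0)) (u 0 + 0) := by rw [add_zero]; exact hx₁ _ hu
  have hxt : HasDerivAt (fun t : ℝ => x (u 0 + t)) (x₁ (u 0)) 0 :=
    hx'.comp_const_add _ _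
  have p01 : pd 0 (pd 1 (revParam x y)) u =
      !₂[-(x₁ (u 0) * Real.sin (u 1)), 0, x₁ (u 0) * Real.cos (u 1)] := by
    rw [pd_congr e1]
    refine pd_eq_of_hasDerivAt d1 fun j => ?_
    fin_cases j
    · simpa using (hxt.mul_const (Real.sin (u 1))).fun_neg
    · simpa using hasDerivAt_const (0 : ℝ) (0 : ℝ)
    · simpa using hxt.mul_const (Real.cos (u 1))
  have p11 : pd 1 (pd 1 (revParam x y)) u =
      !₂[-(x (u 0) * Real.cos (u 1)), 0, -(x (u 0) * Real.sin (u 1))] := by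
    rw [pd_congr e1]
    refine pd_eq_of_hasDerivAt d1 fun j => ?_
    fin_cases j
    · simpa using (hl1.sin.const_mul (x (u 0))).fun_neg
    · simpa using hasDerivAt_const (0 : ℝ) (0 : ℝ)
    · simpa using hl1.cos.const_mul (x (u 0))
  rintro ν ⟨-, hν0, hν1⟩
  rw [meanCurvature, p00, p01, p11, p0, p1]
  rw [p0] at hν0
  rw [p1] at hν1
  simp only [inner_E3, revParam] at hν0 hν1 ⊢
  simp only [Matrix.cons_val_zero, Matrix.cons_val_one, Matrix.cons_val] at hν0 hν1 ⊢
  set c := Real.cos (u 1)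
  set s := Real.sin (u 1)
  have hcs : s ^ 2 + c ^ 2 = 1 := Real.sin_sq_add_cos_sq _
  generalize x (u 0) = X at *
  generalize y (u 0) = Y at *
  generalize x₁ (u 0) = X₁ at *
  generalize y₁ (u 0) = Y₁ at *
  have hν1' : ν 2 * c - ν 0 * s = 0 := by
    have : X * (ν 2 * c - ν 0 * s) = 0 := by linear_combination hν1
    exact (mul_eq_zero.1 this).resolve_left hx0
  set μ := ν 0 * c + ν 2 * s with hμ
  have hν0' : ν 0 = μ * c := by rw [hμ]; linear_combination (-ν 0) * hcs - s * hν1'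
  have hν2' : ν 2 = μ * s := by rw [hμ]; linear_combination (-ν 2) * hcs + c * hν1'
  have hν00 : X₁ * μ + Y₁ * ν 1 = 0 := by rw [hμ]; linear_combination hν0
  -- In the meridian plane the normal `(μ, ν 1)` is orthogonal to the tangent `(X₁, Y₁)`, hence
  -- equal to `k (Y₁, -X₁)`. The equation is homogeneous in `k`, so the normalization of `ν` plays
  -- no role.
  set k := (μ * Y₁ - ν 1 * X₁) / (X₁ ^ 2 + Y₁ ^ 2) with hk
  have hkμ : μ = k * Y₁ := by
    rw [hk]; field_simp; linear_combination X₁ * hν00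
  have hkν : ν 1 = -k * X₁ := by
    rw [hk]; field_simp; linear_combination Y₁ * hν00
  rw [hν0', hν2', hkν, hkμ]
  have hEE : X₁ * c * (X₁ * c) + Y₁ * Y₁ + X₁ * s * (X₁ * s) = X₁ ^ 2 + Y₁ ^ 2 := by
    linear_combination X₁ ^ 2 * hcs
  have hFF : X₁ * c * -(X * s) + Y₁ * 0 + X₁ * s * (X * c) = 0 := by ring
  have hGG : -(X * s) * -(X * s) + 0 * 0 + X * c * (X * c) = X ^ 2 := by
    linear_combination X ^ 2 * hcs
  have hLL : x₂ * c * (k * Y₁ * c) + y₂ * (-k * X₁) + x₂ * s * (k * Y₁ * s) =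
      k * (x₂ * Y₁ - y₂ * X₁) := by linear_combination k * x₂ * Y₁ * hcs
  have hNN : -(X * c) * (k * Y₁ * c) + 0 * (-k * X₁) + -(X * s) * (k * Y₁ * s) =
      -(k * X * Y₁) := by linear_combination -k * X * Y₁ * hcs
  have hXX : X * c * (k * Y₁ * c) + Y * (-k * X₁) + X * s * (k * Y₁ * s) =
      k * (X * Y₁ - Y * X₁) := by linear_combination k * X * Y₁ * hcs
  rw [hEE, hFF, hGG, hLL, hNN, hXX]
  field_simp
  linear_combination k * X * heq

/-! ### Surfaces of revolution near the axis -/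

/-- The surface of revolution about the `y`-axis `(a A(a² + b²), B(a² + b²), b A(a² + b²))`, where
`(1 + a, b)` are the coordinates of the plane. -/
def axisParam (A B : ℝ → ℝ) (u : E2) : E3 :=
  !₂[(u 0 - 1) * A ((u 0 - 1) ^ 2 + u 1 ^ 2), B ((u 0 - 1) ^ 2 + u 1 ^ 2),
    u 1 * A ((u 0 - 1) ^ 2 + u 1 ^ 2)]

lemma contDiffAt_axisParam {A B : ℝ → ℝ} {u : E2}
    (hA : ContDiffAt ℝ ∞ A ((u 0 - 1) ^ 2 + u 1 ^ 2))
    (hB : ContDiffAt ℝ ∞ B ((u 0 - 1) ^ 2 + u 1 ^ 2)) : ContDiffAt ℝ ∞ (axisParam A B) u := by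
  have h0 : ContDiffAt ℝ ∞ (fun u : E2 => u 0 - 1) u :=
    (contDiff_coord 0).contDiffAt.sub contDiffAt_const
  have h1 : ContDiffAt ℝ ∞ (fun u : E2 => u 1) u := (contDiff_coord 1).contDiffAt
  have hp : ContDiffAt ℝ ∞ (fun u : E2 => (u 0 - 1) ^ 2 + u 1 ^ 2) u := (h0.pow 2).add (h1.pow 2)
  have hA' : ContDiffAt ℝ ∞ (fun u : E2 => A ((u 0 - 1) ^ 2 + u 1 ^ 2)) u := hA.comp u hp
  exact contDiffAt_mk3 (h0.mul hA') (hB.comp u hp) (h1.mul hA')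

lemma hasDerivAt_comp_sq_zero {A : ℝ → ℝ} {A₁ a b : ℝ} (hA : HasDerivAt A A₁ ((a - 1) ^ 2 + b ^ 2)) :
    HasDerivAt (fun t : ℝ => A ((a + t - 1) ^ 2 + b ^ 2)) (A₁ * (2 * (a - 1))) 0 := by
  have hl : HasDerivAt (fun t : ℝ => (a + t - 1) ^ 2 + b ^ 2) (2 * (a - 1)) 0 := by
    have := ((((hasDerivAt_id (0 : ℝ)).const_add a).sub_const 1).pow 2).add_const (b ^ 2)
    simpa using this
  have hA' : HasDerivAt A A₁ ((a + 0 - 1) ^ 2 + b ^ 2) := by rwa [add_zero]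
  exact hA'.comp (0 : ℝ) hl

lemma hasDerivAt_comp_sq_one {A : ℝ → ℝ} {A₁ a b : ℝ} (hA : HasDerivAt A A₁ ((a - 1) ^ 2 + b ^ 2)) :
    HasDerivAt (fun t : ℝ => A ((a - 1) ^ 2 + (b + t) ^ 2)) (A₁ * (2 * b)) 0 := by
  have hl : HasDerivAt (fun t : ℝ => (a - 1) ^ 2 + (b + t) ^ 2) (2 * b) 0 := by
    have := (((hasDerivAt_id (0 : ℝ)).const_add b).pow 2).const_add ((a - 1) ^ 2)
    simpa using this
  have hA' : HasDerivAt A A₁ ((a - 1) ^ 2 + (b + 0) ^ 2) := by rwa [add_zero]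
  exact hA'.comp (0 : ℝ) hl

/-- The self-shrinker equation for a surface of revolution near the axis. -/
lemma shrinkerEquationAt_axisParam {A B A₁ B₁ : ℝ → ℝ} {a₀ a₁ a₂ b₀ b₁ b₂ p : ℝ} {u : E2} {J : Set ℝ}
    (hJ : IsOpen J) (hp : (u 0 - 1) ^ 2 + u 1 ^ 2 = p) (hu : p ∈ J)
    (hA : ContDiffOn ℝ ∞ A J) (hB : ContDiffOn ℝ ∞ B J)
    (hA₁ : ∀ s ∈ J, HasDerivAt A (A₁ s) s) (hB₁ : ∀ s ∈ J, HasDerivAt B (B₁ s) s)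
    (hA₂ : HasDerivAt A₁ a₂ p) (hB₂ : HasDerivAt B₁ b₂ p)
    (ha₀ : A p = a₀) (ha₁ : A₁ p = a₁) (hb₀ : B p = b₀) (hb₁ : B₁ p = b₁) (hA0 : a₀ ≠ 0)
    (hn : (a₀ + 2 * p * a₁) ^ 2 + 4 * p * b₁ ^ 2 ≠ 0)
    (heq : 2 * a₀ * (2 * a₀ * b₁ + 4 * p * ((a₀ + 2 * p * a₁) * b₂ - 2 * b₁ * a₁ -
        2 * p * b₁ * a₂)) + ((a₀ + 2 * p * a₁) ^ 2 + 4 * p * b₁ ^ 2) *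
        (4 * b₁ + a₀ * (b₀ * (a₀ + 2 * p * a₁) - 2 * p * a₀ * b₁)) = 0) :
    ShrinkerEquationAt (axisParam A B) u := by
  have hcont : Continuous fun v : E2 => (v 0 - 1) ^ 2 + v 1 ^ 2 := by fun_prop
  have hev : ∀ᶠ v : E2 in nhds u, (v 0 - 1) ^ 2 + v 1 ^ 2 ∈ J :=
    hcont.continuousAt.eventually_mem (hJ.mem_nhds (by rwa [hp]))
  have huJ : (u 0 - 1) ^ 2 + u 1 ^ 2 ∈ J := by rwa [hp]
  have hsm : ∀ v : E2, (v 0 - 1) ^ 2 + v 1 ^ 2 ∈ J → ContDiffAt ℝ ∞ (axisParam A B) v := fun v hv =>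
    contDiffAt_axisParam (hA.contDiffAt (hJ.mem_nhds hv)) (hB.contDiffAt (hJ.mem_nhds hv))
  have hdf : ∀ v : E2, (v 0 - 1) ^ 2 + v 1 ^ 2 ∈ J → DifferentiableAt ℝ (axisParam A B) v :=
    fun v hv => (hsm v hv).differentiableAt (by simp)
  have l0 : ∀ v : E2, HasDerivAt (fun t : ℝ => v 0 + t - 1) 1 0 := fun v =>
    ((hasDerivAt_id (0 : ℝ)).const_add _).sub_const 1
  have l1 : ∀ v : E2, HasDerivAt (fun t : ℝ => v 1 + t) 1 0 := fun v =>
    (hasDerivAt_id (0 : ℝ)).const_add _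
  have e0 : pd 0 (axisParam A B) =ᶠ[nhds u] fun v =>
      !₂[A ((v 0 - 1) ^ 2 + v 1 ^ 2) + 2 * (v 0 - 1) ^ 2 * A₁ ((v 0 - 1) ^ 2 + v 1 ^ 2),
        2 * (v 0 - 1) * B₁ ((v 0 - 1) ^ 2 + v 1 ^ 2),
        2 * (v 0 - 1) * v 1 * A₁ ((v 0 - 1) ^ 2 + v 1 ^ 2)] := by
    filter_upwards [hev] with v hv
    refine pd_eq_of_hasDerivAt (hdf v hv) fun j => ?_
    have hAt := hasDerivAt_comp_sq_zero (hA₁ _ hv)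
    have hBt := hasDerivAt_comp_sq_zero (hB₁ _ hv)
    fin_cases j
    · have := (l0 v).fun_mul hAt
      simp only [axisParam]
      simp
      exact this.congr_deriv (by simp only [add_zero]; ring)
    · simp only [axisParam]
      simp
      exact hBt.congr_deriv (by ring)
    · have := hAt.const_mul (v 1)
      simp only [axisParam]
      simp
      exact this.congr_deriv (by ring)
  have e1 : pd 1 (axisParam A B) =ᶠ[nhds u] fun v =>
      !₂[2 * (v 0 - 1) * v 1 * A₁ ((v 0 - 1) ^ 2 + v 1 ^ 2),
        2 * v 1 * B₁ ((v 0 - 1) ^ 2 + v 1 ^ 2),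
        A ((v 0 - 1) ^ 2 + v 1 ^ 2) + 2 * v 1 ^ 2 * A₁ ((v 0 - 1) ^ 2 + v 1 ^ 2)] := by
    filter_upwards [hev] with v hv
    refine pd_eq_of_hasDerivAt (hdf v hv) fun j => ?_
    have hAt := hasDerivAt_comp_sq_one (hA₁ _ hv)
    have hBt := hasDerivAt_comp_sq_one (hB₁ _ hv)
    fin_cases j
    · have := hAt.const_mul (v 0 - 1)
      simp only [axisParam]
      simp
      exact this.congr_deriv (by ring)
    · simp only [axisParam]
      simp
      exact hBt.congr_deriv (by ring)
    · have := (l1 v).fun_mul hAt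
      simp only [axisParam]
      simp
      exact this.congr_deriv (by simp only [add_zero]; ring)
  have d0 := ((contDiffAt_pd (i := 0) (hsm u huJ)).congr_of_eventuallyEq e0.symm).differentiableAt
    (by simp)
  have d1 := ((contDiffAt_pd (i := 1) (hsm u huJ)).congr_of_eventuallyEq e1.symm).differentiableAt
    (by simp)
  rw [← hp] at hA₂ hB₂
  have hA₁u := hA₁ _ huJ
  have p0 := e0.eq_of_nhds
  have p1 := e1.eq_of_nhds
  have t0 := hasDerivAt_comp_sq_zero hA₁u
  have t1 := hasDerivAt_comp_sq_one hA₁u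
  have s0 := hasDerivAt_comp_sq_zero hA₂
  have s1 := hasDerivAt_comp_sq_one hA₂
  have r0 := hasDerivAt_comp_sq_zero hB₂
  have r1 := hasDerivAt_comp_sq_one hB₂
  have p00 : pd 0 (pd 0 (axisParam A B)) u =
      !₂[6 * (u 0 - 1) * a₁ + 4 * (u 0 - 1) ^ 3 * a₂, 2 * b₁ + 4 * (u 0 - 1) ^ 2 * b₂,
        2 * u 1 * a₁ + 4 * (u 0 - 1) ^ 2 * u 1 * a₂] := by
    rw [pd_congr e0]
    refine pd_eq_of_hasDerivAt d0 fun j => ?_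
    fin_cases j
    · have := t0.fun_add ((((l0 u).fun_pow 2).const_mul 2).fun_mul s0)
      simp
      exact this.congr_deriv (by simp only [add_zero, hp, ha₁]; ring)
    · have := ((l0 u).const_mul 2).fun_mul r0
      simp
      exact this.congr_deriv (by simp only [add_zero, hp, hb₁]; ring)
    · have := (((l0 u).const_mul 2).mul_const (u 1)).fun_mul s0
      simp
      exact this.congr_deriv (by simp only [add_zero, hp, ha₁]; ring)
  have p01 : pd 0 (pd 1 (axisParam A B)) u =
      !₂[2 * u 1 * a₁ + 4 * (u 0 - 1) ^ 2 * u 1 * a₂, 4 * (u 0 - 1) * u 1 * b₂,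
        2 * (u 0 - 1) * a₁ + 4 * (u 0 - 1) * u 1 ^ 2 * a₂] := by
    rw [pd_congr e1]
    refine pd_eq_of_hasDerivAt d1 fun j => ?_
    fin_cases j
    · have := (((l0 u).const_mul 2).mul_const (u 1)).fun_mul s0
      simp
      exact this.congr_deriv (by simp only [add_zero, hp, ha₁]; ring)
    · have := r0.const_mul (2 * u 1)
      simp
      exact this.congr_deriv (by ring)
    · have := t0.fun_add (s0.const_mul (2 * u 1 ^ 2))
      simp
      exact this.congr_deriv (by simp only [hp, ha₁]; ring)
  have p11 : pd 1 (pd 1 (axisParam A B)) u =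
      !₂[2 * (u 0 - 1) * a₁ + 4 * (u 0 - 1) * u 1 ^ 2 * a₂, 2 * b₁ + 4 * u 1 ^ 2 * b₂,
        6 * u 1 * a₁ + 4 * u 1 ^ 3 * a₂] := by
    rw [pd_congr e1]
    refine pd_eq_of_hasDerivAt d1 fun j => ?_
    fin_cases j
    · have := ((l1 u).const_mul (2 * (u 0 - 1))).fun_mul s1
      simp
      exact this.congr_deriv (by simp only [add_zero, hp, ha₁]; ring)
    · have := ((l1 u).const_mul 2).fun_mul r1
      simp
      exact this.congr_deriv (by simp only [add_zero, hp, hb₁]; ring)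
    · have := t1.fun_add ((((l1 u).fun_pow 2).const_mul 2).fun_mul s1)
      simp
      exact this.congr_deriv (by simp only [add_zero, hp, ha₁]; ring)
  rintro ν ⟨-, hν0, hν1⟩
  rw [meanCurvature, p00, p01, p11, p0, p1]
  rw [p0] at hν0
  rw [p1] at hν1
  simp only [inner_E3, axisParam, hp, ha₀, ha₁, hb₀, hb₁] at hν0 hν1 ⊢
  simp only [Matrix.cons_val_zero, Matrix.cons_val_one, Matrix.cons_val] at hν0 hν1 ⊢
  generalize u 0 - 1 = a at *
  generalize u 1 = b at *
  set D := a₀ + 2 * p * a₁ with hD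
  set n := D ^ 2 + 4 * p * b₁ ^ 2 with hn'
  set τ := a * ν 0 + b * ν 2 with hτ
  have h3 : τ * D + 2 * p * b₁ * ν 1 = 0 := by
    rw [hτ, hD]
    linear_combination a * hν0 + b * hν1 - (2 * a₁ * (a * ν 0 + b * ν 2) + 2 * b₁ * ν 1) * hp
  -- The normal is `k (-2 a b₁, D, -2 b b₁)`. This form is free of division by `p = a² + b²`, so the
  -- computation covers the axis itself.
  set k := (D * ν 1 - 2 * b₁ * τ) / n with hk
  have hkn : k * n = D * ν 1 - 2 * b₁ * τ := by rw [hk]; field_simp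
  have hν1' : ν 1 = D * k := by
    have : n * (ν 1 - D * k) = 0 := by
      rw [hn']
      linear_combination (-D) * hkn + 2 * b₁ * h3 + D * k * hn'
    linarith [(mul_eq_zero.1 this).resolve_left hn]
  have hν0' : ν 0 = -2 * a * b₁ * k := by
    have : a₀ * n * (ν 0 + 2 * a * b₁ * k) = 0 := by
      linear_combination n * hν0 - 2 * a * (a₁ * D + 2 * b₁ ^ 2) * h3 + 2 * a * b₁ * a₀ * hkn
    linarith [(mul_eq_zero.1 this).resolve_left (mul_ne_zero hA0 hn)]
  have hν2' : ν 2 = -2 * b * b₁ * k := by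
    have : a₀ * n * (ν 2 + 2 * b * b₁ * k) = 0 := by
      linear_combination n * hν1 - 2 * b * (a₁ * D + 2 * b₁ ^ 2) * h3 + 2 * b * b₁ * a₀ * hkn
    linarith [(mul_eq_zero.1 this).resolve_left (mul_ne_zero hA0 hn)]
  rw [hν0', hν1', hν2']
  set W := 2 * a₀ * b₁ + 4 * p * (D * b₂ - 2 * b₁ * a₁ - 2 * p * b₁ * a₂) with hW
  -- `N`, `G` and `X` are the numerator of the mean curvature, the determinant of the first
  -- fundamental form and the support term; each simplifies by `a² + b² = p`.
  have key : ∀ N G X : ℝ, N = -(k * a₀ * (a₀ * W + 2 * b₁ * n)) → G = a₀ ^ 2 * n →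
      X = k * (b₀ * D - 2 * p * a₀ * b₁) → N / G - 1 / 2 * X = 0 := by
    rintro N G X rfl rfl rfl
    field_simp
    linear_combination (-k) * heq
  apply key
  · rw [hW, hn', hD, ← hp]; ring
  · rw [hn', hD, ← hp]; ring
  · rw [← hp]; ring

/-! ### Caps generated by a solution of the profile equation -/

/-- The interval on which profiles are defined; it contains `[0, 1]`. -/
def profileDomain : Set ℝ := Ioo (-(1 / 4)) (5 / 4)

lemma isOpen_profileDomain : IsOpen profileDomain := isOpen_Ioo

/-- A positive solution `q` of the profile equation, with derivatives `q₁` and `q₂`. -/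
structure Profile (q q₁ q₂ : ℝ → ℝ) : Prop where
  smooth : ContDiffOn ℝ ∞ q profileDomain
  hasDerivAt : ∀ w ∈ profileDomain, HasDerivAt q (q₁ w) w
  hasDerivAt₁ : ∀ w ∈ profileDomain, HasDerivAt q₁ (q₂ w) w
  eqn : ∀ w ∈ profileDomain, ProfileEquation w (q w) (q₁ w) (q₂ w)
  pos : ∀ w ∈ profileDomain, 0 < q w
  -- For `w ≥ 0` this follows from the positivity of `q`; it is a genuine condition only for `w <
  -- 0`, where the domain is prolonged past the pole.
  speed_pos : ∀ w ∈ profileDomain, 0 < 4 * q w ^ 2 + w * (2 - w) * q₁ w ^ 2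

namespace Profile

variable {q q₁ q₂ : ℝ → ℝ}

lemma hasDerivAt_sqrt (h : Profile q q₁ q₂) {w : ℝ} (hw : w ∈ profileDomain) :
    HasDerivAt (fun w => √(q w)) (q₁ w / (2 * √(q w))) w :=
  (h.hasDerivAt w hw).sqrt (h.pos w hw).ne'

lemma hasDerivAt_sqrt₁ (h : Profile q q₁ q₂) {w : ℝ} (hw : w ∈ profileDomain) :
    HasDerivAt (fun w => q₁ w / (2 * √(q w)))
      (q₂ w / (2 * √(q w)) - q₁ w ^ 2 / (4 * √(q w) ^ 3)) w := by
  have hR : 0 < √(q w) := Real.sqrt_pos.2 (h.pos w hw)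
  have := (h.hasDerivAt₁ w hw).fun_div ((h.hasDerivAt_sqrt hw).const_mul 2) (by positivity)
  refine this.congr_deriv ?_
  field_simp
  ring

lemma smooth_sqrt (h : Profile q q₁ q₂) : ContDiffOn ℝ ∞ (fun w => √(q w)) profileDomain :=
  h.smooth.sqrt fun w hw => (h.pos w hw).ne'

end Profile

/-- The coefficient function of the parametrization of a cap near its pole. -/
def poleA (q : ℝ → ℝ) (p : ℝ) : ℝ := √(q p) * √(2 - p)

/-- The height function of the parametrization of a cap near its pole. -/
def poleB (q : ℝ → ℝ) (p : ℝ) : ℝ := √(q p) * (1 - p)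

namespace Profile

variable {q q₁ q₂ : ℝ → ℝ}

lemma smooth_poleA (h : Profile q q₁ q₂) : ContDiffOn ℝ ∞ (poleA q) profileDomain := by
  refine h.smooth_sqrt.mul (ContDiffOn.sqrt (by fun_prop) fun w hw => ?_)
  have := hw.2
  linarith

lemma smooth_poleB (h : Profile q q₁ q₂) : ContDiffOn ℝ ∞ (poleB q) profileDomain :=
  h.smooth_sqrt.mul (by fun_prop)

/-- With `p = w` the distance to the axis is `√p * poleA q p = √q √(w (2 - w))`. Pulling out `√p`
leaves functions that are smooth at the pole. -/
lemma shrinkerEquationAt_pole (h : Profile q q₁ q₂) {u : E2}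
    (hu : (u 0 - 1) ^ 2 + u 1 ^ 2 ∈ profileDomain) :
    ShrinkerEquationAt (axisParam (poleA q) (poleB q)) u := by
  have hg : ∀ w ∈ profileDomain, 0 < 2 - w := fun w hw => by linarith [hw.2]
  have hσ : ∀ w ∈ profileDomain, HasDerivAt (fun w : ℝ => √(2 - w)) (-1 / (2 * √(2 - w))) w :=
    fun w hw => ((hasDerivAt_id w).const_sub 2).sqrt (hg w hw).ne'
  have hA₁ : ∀ w ∈ profileDomain, HasDerivAt (poleA q)
      (q₁ w / (2 * √(q w)) * √(2 - w) + √(q w) * (-1 / (2 * √(2 - w)))) w := fun w hw =>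
    (h.hasDerivAt_sqrt hw).mul (hσ w hw)
  have hB₁ : ∀ w ∈ profileDomain, HasDerivAt (poleB q)
      (q₁ w / (2 * √(q w)) * (1 - w) + √(q w) * -1) w := fun w hw =>
    (h.hasDerivAt_sqrt hw).mul ((hasDerivAt_id w).const_sub 1)
  generalize hp : (u 0 - 1) ^ 2 + u 1 ^ 2 = p at hu
  have hR0 : 0 < √(q p) := Real.sqrt_pos.2 (h.pos p hu)
  have hg0 : 0 < √(2 - p) := Real.sqrt_pos.2 (hg p hu)
  have hA₂ := ((h.hasDerivAt_sqrt₁ hu).fun_mul (hσ p hu)).fun_add ((h.hasDerivAt_sqrt hu).fun_mul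
    (((hasDerivAt_const p (-1 : ℝ)).fun_div ((hσ p hu).const_mul 2) (by positivity))))
  have hB₂ := ((h.hasDerivAt_sqrt₁ hu).fun_mul ((hasDerivAt_id p).const_sub 1)).fun_add
    ((h.hasDerivAt_sqrt hu).mul_const (-1))
  refine shrinkerEquationAt_axisParam isOpen_profileDomain hp hu h.smooth_poleA h.smooth_poleB
    hA₁ hB₁ hA₂ hB₂ rfl rfl rfl rfl (mul_pos hR0 hg0).ne' ?_ ?_
  all_goals
    have hODE := h.eqn p hu
    have hsp := h.speed_pos p hu
    have hq : q p = √(q p) ^ 2 := (Real.sq_sqrt (h.pos p hu).le).symm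
    have hgp : p = 2 - √(2 - p) ^ 2 := by rw [Real.sq_sqrt (hg p hu).le]; ring
    unfold ProfileEquation at hODE
    simp only [poleA, poleB]
    generalize √(q p) = R at *
    generalize √(2 - p) = g at *
    rw [hq] at hODE hsp
    generalize q₁ p = Q₁ at *
    generalize q₂ p = Q₂ at *
    subst hgp
  · have : (R * g + 2 * (2 - g ^ 2) * (Q₁ / (2 * R) * g + R * (-1 / (2 * g)))) ^ 2 +
        4 * (2 - g ^ 2) * (Q₁ / (2 * R) * (1 - (2 - g ^ 2)) + R * -1) ^ 2 =
        (4 * (R ^ 2) ^ 2 + (2 - g ^ 2) * (2 - (2 - g ^ 2)) * Q₁ ^ 2) / (g ^ 2 * R ^ 2) := by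
      field_simp
      ring
    rw [this]
    positivity
  -- After `p = 2 - g²` and `q = R²` everything is rational in `g` and `R`, and the geometric
  -- equation is this multiple of the profile equation.
  · refine Eq.trans ?_ (mul_eq_zero_of_right (2 / (g ^ 2 * R ^ 3)) hODE)
    simp only [id]
    field_simp
    ring

/-- The derivative of the radius with respect to the latitude. -/
lemma hasDerivAt_radius (h : Profile q q₁ q₂) {s : ℝ} (hs : 1 - Real.sin s ∈ profileDomain) :
    HasDerivAt (fun s => √(q (1 - Real.sin s)))
      (-(q₁ (1 - Real.sin s) / (2 * √(q (1 - Real.sin s))) * Real.cos s)) s := by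
  have := (h.hasDerivAt_sqrt hs).comp s ((Real.hasDerivAt_sin s).const_sub 1)
  exact this.congr_deriv (by ring)

lemma hasDerivAt_radius₁ (h : Profile q q₁ q₂) {s : ℝ} (hs : 1 - Real.sin s ∈ profileDomain) :
    HasDerivAt (fun s => -(q₁ (1 - Real.sin s) / (2 * √(q (1 - Real.sin s))) * Real.cos s))
      ((q₂ (1 - Real.sin s) / (2 * √(q (1 - Real.sin s))) - q₁ (1 - Real.sin s) ^ 2 /
        (4 * √(q (1 - Real.sin s)) ^ 3)) * Real.cos s ^ 2 +
        q₁ (1 - Real.sin s) / (2 * √(q (1 - Real.sin s))) * Real.sin s) s := by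
  have := (((h.hasDerivAt_sqrt₁ hs).comp s ((Real.hasDerivAt_sin s).const_sub 1)).fun_mul
    (Real.hasDerivAt_cos s)).fun_neg
  exact this.congr_deriv (by simp only [Function.comp_apply]; ring)

end Profile

/-- The distance to the axis, as a function of the latitude. -/
def latX (q : ℝ → ℝ) (s : ℝ) : ℝ := √(q (1 - Real.sin s)) * Real.cos s

/-- The height, as a function of the latitude. -/
def latY (q : ℝ → ℝ) (s : ℝ) : ℝ := √(q (1 - Real.sin s)) * Real.sin s

/-- The latitudes on which `latX` and `latY` are used. -/
def latDomain : Set ℝ := Ioo (-(1 / 4)) (Real.pi / 2)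

/-- Latitudes below `0` go beyond the rim `w = 1`; as `sin (1/4) < 1/4`, they stay below `w = 5/4`.
-/
lemma one_sub_sin_mem {s : ℝ} (hs : s ∈ latDomain) : 1 - Real.sin s ∈ profileDomain := by
  have h1 : Real.sin (-(1 / 4)) < Real.sin s :=
    Real.sin_lt_sin_of_lt_of_le_pi_div_two (by linarith [Real.pi_gt_three]) hs.2.le hs.1
  have h2 : Real.sin (1 / 4) < 1 / 4 := Real.sin_lt (by norm_num)
  rw [Real.sin_neg] at h1
  constructor
  · linarith [Real.sin_le_one s]
  · linarith

lemma cos_pos_of_mem_latDomain {s : ℝ} (hs : s ∈ latDomain) : 0 < Real.cos s :=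
  Real.cos_pos_of_mem_Ioo ⟨by linarith [hs.1, Real.pi_gt_three], hs.2⟩

namespace Profile

variable {q q₁ q₂ : ℝ → ℝ}

lemma smooth_radius (h : Profile q q₁ q₂) :
    ContDiffOn ℝ ∞ (fun s => √(q (1 - Real.sin s))) latDomain :=
  h.smooth_sqrt.comp (by fun_prop) fun _ hs => one_sub_sin_mem hs

lemma smooth_latX (h : Profile q q₁ q₂) : ContDiffOn ℝ ∞ (latX q) latDomain :=
  h.smooth_radius.mul (by fun_prop)

lemma smooth_latY (h : Profile q q₁ q₂) : ContDiffOn ℝ ∞ (latY q) latDomain :=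
  h.smooth_radius.mul (by fun_prop)

lemma hasDerivAt_latX (h : Profile q q₁ q₂) {s : ℝ} (hs : s ∈ latDomain) :
    HasDerivAt (latX q) (-(q₁ (1 - Real.sin s) / (2 * √(q (1 - Real.sin s))) * Real.cos s) *
      Real.cos s + √(q (1 - Real.sin s)) * -Real.sin s) s :=
  (h.hasDerivAt_radius (one_sub_sin_mem hs)).mul (Real.hasDerivAt_cos s)

lemma hasDerivAt_latY (h : Profile q q₁ q₂) {s : ℝ} (hs : s ∈ latDomain) :
    HasDerivAt (latY q) (-(q₁ (1 - Real.sin s) / (2 * √(q (1 - Real.sin s))) * Real.cos s) *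
      Real.sin s + √(q (1 - Real.sin s)) * Real.cos s) s :=
  (h.hasDerivAt_radius (one_sub_sin_mem hs)).mul (Real.hasDerivAt_sin s)

lemma shrinkerEquationAt_lat (h : Profile q q₁ q₂) {u : E2} (hu : u 0 ∈ latDomain) :
    ShrinkerEquationAt (revParam (latX q) (latY q)) u := by
  have hw := one_sub_sin_mem hu
  have hR0 : 0 < √(q (1 - Real.sin (u 0))) := Real.sqrt_pos.2 (h.pos _ hw)
  have hc0 := cos_pos_of_mem_latDomain hu
  have hX₂ := ((h.hasDerivAt_radius₁ hw).fun_mul (Real.hasDerivAt_cos _)).fun_add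
    ((h.hasDerivAt_radius hw).fun_mul (Real.hasDerivAt_sin _).fun_neg)
  have hY₂ := ((h.hasDerivAt_radius₁ hw).fun_mul (Real.hasDerivAt_sin _)).fun_add
    ((h.hasDerivAt_radius hw).fun_mul (Real.hasDerivAt_cos _))
  refine shrinkerEquationAt_revParam isOpen_Ioo hu h.smooth_latX h.smooth_latY
    (fun s hs => h.hasDerivAt_latX hs) (fun s hs => h.hasDerivAt_latY hs) hX₂ hY₂
    (mul_pos hR0 hc0).ne' ?_ ?_
  on_goal 2 => unfold latX latY
  all_goals
    have hODE := h.eqn _ hw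
    have hsp := h.speed_pos _ hw
    have hq : q (1 - Real.sin (u 0)) = √(q (1 - Real.sin (u 0))) ^ 2 :=
      (Real.sq_sqrt (h.pos _ hw).le).symm
    have hcs : Real.sin (u 0) ^ 2 + Real.cos (u 0) ^ 2 = 1 := Real.sin_sq_add_cos_sq _
    unfold ProfileEquation at hODE
    generalize √(q (1 - Real.sin (u 0))) = R at *
    rw [hq] at hODE hsp
    generalize q₁ (1 - Real.sin (u 0)) = Q₁ at *
    generalize q₂ (1 - Real.sin (u 0)) = Q₂ at *
    generalize Real.sin (u 0) = s at *
    generalize Real.cos (u 0) = c at *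
    have hm : (1 - s) * (2 - (1 - s)) = c ^ 2 := by linear_combination -hcs
    rw [hm] at hODE hsp
    set R₁ := -(Q₁ / (2 * R) * c) with hR₁
    have hE : (R₁ * c + R * -s) ^ 2 + (R₁ * s + R * c) ^ 2 = R₁ ^ 2 + R ^ 2 := by
      linear_combination (R₁ ^ 2 + R ^ 2) * hcs
    rw [hE]
    have hE2 : R₁ ^ 2 + R ^ 2 = (4 * (R ^ 2) ^ 2 + c ^ 2 * Q₁ ^ 2) / (4 * R ^ 2) := by
      rw [hR₁]; field_simp; ring
  · rw [hE2]
    positivity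
  · set R₂ := (Q₂ / (2 * R) - Q₁ ^ 2 / (4 * R ^ 3)) * c ^ 2 + Q₁ / (2 * R) * s with hR₂
    have h1 : (R₂ * c + R₁ * -s + (R₁ * -s + R * -c)) * (R₁ * s + R * c) -
        (R₂ * s + R₁ * c + (R₁ * c + R * -s)) * (R₁ * c + R * -s) =
        R * R₂ - R ^ 2 - 2 * R₁ ^ 2 := by
      linear_combination (R * R₂ - R ^ 2 - 2 * R₁ ^ 2) * hcs
    have h2 : R * c * (R₁ * s + R * c) - R * s * (R₁ * c + R * -s) = R ^ 2 := by
      linear_combination R ^ 2 * hcs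
    rw [h1, h2]
    -- With `w (2 - w) = c²` the meridian equation is this multiple of the profile equation.
    refine Eq.trans ?_ (mul_eq_zero_of_right (-c / (4 * R ^ 3)) hODE)
    rw [hR₁, hR₂]
    field_simp
    ring

end Profile

/-! ### Local parametrizations -/

/-- A smooth map with a differentiable left inverse is a local parametrization. -/
lemma IsLocalParam.of_leftInverse {S B : Set E3} {φ : E2 → E3} {g : E3 → E2} {U : Set E2}
    {V : Set E3} (hU : IsOpen U) (hφ : ContDiffOn ℝ ∞ φ U) (hV : IsOpen V) (hmaps : MapsTo φ U V)
    (hg : ∀ X ∈ V, DifferentiableAt ℝ g X) (hl : ∀ u ∈ U, g (φ u) = u)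
    (hS : S ∩ V = φ '' (U ∩ halfPlane)) (hB : B ∩ V = φ '' (U ∩ edge)) :
    IsLocalParam S B φ U where
  isOpen := hU
  smooth := hφ
  immersion u hu := by
    have h1 := ((hφ.contDiffAt (hU.mem_nhds hu)).differentiableAt (by simp)).hasFDerivAt
    have h2 := (hg _ (hmaps hu)).hasFDerivAt.comp u h1
    have h3 : (g ∘ φ) =ᶠ[nhds u] id := by
      filter_upwards [hU.mem_nhds hu] with v hv using hl v hv
    have h4 := (h2.congr_of_eventuallyEq h3.symm).unique (hasFDerivAt_id u)
    -- By the chain rule for `g ∘ φ = id`, the derivative of `g` is a left inverse of that of `φ`.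
    refine Function.LeftInverse.injective (g := fderiv ℝ g (φ u)) fun v => ?_
    exact DFunLike.congr_fun h4 v
  embedding := by
    have hc : Continuous (hmaps.restrict φ U V) :=
      hφ.continuousOn.mapsToRestrict hmaps
    have hgc : Continuous (V.domRestrict g) :=
      continuousOn_iff_continuous_domRestrict.1 fun X hX => (hg X hX).continuousAt.continuousWithinAt
    have : Topology.IsEmbedding (V.domRestrict g ∘ hmaps.restrict φ U V) := by
      have : V.domRestrict g ∘ hmaps.restrict φ U V = Subtype.val := by
        funext u
        exact hl u u.2
      rw [this]
      exact Topology.IsEmbedding.subtypeVal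
    exact Topology.IsEmbedding.subtypeVal.comp (Topology.IsEmbedding.of_comp hc hgc this)
  image := ⟨V, hV, hS, hB⟩

lemma ext_E3 {v w : E3} (h0 : v 0 = w 0) (h1 : v 1 = w 1) (h2 : v 2 = w 2) : v = w := by
  ext i
  fin_cases i
  exacts [h0, h1, h2]

/-- The cap generated by the profile `q`. -/
def capSet (q : ℝ → ℝ) : Set E3 := {Y | Y ≠ 0 ∧ 0 ≤ Y 1 ∧ ‖Y‖ ^ 2 = q (1 - Y 1 / ‖Y‖)}

lemma norm_pos_of_coord {X : E3} (h : 0 < X 1) : 0 < ‖X‖ :=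
  norm_pos_iff.2 fun h0 => by simp [h0] at h

lemma coord_one_le_norm (X : E3) : X 1 ≤ ‖X‖ :=
  (le_abs_self _).trans (by simpa using PiLp.norm_apply_le X 1)

/-! #### The pole -/

/-- The left inverse of the parametrization near the pole. -/
def poleInv (X : E3) : E2 :=
  !₂[1 + X 0 / (‖X‖ * √(1 + X 1 / ‖X‖)), X 2 / (‖X‖ * √(1 + X 1 / ‖X‖))]

lemma contDiffAt_mk2 {V : Type*} [NormedAddCommGroup V] [NormedSpace ℝ V] {n : WithTop ℕ∞}
    {f g : V → ℝ} {u : V} (hf : ContDiffAt ℝ n f u) (hg : ContDiffAt ℝ n g u) :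
    ContDiffAt ℝ n (fun u => (!₂[f u, g u] : E2)) u := by
  rw [contDiffAt_euclidean]
  intro i
  fin_cases i
  exacts [hf, hg]

lemma differentiableAt_poleInv {X : E3} (h : 0 < X 1) : DifferentiableAt ℝ poleInv X := by
  have hn := norm_pos_of_coord h
  have hd : ContDiffAt ℝ 1 (fun X : E3 => ‖X‖) X := contDiffAt_norm ℝ (norm_pos_iff.1 hn)
  have hc : ∀ i : Fin 3, ContDiffAt ℝ 1 (fun X : E3 => X i) X := fun i =>
    (contDiff_coord i).contDiffAt
  have h1 : 1 + X 1 / ‖X‖ ≠ 0 := by positivity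
  have hs : ContDiffAt ℝ 1 (fun X : E3 => ‖X‖ * √(1 + X 1 / ‖X‖)) X :=
    hd.mul ((contDiffAt_const.add ((hc 1).div hd hn.ne')).sqrt h1)
  have hs0 : ‖X‖ * √(1 + X 1 / ‖X‖) ≠ 0 := by positivity
  exact (contDiffAt_mk2 (contDiffAt_const.add ((hc 0).div hs hs0))
    ((hc 2).div hs hs0)).differentiableAt (by simp)

namespace Profile

variable {q q₁ q₂ : ℝ → ℝ}

lemma mem_profileDomain_of_Icc {p : ℝ} (h0 : 0 ≤ p) (h1 : p ≤ 1) : p ∈ profileDomain :=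
  ⟨by linarith, by linarith⟩

lemma norm_axisParam {u : E2} (hu : (u 0 - 1) ^ 2 + u 1 ^ 2 < 1) :
    ‖axisParam (poleA q) (poleB q) u‖ = √(q ((u 0 - 1) ^ 2 + u 1 ^ 2)) := by
  rw [← sq_eq_sq₀ (norm_nonneg _) (Real.sqrt_nonneg _), norm_sq_E3]
  simp only [axisParam, poleA, poleB, Matrix.cons_val_zero, Matrix.cons_val_one, Matrix.cons_val]
  generalize u 0 - 1 = a at *
  generalize u 1 = b at *
  have h2 : √(2 - (a ^ 2 + b ^ 2)) ^ 2 = 2 - (a ^ 2 + b ^ 2) := Real.sq_sqrt (by linarith)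
  linear_combination √(q (a ^ 2 + b ^ 2)) ^ 2 * (a ^ 2 + b ^ 2) * h2

/-- The surface, its boundary and the open set are left free because the chart is used twice: for
the cap above its rim, and for the cap without pole and rim in (A). The parameter is recovered from
`X` through `p = 1 - X 1 / ‖X‖`. -/
lemma isLocalParam_pole (h : Profile q q₁ q₂) {S B W : Set E3} (hW : IsOpen W)
    (hW1 : ∀ X ∈ W, 0 < X 1) (hS : ∀ X ∈ W, X ∈ S ↔ ‖X‖ ^ 2 = q (1 - X 1 / ‖X‖))
    (hB : B ∩ W = ∅) : ∃ U : Set E2, IsLocalParam S B (axisParam (poleA q) (poleB q)) U ∧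
      S ∩ W ⊆ axisParam (poleA q) (poleB q) '' (U ∩ halfPlane) ∧
      ∀ u ∈ U, ShrinkerEquationAt (axisParam (poleA q) (poleB q)) u := by
  set ψ := axisParam (poleA q) (poleB q) with hψ
  set D : Set E2 := {u | (u 0 - 1) ^ 2 + u 1 ^ 2 < 1} with hDdef
  have hD : IsOpen D := isOpen_lt (by fun_prop) continuous_const
  have hdom : ∀ u ∈ D, (u 0 - 1) ^ 2 + u 1 ^ 2 ∈ profileDomain := fun u hu =>
    mem_profileDomain_of_Icc (by positivity) (le_of_lt hu)
  have hsm : ContDiffOn ℝ ∞ ψ D := fun u hu => (contDiffAt_axisParam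
    (h.smooth_poleA.contDiffAt (isOpen_profileDomain.mem_nhds (hdom u hu)))
    (h.smooth_poleB.contDiffAt (isOpen_profileDomain.mem_nhds (hdom u hu)))).contDiffWithinAt
  have hU : IsOpen (D ∩ ψ ⁻¹' W) := hsm.continuousOn.isOpen_inter_preimage hD hW
  -- The unit disc about `(1, 0)` lies in the open half plane, so this chart has only interior
  -- points. That is the reason for the shift by `1` in `axisParam`.
  have hhalf : ∀ u ∈ D, 0 < u 0 := fun u hu => by
    have : (u 0 - 1) ^ 2 + u 1 ^ 2 < 1 := hu
    nlinarith [sq_nonneg (u 1)]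
  have hRpos : ∀ u ∈ D, 0 < √(q ((u 0 - 1) ^ 2 + u 1 ^ 2)) := fun u hu =>
    Real.sqrt_pos.2 (h.pos _ (hdom u hu))
  have hratio : ∀ u ∈ D, ψ u 1 / ‖ψ u‖ = 1 - ((u 0 - 1) ^ 2 + u 1 ^ 2) := fun u hu => by
    rw [hψ, norm_axisParam hu]
    have := hRpos u hu
    simp only [axisParam, poleB, Matrix.cons_val_one]
    simp only [Matrix.cons_val_zero]
    field_simp
  have himg : S ∩ W = ψ '' ((D ∩ ψ ⁻¹' W) ∩ halfPlane) := by
    ext X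
    constructor
    · rintro ⟨hXS, hXW⟩
      have hX1 := hW1 X hXW
      have hq := (hS X hXW).1 hXS
      have hn := norm_pos_of_coord hX1
      have hle : X 1 / ‖X‖ ≤ 1 := (div_le_one hn).2 (coord_one_le_norm X)
      have hpos : 0 < X 1 / ‖X‖ := div_pos hX1 hn
      have hs : 0 < √(1 + X 1 / ‖X‖) := Real.sqrt_pos.2 (by linarith)
      have hs2 : √(1 + X 1 / ‖X‖) ^ 2 = 1 + X 1 / ‖X‖ := Real.sq_sqrt (by linarith)
      set u := poleInv X with hu
      have hu0 : u 0 - 1 = X 0 / (‖X‖ * √(1 + X 1 / ‖X‖)) := by simp [hu, poleInv]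
      have hu1 : u 1 = X 2 / (‖X‖ * √(1 + X 1 / ‖X‖)) := by simp [hu, poleInv]
      have hp : (u 0 - 1) ^ 2 + u 1 ^ 2 = 1 - X 1 / ‖X‖ := by
        rw [hu0, hu1, div_pow, div_pow, mul_pow, hs2, ← add_div, div_eq_iff (by positivity)]
        have := norm_sq_E3 X
        field_simp
        linarith
      have hqn : √(q (1 - X 1 / ‖X‖)) = ‖X‖ := by
        rw [← hq]; exact Real.sqrt_sq hn.le
      have h2p : 2 - (1 - X 1 / ‖X‖) = 1 + X 1 / ‖X‖ := by ring
      have hψu : ψ u = X := by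
        refine ext_E3 ?_ ?_ ?_
        · simp only [hψ, axisParam, poleA, Matrix.cons_val_zero, hp, hqn, h2p]
          rw [hu0]
          field_simp
        · simp only [hψ, axisParam, poleB, Matrix.cons_val_one, Matrix.cons_val_zero, hp, hqn]
          field_simp
          ring
        · simp only [hψ, axisParam, poleA, Matrix.cons_val, hp, hqn, h2p]
          rw [hu1]
          field_simp
      have huD : u ∈ D := by
        show (u 0 - 1) ^ 2 + u 1 ^ 2 < 1
        rw [hp]; linarith
      exact ⟨u, ⟨⟨huD, by rw [mem_preimage, hψu]; exact hXW⟩, (hhalf u huD).le⟩, hψu⟩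
    · rintro ⟨u, ⟨⟨huD, huW⟩, -⟩, rfl⟩
      refine ⟨(hS _ huW).2 ?_, huW⟩
      rw [hratio u huD, hψ, norm_axisParam huD, Real.sq_sqrt (h.pos _ (hdom u huD)).le,
        sub_sub_cancel]
  refine ⟨D ∩ ψ ⁻¹' W, ?_, himg.subset, fun u hu => h.shrinkerEquationAt_pole (hdom u hu.1)⟩
  refine IsLocalParam.of_leftInverse (g := poleInv) hU (hsm.mono inter_subset_left) hW
    (fun u hu => hu.2) (fun X hX => differentiableAt_poleInv (hW1 X hX)) ?_ himg ?_
  · rintro u ⟨hu, -⟩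
    have hR := hRpos u hu
    have hlt : (u 0 - 1) ^ 2 + u 1 ^ 2 < 1 := hu
    have hg : 0 < √(2 - ((u 0 - 1) ^ 2 + u 1 ^ 2)) := Real.sqrt_pos.2 (by linarith)
    have e : √(1 + ψ u 1 / ‖ψ u‖) = √(2 - ((u 0 - 1) ^ 2 + u 1 ^ 2)) := by
      rw [hratio u hu]; congr 1; ring
    ext i
    fin_cases i
    · simp only [poleInv, e]
      simp only [hψ, norm_axisParam hlt]
      simp [axisParam, poleA]
      field_simp
      ring
    · simp only [poleInv, e]
      simp only [hψ, norm_axisParam hlt]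
      simp [axisParam, poleA]
      field_simp
  · rw [hB]
    symm
    rw [image_eq_empty, ← disjoint_iff_inter_eq_empty, disjoint_left]
    intro u hu he
    have : u 0 = 0 := he
    exact (hhalf u hu.1).ne' this

end Profile

/-! #### The boundary -/

lemma cos_sin_arctan_div {α β d : ℝ} (hα : 0 < α) (hd : 0 < d) (h : α ^ 2 + β ^ 2 = d ^ 2) :
    Real.cos (Real.arctan (β / α)) = α / d ∧ Real.sin (Real.arctan (β / α)) = β / d := by
  have : √(1 + (β / α) ^ 2) = d / α := by
    rw [Real.sqrt_eq_iff_mul_self_eq_of_pos (by positivity)]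
    field_simp
    linarith
  rw [Real.cos_arctan, Real.sin_arctan, this]
  constructor <;> field_simp

/-- The left inverse of the parametrization by latitude and longitude, for longitudes near `z₀`. -/
def latInv (z₀ : ℝ) (X : E3) : E2 :=
  !₂[Real.arctan (X 1 / √(X 0 ^ 2 + X 2 ^ 2)),
    z₀ + Real.arctan ((X 2 * Real.cos z₀ - X 0 * Real.sin z₀) /
      (X 0 * Real.cos z₀ + X 2 * Real.sin z₀))]

/-- The domain of `latInv`. -/
def latRange (z₀ : ℝ) : Set E3 := {X | 0 < X 0 * Real.cos z₀ + X 2 * Real.sin z₀ ∧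
  Real.tan (-(1 / 4)) * √(X 0 ^ 2 + X 2 ^ 2) < X 1}

lemma isOpen_latRange (z₀ : ℝ) : IsOpen (latRange z₀) := by
  have h1 : IsOpen {X : E3 | 0 < X 0 * Real.cos z₀ + X 2 * Real.sin z₀} :=
    isOpen_lt continuous_const (by fun_prop)
  have h2 : IsOpen {X : E3 | Real.tan (-(1 / 4)) * √(X 0 ^ 2 + X 2 ^ 2) < X 1} :=
    isOpen_lt (by fun_prop) (by fun_prop)
  exact h1.inter h2

lemma axisDist_pos {z₀ : ℝ} {X : E3} (h : 0 < X 0 * Real.cos z₀ + X 2 * Real.sin z₀) :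
    0 < X 0 ^ 2 + X 2 ^ 2 := by
  by_contra hn
  have h0 : X 0 = 0 := by nlinarith [sq_nonneg (X 0), sq_nonneg (X 2)]
  have h2 : X 2 = 0 := by nlinarith [sq_nonneg (X 0), sq_nonneg (X 2)]
  simp [h0, h2] at h

lemma differentiableAt_latInv {z₀ : ℝ} {X : E3} (h : X ∈ latRange z₀) :
    DifferentiableAt ℝ (latInv z₀) X := by
  have hpos := axisDist_pos h.1
  have hc : ∀ i : Fin 3, ContDiffAt ℝ 1 (fun X : E3 => X i) X := fun i =>
    (contDiff_coord i).contDiffAt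
  have hs : ContDiffAt ℝ 1 (fun X : E3 => √(X 0 ^ 2 + X 2 ^ 2)) X :=
    (((hc 0).pow 2).add ((hc 2).pow 2)).sqrt hpos.ne'
  have : ContDiffAt ℝ 1 (latInv z₀) X := by
    refine contDiffAt_mk2 ?_ ?_
    · exact ((hc 1).div hs (Real.sqrt_pos.2 hpos).ne').arctan
    · exact contDiffAt_const.add ((((hc 2).mul contDiffAt_const).sub
        ((hc 0).mul contDiffAt_const)).div
        (((hc 0).mul contDiffAt_const).add ((hc 2).mul contDiffAt_const)) h.1.ne').arctan
  exact this.differentiableAt (by simp)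

namespace Profile

variable {q q₁ q₂ : ℝ → ℝ}

/-- The latitude has the sign of the height, so the half plane and its edge correspond to the cap
and its rim. The chart is defined also for slightly negative latitudes, as openness across the edge
demands. The last clause puts a rim point into the chart, for the co-normal. -/
lemma isLocalParam_lat (h : Profile q q₁ q₂) (z₀ : ℝ) {B : Set E3}
    (hB : ∀ X, X ∈ B ↔ X ∈ capSet q ∧ X 1 = 0) : ∃ U : Set E2,
      IsLocalParam (capSet q) B (revParam (latX q) (latY q)) U ∧
      capSet q ∩ latRange z₀ ⊆ revParam (latX q) (latY q) '' (U ∩ halfPlane) ∧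
      (∀ u ∈ U, ShrinkerEquationAt (revParam (latX q) (latY q)) u) ∧ !₂[0, z₀] ∈ U := by
  set ψ := revParam (latX q) (latY q) with hψ
  set U : Set E2 := {u | u 0 ∈ latDomain ∧ u 1 ∈ Ioo (z₀ - Real.pi / 2) (z₀ + Real.pi / 2)}
  have hU : IsOpen U := (isOpen_Ioo.preimage (contDiff_coord (n := 0) (0 : Fin 2)).continuous).inter
    (isOpen_Ioo.preimage (contDiff_coord (n := 0) (1 : Fin 2)).continuous)
  have hsm : ContDiffOn ℝ ∞ ψ U := fun u hu => (contDiffAt_revParam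
    (h.smooth_latX.contDiffAt (isOpen_Ioo.mem_nhds hu.1))
    (h.smooth_latY.contDiffAt (isOpen_Ioo.mem_nhds hu.1))).contDiffWithinAt
  have hR : ∀ u ∈ U, 0 < √(q (1 - Real.sin (u 0))) := fun u hu =>
    Real.sqrt_pos.2 (h.pos _ (one_sub_sin_mem hu.1))
  have hx : ∀ u ∈ U, 0 < latX q (u 0) := fun u hu =>
    mul_pos (hR u hu) (cos_pos_of_mem_latDomain hu.1)
  have hd : ∀ u ∈ U, √(ψ u 0 ^ 2 + ψ u 2 ^ 2) = latX q (u 0) := fun u hu => by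
    rw [Real.sqrt_eq_iff_mul_self_eq_of_pos (hx u hu)]
    simp only [hψ, revParam, Matrix.cons_val_zero, Matrix.cons_val]
    linear_combination (-latX q (u 0) ^ 2) * Real.sin_sq_add_cos_sq (u 1)
  have hα : ∀ u ∈ U, ψ u 0 * Real.cos z₀ + ψ u 2 * Real.sin z₀ =
      latX q (u 0) * Real.cos (u 1 - z₀) := fun u _ => by
    simp only [hψ, revParam, Matrix.cons_val_zero, Matrix.cons_val, Real.cos_sub]
    ring
  have hβ : ∀ u ∈ U, ψ u 2 * Real.cos z₀ - ψ u 0 * Real.sin z₀ =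
      latX q (u 0) * Real.sin (u 1 - z₀) := fun u _ => by
    simp only [hψ, revParam, Matrix.cons_val_zero, Matrix.cons_val, Real.sin_sub]
    ring
  have hz : ∀ u ∈ U, 0 < Real.cos (u 1 - z₀) := fun u hu =>
    Real.cos_pos_of_mem_Ioo ⟨by linarith [hu.2.1], by linarith [hu.2.2]⟩
  have htan : ∀ u ∈ U, latY q (u 0) = Real.tan (u 0) * latX q (u 0) := fun u hu => by
    have := cos_pos_of_mem_latDomain hu.1
    rw [Real.tan_eq_sin_div_cos, latX, latY]
    field_simp
  have hmaps : MapsTo ψ U (latRange z₀) := by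
    intro u hu
    refine ⟨?_, ?_⟩
    · rw [hα u hu]; exact mul_pos (hx u hu) (hz u hu)
    · rw [hd u hu, show ψ u 1 = latY q (u 0) by simp [hψ, revParam], htan u hu]
      refine mul_lt_mul_of_pos_right ?_ (hx u hu)
      exact Real.tan_lt_tan_of_lt_of_lt_pi_div_two (by linarith [Real.pi_gt_three]) hu.1.2 hu.1.1
  have hnorm : ∀ u ∈ U, ‖ψ u‖ = √(q (1 - Real.sin (u 0))) := fun u hu => by
    rw [← sq_eq_sq₀ (norm_nonneg _) (Real.sqrt_nonneg _), norm_sq_E3]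
    simp only [hψ, revParam, latX, latY, Matrix.cons_val_zero, Matrix.cons_val_one, Matrix.cons_val]
    linear_combination √(q (1 - Real.sin (u 0))) ^ 2 * (Real.sin_sq_add_cos_sq (u 0) +
      Real.cos (u 0) ^ 2 * Real.sin_sq_add_cos_sq (u 1))
  have hcap : ∀ u ∈ U, (ψ u ∈ capSet q ↔ 0 ≤ u 0) := by
    intro u hu
    have hRu := hR u hu
    have h1 : ψ u 1 = √(q (1 - Real.sin (u 0))) * Real.sin (u 0) := by simp [hψ, revParam, latY]
    have hs : 0 ≤ Real.sin (u 0) ↔ 0 ≤ u 0 := by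
      constructor
      · intro hs
        by_contra hneg
        have := Real.sin_neg_of_neg_of_neg_pi_lt (not_le.1 hneg)
          (by linarith [hu.1.1, Real.pi_gt_three])
        linarith
      · intro h0
        exact Real.sin_nonneg_of_nonneg_of_le_pi h0 (by linarith [hu.1.2, Real.pi_pos])
    constructor
    · rintro ⟨-, h2, -⟩
      rw [h1] at h2
      exact hs.1 (nonneg_of_mul_nonneg_right h2 hRu)
    · intro h0
      refine ⟨?_, ?_, ?_⟩
      · rw [← norm_pos_iff, hnorm u hu]; exact hRu
      · rw [h1]; exact mul_nonneg hRu.le (hs.2 h0)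
      · rw [hnorm u hu, h1, mul_div_cancel_left₀ _ hRu.ne',
          Real.sq_sqrt (h.pos _ (one_sub_sin_mem hu.1)).le]
  have hsurj : ∀ X ∈ capSet q ∩ latRange z₀, latInv z₀ X ∈ U ∧ ψ (latInv z₀ X) = X := by
    rintro X ⟨⟨hX0, hX1, hXq⟩, hXr, hXt⟩
    have hpos := axisDist_pos hXr
    have hd0 : 0 < √(X 0 ^ 2 + X 2 ^ 2) := Real.sqrt_pos.2 hpos
    have hd2 : √(X 0 ^ 2 + X 2 ^ 2) ^ 2 = X 0 ^ 2 + X 2 ^ 2 := Real.sq_sqrt hpos.le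
    have hn : 0 < ‖X‖ := norm_pos_iff.2 hX0
    obtain ⟨hc, hs⟩ := cos_sin_arctan_div (β := X 1) hd0 hn (by rw [hd2, norm_sq_E3]; ring)
    obtain ⟨hc', hs'⟩ := cos_sin_arctan_div (β := X 2 * Real.cos z₀ - X 0 * Real.sin z₀) hXr hd0
      (by rw [hd2]; linear_combination (X 0 ^ 2 + X 2 ^ 2) * Real.sin_sq_add_cos_sq z₀)
    have hqn : √(q (1 - X 1 / ‖X‖)) = ‖X‖ := by
      rw [← hXq]; exact Real.sqrt_sq hn.le
    have hmem : latInv z₀ X ∈ U := by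
      refine ⟨⟨?_, ?_⟩, ?_, ?_⟩
      · have : 0 ≤ Real.arctan (X 1 / √(X 0 ^ 2 + X 2 ^ 2)) := Real.arctan_nonneg.2 (by positivity)
        simp only [latInv, Matrix.cons_val_zero]
        linarith
      · exact Real.arctan_lt_pi_div_two _
      · simp only [latInv, Matrix.cons_val_one, Matrix.cons_val_zero]
        linarith [Real.neg_pi_div_two_lt_arctan ((X 2 * Real.cos z₀ - X 0 * Real.sin z₀) /
          (X 0 * Real.cos z₀ + X 2 * Real.sin z₀))]
      · simp only [latInv, Matrix.cons_val_one, Matrix.cons_val_zero]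
        linarith [Real.arctan_lt_pi_div_two ((X 2 * Real.cos z₀ - X 0 * Real.sin z₀) /
          (X 0 * Real.cos z₀ + X 2 * Real.sin z₀))]
    refine ⟨hmem, ?_⟩
    have hsc := Real.sin_sq_add_cos_sq z₀
    refine ext_E3 ?_ ?_ ?_
    · simp only [hψ, revParam, latInv, latX, latY, Matrix.cons_val_one, Matrix.cons_val_zero,
        hs, hc, hqn, Real.cos_add, hc', hs']
      field_simp
      linear_combination X 0 * hsc
    · simp only [hψ, revParam, latInv, latX, latY, Matrix.cons_val_one, Matrix.cons_val_zero,
        hs, hc, hqn]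
      field_simp
    · simp only [hψ, revParam, latInv, latX, latY, Matrix.cons_val_one, Matrix.cons_val_zero,
        Matrix.cons_val, hs, hc, hqn, Real.sin_add, hc', hs']
      field_simp
      linear_combination X 2 * hsc
  have himg : capSet q ∩ latRange z₀ = ψ '' (U ∩ halfPlane) := by
    ext X
    constructor
    · intro hX
      obtain ⟨h1, h2⟩ := hsurj X hX
      refine ⟨latInv z₀ X, ⟨h1, ?_⟩, h2⟩
      exact (hcap _ h1).1 (by rw [h2]; exact hX.1)
    · rintro ⟨u, ⟨hu, hu0⟩, rfl⟩
      exact ⟨(hcap u hu).2 hu0, hmaps hu⟩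
  refine ⟨U, ?_, himg.subset, fun u hu => h.shrinkerEquationAt_lat hu.1, ?_⟩
  · refine IsLocalParam.of_leftInverse hU hsm (isOpen_latRange z₀) hmaps
      (fun X hX => differentiableAt_latInv hX) ?_ himg ?_
    · intro u hu
      ext i
      have hxu := hx u hu
      have hzu := hz u hu
      fin_cases i
      · have : ψ u 1 / √(ψ u 0 ^ 2 + ψ u 2 ^ 2) = Real.tan (u 0) := by
          rw [hd u hu, show ψ u 1 = latY q (u 0) by simp [hψ, revParam], htan u hu]
          field_simp
        simp only [latInv, this]
        exact Real.arctan_tan (by linarith [hu.1.1, Real.pi_gt_three]) hu.1.2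
      · simp only [latInv, hα u hu, hβ u hu, mul_div_mul_left _ _ hxu.ne',
          ← Real.tan_eq_sin_div_cos]
        have := Real.arctan_tan (x := u 1 - z₀) (by linarith [hu.2.1]) (by linarith [hu.2.2])
        simp [this]
    · ext X
      constructor
      · rintro ⟨hXB, hXr⟩
        obtain ⟨hXc, hX1⟩ := (hB X).1 hXB
        obtain ⟨h1, h2⟩ := hsurj X ⟨hXc, hXr⟩
        refine ⟨latInv z₀ X, ⟨h1, ?_⟩, h2⟩
        simp [edge, latInv, hX1]
      · rintro ⟨u, ⟨hu, hu0⟩, rfl⟩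
        have hu0' : u 0 = 0 := hu0
        refine ⟨(hB _).2 ⟨(hcap u hu).2 hu0'.ge, ?_⟩, hmaps hu⟩
        simp [hψ, revParam, latY, hu0']
  · refine ⟨⟨?_, ?_⟩, ?_, ?_⟩ <;> simp [Real.pi_pos]

end Profile

/-! ### Caps as self-shrinkers with boundary: charts, co-normal, graph, rotations. -/

lemma mem_circleY_iff {q : ℝ → ℝ} {r : ℝ} (hr : 0 < r) (hq : r ^ 2 = q 1) (X : E3) :
    X ∈ circleY 0 r ↔ X ∈ capSet q ∧ X 1 = 0 := by
  have hn := norm_sq_E3 X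
  constructor
  · rintro ⟨h1, h2⟩
    have hX : ‖X‖ ^ 2 = r ^ 2 := by rw [hn, h1, ← h2]; ring
    refine ⟨⟨fun h0 => ?_, h1.ge, ?_⟩, h1⟩
    · rw [h0, norm_zero] at hX
      nlinarith
    · rw [hX, hq, h1, zero_div, sub_zero]
  · rintro ⟨⟨-, -, h2⟩, h1⟩
    refine ⟨h1, ?_⟩
    rw [h1, zero_div, sub_zero, ← hq, hn, h1] at h2
    linarith

lemma exists_polar (a b : ℝ) :
    ∃ z : ℝ, a = √(a ^ 2 + b ^ 2) * Real.cos z ∧ b = √(a ^ 2 + b ^ 2) * Real.sin z := by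
  refine ⟨Complex.arg ⟨a, b⟩, ?_, ?_⟩
  · have := Complex.norm_mul_cos_arg ⟨a, b⟩
    rw [Complex.norm_eq_sqrt_sq_add_sq] at this
    exact this.symm
  · have := Complex.norm_mul_sin_arg ⟨a, b⟩
    rw [Complex.norm_eq_sqrt_sq_add_sq] at this
    exact this.symm

namespace Profile

variable {q q₁ q₂ : ℝ → ℝ}

/-- Points of positive height lie in the pole chart; a point of height `0` lies in the latitude
chart centred at its own longitude. -/
lemma exists_param_cap (h : Profile q q₁ q₂) {r : ℝ} (hr : 0 < r) (hq : r ^ 2 = q 1) {X : E3}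
    (hX : X ∈ capSet q) : ∃ (φ : E2 → E3) (U : Set E2), IsLocalParam (capSet q) (circleY 0 r) φ U ∧
      X ∈ φ '' (U ∩ halfPlane) ∧ ∀ u ∈ U ∩ halfPlane, ShrinkerEquationAt φ u := by
  rcases hX.2.1.lt_or_eq with h1 | h1
  · have hW : IsOpen {X : E3 | 0 < X 1} := isOpen_lt continuous_const (by fun_prop)
    obtain ⟨U, hU, hU1, hU2⟩ := h.isLocalParam_pole (S := capSet q) (B := circleY 0 r) hW
      (fun X hX => hX) (fun X hX => ⟨fun h => h.2.2, fun h =>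
        ⟨norm_pos_iff.1 (norm_pos_of_coord hX), le_of_lt hX, h⟩⟩)
      (by
        rw [← disjoint_iff_inter_eq_empty, disjoint_left]
        intro X hX hX'
        exact (ne_of_gt hX') hX.1)
    exact ⟨_, U, hU, hU1 ⟨hX, h1⟩, fun u hu => hU2 u hu.1⟩
  · obtain ⟨z, hz0, hz2⟩ := exists_polar (X 0) (X 2)
    have hpos : 0 < X 0 ^ 2 + X 2 ^ 2 := by
      have := norm_sq_E3 X
      have h2 : 0 < ‖X‖ := norm_pos_iff.2 hX.1
      rw [← h1] at this
      nlinarith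
    have hd := Real.sqrt_pos.2 hpos
    obtain ⟨U, hU, hU1, hU2, -⟩ := h.isLocalParam_lat z (mem_circleY_iff hr hq)
    refine ⟨_, U, hU, hU1 ⟨hX, ?_, ?_⟩, fun u hu => hU2 u hu.1⟩
    · have : X 0 * Real.cos z + X 2 * Real.sin z = √(X 0 ^ 2 + X 2 ^ 2) := by
        linear_combination Real.cos z * hz0 + Real.sin z * hz2 +
          √(X 0 ^ 2 + X 2 ^ 2) * Real.sin_sq_add_cos_sq z
      rw [this]
      exact hd
    · rw [← h1, Real.tan_neg]
      have : 0 < Real.tan (1 / 4) :=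
        Real.tan_pos_of_pos_of_lt_pi_div_two (by norm_num) (by linarith [Real.pi_gt_three])
      nlinarith

lemma isSurfaceWithBoundary_cap (h : Profile q q₁ q₂) {r : ℝ} (hr : 0 < r) (hq : r ^ 2 = q 1) :
    IsSurfaceWithBoundary (capSet q) (circleY 0 r) := by
  refine ⟨fun X hX => ((mem_circleY_iff hr hq X).1 hX).1, fun X hX => ?_⟩
  obtain ⟨φ, U, h1, h2, -⟩ := h.exists_param_cap hr hq hX
  exact ⟨φ, U, h1, h2⟩

lemma isSelfShrinker_cap (h : Profile q q₁ q₂) {r : ℝ} (hr : 0 < r) (hq : r ^ 2 = q 1) :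
    IsSelfShrinker (capSet q) (circleY 0 r) := fun _ hX => h.exists_param_cap hr hq hX

/-- At the rim the meridian, followed by latitude, has tangent `(-q₁ / (2 r), r)` in the coordinates
`(x, y)`. Its slope against the vertical is `-q₁ / (2 q) = tan θ`, so `(sin θ, cos θ, 0)` is `cos θ
/ r` times this tangent. -/
lemma exists_conormal (h : Profile q q₁ q₂) {r θ : ℝ} (hr : 0 < r) (hq : r ^ 2 = q 1)
    (hθ : θ ∈ Ioo (-(Real.pi / 2)) (Real.pi / 2)) (htan : Real.tan θ = -q₁ 1 / (2 * q 1)) :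
    ∃ η : E3, IsInwardConormal (capSet q) (circleY 0 r) !₂[r, 0, 0] η ∧
      ⟪η, EuclideanSpace.single (0 : Fin 3) (1 : ℝ)⟫ = Real.sin θ ∧
      InnerProductGeometry.angle η (EuclideanSpace.single (0 : Fin 3) (1 : ℝ)) =
        Real.pi / 2 - θ := by
  have hc : 0 < Real.cos θ := Real.cos_pos_of_mem_Ioo hθ
  have hrs : √(q 1) = r := by rw [← hq]; exact Real.sqrt_sq hr.le
  obtain ⟨U, hU, -, -, hu⟩ := h.isLocalParam_lat 0 (mem_circleY_iff hr hq)
  have hdom : (0 : ℝ) ∈ latDomain := ⟨by norm_num, by positivity⟩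
  have hdiff : DifferentiableAt ℝ (revParam (latX q) (latY q)) !₂[0, 0] :=
    (hU.smooth.contDiffAt (hU.isOpen.mem_nhds hu)).differentiableAt (by simp)
  have hp0 := pd_zero_revParam hdiff (h.hasDerivAt_latX hdom) (h.hasDerivAt_latY hdom)
  have hp1 := pd_one_revParam hdiff
  set η : E3 := !₂[Real.sin θ, Real.cos θ, 0] with hη
  have hnorm : ‖η‖ = 1 := by
    rw [← sq_eq_sq₀ (norm_nonneg _) zero_le_one, norm_sq_E3, hη]
    simp
  have hinner : ⟪η, EuclideanSpace.single (0 : Fin 3) (1 : ℝ)⟫ = Real.sin θ := by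
    rw [inner_E3, hη]
    simp
  refine ⟨η, ⟨revParam (latX q) (latY q), U, !₂[0, 0], hU, ⟨hu, rfl⟩, ?_,
    ⟨Real.cos θ / r, 0, by positivity, ?_⟩, ?_, hnorm⟩, hinner, ?_⟩
  · refine ext_E3 ?_ ?_ ?_ <;> simp [revParam, latX, latY, hrs]
  · rw [hp0, zero_smul, add_zero]
    have hs : Real.sin θ = Real.tan θ * Real.cos θ := (Real.tan_mul_cos hc.ne').symm
    refine ext_E3 ?_ ?_ ?_
    · simp [hη, hrs]
      rw [hs, htan, ← hq]
      field_simp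
    · simp [hη, hrs]
      field_simp
    · simp [hη]
  · rw [hp1, inner_E3, hη]
    simp
  · rw [InnerProductGeometry.angle, hinner, hnorm]
    simp only [PiLp.norm_single, norm_one, mul_one, div_one]
    rw [← Real.cos_pi_div_two_sub]
    exact Real.arccos_cos (by linarith [hθ.2]) (by linarith [hθ.1, Real.pi_pos])

end Profile

/-- Moving along the normal of the sphere is a radial rescaling, here by `√q / 2`. It preserves `X 1
/ ‖X‖`, hence `w`, and changes the norm from `2` to `√q`. -/
lemma normalGraph_eq_capSet {q : ℝ → ℝ} {f : E3 → ℝ} (hpos : ∀ w ∈ Icc (0 : ℝ) 1, 0 < q w)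
    (hf : ∀ X ∈ hemisphere, f X = √(q (1 - X 1 / 2)) - 2) :
    normalGraph hemisphere sphereNormal f = capSet q := by
  have hw : ∀ X ∈ hemisphere, 1 - X 1 / 2 ∈ Icc (0 : ℝ) 1 := by
    rintro X ⟨h1, h2⟩
    have := coord_one_le_norm X
    rw [h1] at this
    constructor <;> linarith
  have hpt : ∀ X ∈ hemisphere, X + f X • sphereNormal X = (√(q (1 - X 1 / 2)) / 2) • X := by
    intro X hX
    rw [hf X hX, sphereNormal, smul_smul]
    nth_rewrite 1 [← one_smul ℝ X]
    rw [← add_smul]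
    congr 1
    ring
  ext Y
  constructor
  · rintro ⟨X, hX, rfl⟩
    simp only [hpt X hX]
    have hR := Real.sqrt_pos.2 (hpos _ (hw X hX))
    have hq := Real.sq_sqrt (hpos _ (hw X hX)).le
    have hn : ‖(√(q (1 - X 1 / 2)) / 2) • X‖ = √(q (1 - X 1 / 2)) := by
      rw [norm_smul, hX.1, Real.norm_of_nonneg (by positivity)]
      ring
    refine ⟨?_, ?_, ?_⟩
    · rw [← norm_pos_iff, hn]; exact hR
    · exact mul_nonneg (by positivity) hX.2
    · rw [hn, hq, PiLp.smul_apply, smul_eq_mul]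
      congr 2
      generalize √(q (1 - X 1 / 2)) = R at hR
      field_simp
  · rintro ⟨h0, h1, h2⟩
    have hn : 0 < ‖Y‖ := norm_pos_iff.2 h0
    have hX : (2 / ‖Y‖) • Y ∈ hemisphere := by
      refine ⟨?_, mul_nonneg (by positivity) h1⟩
      rw [norm_smul, Real.norm_of_nonneg (by positivity)]
      field_simp
    refine ⟨(2 / ‖Y‖) • Y, hX, ?_⟩
    simp only [hpt _ hX]
    have : 1 - ((2 / ‖Y‖) • Y : E3) 1 / 2 = 1 - Y 1 / ‖Y‖ := by
      simp
      field_simp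
    rw [this, ← h2, Real.sqrt_sq hn.le, smul_smul]
    rw [show ‖Y‖ / 2 * (2 / ‖Y‖) = 1 by field_simp, one_smul]

lemma norm_rotY (α : ℝ) (X : E3) : ‖rotY α X‖ = ‖X‖ := by
  rw [← sq_eq_sq₀ (norm_nonneg _) (norm_nonneg _), norm_sq_E3, norm_sq_E3]
  simp only [rotY, Matrix.cons_val_zero, Matrix.cons_val_one, Matrix.cons_val]
  linear_combination (X 0 ^ 2 + X 2 ^ 2) * Real.sin_sq_add_cos_sq α

lemma rotY_rotY_neg (α : ℝ) (X : E3) : rotY α (rotY (-α) X) = X := by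
  refine ext_E3 ?_ ?_ ?_ <;>
    simp only [rotY, Matrix.cons_val_zero, Matrix.cons_val_one, Matrix.cons_val, Real.cos_neg,
      Real.sin_neg]
  · linear_combination X 0 * Real.sin_sq_add_cos_sq α
  · linear_combination X 2 * Real.sin_sq_add_cos_sq α

lemma rotY_mem_capSet {q : ℝ → ℝ} (α : ℝ) {X : E3} (hX : X ∈ capSet q) : rotY α X ∈ capSet q := by
  have h1 : rotY α X 1 = X 1 := by simp [rotY]
  refine ⟨?_, ?_, ?_⟩
  · rw [← norm_pos_iff, norm_rotY]; exact norm_pos_iff.2 hX.1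
  · rw [h1]; exact hX.2.1
  · rw [h1, norm_rotY]; exact hX.2.2

lemma rotY_image_capSet (q : ℝ → ℝ) (α : ℝ) : rotY α '' capSet q = capSet q := by
  ext X
  constructor
  · rintro ⟨Y, hY, rfl⟩
    exact rotY_mem_capSet α hY
  · intro hX
    exact ⟨rotY (-α) X, rotY_mem_capSet _ hX, rotY_rotY_neg α X⟩

/-! ### Invariance under isometries -/

lemma pd_isometry (σ : E3 ≃ₗᵢ[ℝ] E3) (i : Fin 2) (φ : E2 → E3) (u : E2) :
    pd i (fun v => σ (φ v)) u = σ (pd i φ u) := by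
  have : fderiv ℝ (σ ∘ φ) u = (σ : E3 →L[ℝ] E3).comp (fderiv ℝ φ u) :=
    σ.toContinuousLinearEquiv.comp_fderiv
  change fderiv ℝ (σ ∘ φ) u _ = _
  rw [this]
  rfl

/-- Only inner products of derivatives, position and normal enter. Reflections are covered too,
because the equation is required for both unit normals and none is singled out by a cross product.
-/
lemma shrinkerEquationAt_isometry (σ : E3 ≃ₗᵢ[ℝ] E3) {φ : E2 → E3} {u : E2}
    (h : ShrinkerEquationAt φ u) : ShrinkerEquationAt (fun v => σ (φ v)) u := by
  rintro ν ⟨h1, h2, h3⟩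
  obtain ⟨μ, rfl⟩ := σ.surjective ν
  have e : ∀ i, pd i (fun v => σ (φ v)) = fun v => σ (pd i φ v) := fun i => by
    funext v; exact pd_isometry σ i φ v
  rw [pd_isometry, σ.inner_map_map] at h2 h3
  rw [σ.norm_map] at h1
  have := h μ ⟨h1, h2, h3⟩
  simpa only [meanCurvature, e, pd_isometry, σ.inner_map_map] using this

lemma IsLocalParam.isometry (σ : E3 ≃ₗᵢ[ℝ] E3) {S B : Set E3} {φ : E2 → E3} {U : Set E2}
    (h : IsLocalParam S B φ U) : IsLocalParam (σ '' S) (σ '' B) (fun v => σ (φ v)) U where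
  isOpen := h.isOpen
  smooth := σ.toContinuousLinearEquiv.contDiff.comp_contDiffOn h.smooth
  immersion u hu := by
    have : fderiv ℝ (σ ∘ φ) u = (σ : E3 →L[ℝ] E3).comp (fderiv ℝ φ u) :=
      σ.toContinuousLinearEquiv.comp_fderiv
    change Function.Injective (fderiv ℝ (σ ∘ φ) u)
    rw [this]
    exact σ.injective.comp (h.immersion u hu)
  embedding := σ.toHomeomorph.isEmbedding.comp h.embedding
  image := by
    obtain ⟨V, hV, h1, h2⟩ := h.image
    refine ⟨σ '' V, σ.toHomeomorph.isOpenMap V hV, ?_, ?_⟩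
    · rw [← image_inter σ.injective, h1, image_image]
    · rw [← image_inter σ.injective, h2, image_image]

/-! ### Surfaces generated by revolution about the `z`-axis. -/

/-- The reflection exchanging the `y`-axis and the `z`-axis. -/
def swapYZ : E3 ≃ₗᵢ[ℝ] E3 := LinearIsometryEquiv.piLpCongrLeft 2 ℝ ℝ (Equiv.swap 1 2)

lemma swapYZ_apply (X : E3) : swapYZ X = !₂[X 0, X 2, X 1] := by
  ext i
  fin_cases i <;>
    simp [swapYZ, LinearIsometryEquiv.piLpCongrLeft_apply, Equiv.piCongrLeft'_apply,
      Equiv.swap_apply_of_ne_of_ne]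

/-- The part of a cap between its pole and its boundary. -/
def openCap (q : ℝ → ℝ) : Set E3 :=
  {X | (0 < X 1 ∧ 0 < X 0 ^ 2 + X 2 ^ 2) ∧ ‖X‖ ^ 2 = q (1 - X 1 / ‖X‖)}

/-- Both sides are the radial graph `√(q (1 - cos φ))`. The open interval of `φ` omits the pole and
the rim, as `openCap` does. -/
lemma revolution_eq {q ρ : ℝ → ℝ} (hpos : ∀ w ∈ Icc (0 : ℝ) 1, 0 < q w)
    (hρ : ∀ φ ∈ Ioo 0 (Real.pi / 2), ρ φ = √(q (1 - Real.cos φ))) :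
    revolution ρ = swapYZ '' openCap q := by
  ext X
  constructor
  · rintro ⟨φ, hφ, α, rfl⟩
    have hc : 0 < Real.cos φ := Real.cos_pos_of_mem_Ioo ⟨by linarith [hφ.1, Real.pi_pos], hφ.2⟩
    have hs : 0 < Real.sin φ := Real.sin_pos_of_pos_of_lt_pi hφ.1 (by linarith [hφ.2, Real.pi_pos])
    have hw : 1 - Real.cos φ ∈ Icc (0 : ℝ) 1 := ⟨by linarith [Real.cos_le_one φ], by linarith⟩
    have hR : 0 < ρ φ := by rw [hρ φ hφ]; exact Real.sqrt_pos.2 (hpos _ hw)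
    set Y : E3 := !₂[ρ φ * Real.sin φ * Real.cos α, ρ φ * Real.cos φ,
      ρ φ * Real.sin φ * Real.sin α] with hY
    have hn : ‖Y‖ = ρ φ := by
      rw [← sq_eq_sq₀ (norm_nonneg _) hR.le, norm_sq_E3]
      simp only [hY, Matrix.cons_val_zero, Matrix.cons_val_one, Matrix.cons_val]
      linear_combination ρ φ ^ 2 * (Real.sin_sq_add_cos_sq φ +
        Real.sin φ ^ 2 * Real.sin_sq_add_cos_sq α)
    refine ⟨Y, ⟨⟨?_, ?_⟩, ?_⟩, ?_⟩
    · simp only [hY, Matrix.cons_val_one, Matrix.cons_val_zero]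
      positivity
    · have : Y 0 ^ 2 + Y 2 ^ 2 = (ρ φ * Real.sin φ) ^ 2 := by
        simp only [hY, Matrix.cons_val_zero, Matrix.cons_val]
        linear_combination (ρ φ * Real.sin φ) ^ 2 * Real.sin_sq_add_cos_sq α
      rw [this]
      positivity
    · have h1 : Y 1 = ρ φ * Real.cos φ := by simp [hY]
      rw [hn, h1, mul_div_cancel_left₀ _ hR.ne', hρ φ hφ, Real.sq_sqrt (hpos _ hw).le]
    · rw [swapYZ_apply]
      refine ext_E3 ?_ ?_ ?_ <;> simp [hY]
  · rintro ⟨Y, ⟨⟨hY1, hY02⟩, hYq⟩, rfl⟩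
    have hn := norm_pos_of_coord hY1
    have hns := norm_sq_E3 Y
    have hlt : Y 1 < ‖Y‖ := by nlinarith
    have h1 : Y 1 / ‖Y‖ < 1 := (div_lt_one hn).2 hlt
    have h0 : 0 < Y 1 / ‖Y‖ := div_pos hY1 hn
    have hcos : Real.cos (Real.arccos (Y 1 / ‖Y‖)) = Y 1 / ‖Y‖ :=
      Real.cos_arccos (by linarith) h1.le
    have hφ : Real.arccos (Y 1 / ‖Y‖) ∈ Ioo 0 (Real.pi / 2) :=
      ⟨Real.arccos_pos.2 h1, Real.arccos_lt_pi_div_two.2 h0⟩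
    obtain ⟨α, hα0, hα2⟩ := exists_polar (Y 0) (Y 2)
    have hρ' : ρ (Real.arccos (Y 1 / ‖Y‖)) = ‖Y‖ := by
      rw [hρ _ hφ, hcos, ← hYq, Real.sqrt_sq hn.le]
    have hsin : ‖Y‖ * Real.sin (Real.arccos (Y 1 / ‖Y‖)) = √(Y 0 ^ 2 + Y 2 ^ 2) := by
      rw [Real.sin_arccos, eq_comm, Real.sqrt_eq_iff_mul_self_eq (by positivity) (by positivity),
        mul_mul_mul_comm, Real.mul_self_sqrt]
      · field_simp
        linarith
      · have : (Y 1 / ‖Y‖) ^ 2 ≤ 1 := pow_le_one₀ h0.le h1.le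
        linarith
    refine ⟨Real.arccos (Y 1 / ‖Y‖), hφ, α, ?_⟩
    rw [swapYZ_apply, hρ', hsin, hcos, ← hα0, ← hα2]
    congr 3
    field_simp

namespace Profile

variable {q q₁ q₂ : ℝ → ℝ}

lemma exists_param_openCap (h : Profile q q₁ q₂) {X : E3} (hX : X ∈ swapYZ '' openCap q) :
    ∃ (φ : E2 → E3) (U : Set E2), IsLocalParam (swapYZ '' openCap q) ∅ φ U ∧
      X ∈ φ '' (U ∩ halfPlane) ∧ ∀ u ∈ U ∩ halfPlane, ShrinkerEquationAt φ u := by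
  obtain ⟨Y, hY, rfl⟩ := hX
  have hW : IsOpen {X : E3 | 0 < X 1 ∧ 0 < X 0 ^ 2 + X 2 ^ 2} := by
    have h1 : IsOpen {X : E3 | 0 < X 1} := isOpen_lt continuous_const (by fun_prop)
    have h2 : IsOpen {X : E3 | 0 < X 0 ^ 2 + X 2 ^ 2} := isOpen_lt continuous_const (by fun_prop)
    exact h1.inter h2
  obtain ⟨U, hU, hU1, hU2⟩ := h.isLocalParam_pole (S := openCap q) (B := ∅) hW
    (fun X hX => hX.1) (fun X hX => ⟨fun h => h.2, fun h => ⟨hX, h⟩⟩) (by simp)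
  have hσ := hU.isometry swapYZ
  rw [image_empty] at hσ
  refine ⟨_, U, hσ, ?_, fun u hu => shrinkerEquationAt_isometry swapYZ (hU2 u hu.1)⟩
  obtain ⟨u, hu, hu'⟩ := hU1 ⟨hY, hY.1⟩
  exact ⟨u, hu, by simp [hu']⟩

lemma isSurface_revolution (h : Profile q q₁ q₂) {ρ : ℝ → ℝ}
    (hρ : ∀ φ ∈ Ioo 0 (Real.pi / 2), ρ φ = √(q (1 - Real.cos φ))) :
    IsSurfaceWithBoundary (revolution ρ) ∅ ∧ IsSelfShrinker (revolution ρ) ∅ := by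
  rw [revolution_eq (fun w hw => h.pos w (mem_profileDomain_of_Icc hw.1 hw.2)) hρ]
  refine ⟨⟨empty_subset _, fun X hX => ?_⟩, fun X hX => h.exists_param_openCap hX⟩
  obtain ⟨φ, U, h1, h2, -⟩ := h.exists_param_openCap hX
  exact ⟨φ, U, h1, h2⟩

end Profile

/-! ### The family of profiles -/

/-- A smooth one-parameter family of profiles about the profile of the sphere of radius 2. -/
structure ProfileFamily (ε : ℝ) (q q₁ q₂ : ℝ → ℝ → ℝ) : Prop where
  pos : 0 < ε
  le_one : ε ≤ 1
  smooth : ContDiffOn ℝ ∞ (fun p : ℝ × ℝ => q p.1 p.2) (Ioo (-ε) ε ×ˢ profileDomain)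
  smooth₁ : ContDiffOn ℝ ∞ (fun p : ℝ × ℝ => q₁ p.1 p.2) (Ioo (-ε) ε ×ˢ profileDomain)
  profile : ∀ t ∈ Ioo (-ε) ε, Profile (q t) (q₁ t) (q₂ t)
  lt : ∀ t ∈ Ioo (-ε) ε, ∀ w ∈ profileDomain, q t w < 16
  zero : ∀ w, q 0 w = 4
  zero₁ : ∀ w, q₁ 0 w = 0
  pole : ∀ t, q t 0 = 4 + t
  rim : ∃ c < 0, HasDerivAt (fun t => q t 1) c 0
  rim₁ : ∃ c < 0, HasDerivAt (fun t => q₁ t 1) c 0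

/-- At `t = 0` the strict inequalities hold with `q = 4`; they persist for small `t`, uniformly on
the compact closure of `profileDomain`. The bound `16` serves the estimate of the graph function by
`2`. -/
theorem exists_profileFamily : ∃ (ε : ℝ) (q q₁ q₂ : ℝ → ℝ → ℝ), ProfileFamily ε q q₁ q₂ := by
  obtain ⟨ε, q, q₁, q₂, hε, hq, hq₁, hD, h0, h01, hp, hr, hr₁⟩ := exists_profile
  have hev : ∀ᶠ t in nhds (0 : ℝ), ∀ w ∈ Icc (-(1 / 4) : ℝ) (5 / 4),
      0 < q t w ∧ q t w < 16 ∧ 0 < 4 * q t w ^ 2 + w * (2 - w) * q₁ t w ^ 2 := by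
    refine isCompact_Icc.eventually_forall_of_forall_eventually fun w hw => ?_
    have hO : Ioo (-ε) ε ×ˢ Ioo (-(3 / 2) : ℝ) (3 / 2) ∈ nhds ((0 : ℝ), w) :=
      (isOpen_Ioo.prod isOpen_Ioo).mem_nhds ⟨⟨by simpa, hε⟩, by linarith [hw.1], by linarith [hw.2]⟩
    have c : ContinuousAt (fun p : ℝ × ℝ => q p.1 p.2) (0, w) := (hq.contDiffAt hO).continuousAt
    have c₁ : ContinuousAt (fun p : ℝ × ℝ => q₁ p.1 p.2) (0, w) := (hq₁.contDiffAt hO).continuousAt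
    have c₂ : ContinuousAt (fun p : ℝ × ℝ => 4 * q p.1 p.2 ^ 2 + p.2 * (2 - p.2) * q₁ p.1 p.2 ^ 2)
        (0, w) := ((c.pow 2).const_mul 4).add
      ((continuousAt_snd.mul (continuousAt_const.sub continuousAt_snd)).mul (c₁.pow 2))
    exact (c.eventually_const_lt (by simp [h0])).and
      ((c.eventually_lt_const (by simp only [h0]; norm_num)).and
        (c₂.eventually_const_lt (by simp [h0, h01])))
  obtain ⟨ε₁, hε₁, hball⟩ := Metric.eventually_nhds_iff.1 hev
  have hm1 : min ε (min ε₁ 1) ≤ ε := min_le_left _ _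
  have hm2 : min ε (min ε₁ 1) ≤ ε₁ := (min_le_right _ _).trans (min_le_left _ _)
  have hm3 : min ε (min ε₁ 1) ≤ 1 := (min_le_right _ _).trans (min_le_right _ _)
  have hm0 : 0 < min ε (min ε₁ 1) := by positivity
  set η := min ε (min ε₁ 1)
  have hsub : ∀ t ∈ Ioo (-η) η, t ∈ Ioo (-ε) ε := fun t ht =>
    ⟨by linarith [ht.1], by linarith [ht.2]⟩
  have hdom : ∀ w ∈ profileDomain, w ∈ Ioo (-(3 / 2) : ℝ) (3 / 2) := fun w hw =>
    ⟨by linarith [hw.1], by linarith [hw.2]⟩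
  have hgood : ∀ t ∈ Ioo (-η) η, ∀ w ∈ profileDomain,
      0 < q t w ∧ q t w < 16 ∧ 0 < 4 * q t w ^ 2 + w * (2 - w) * q₁ t w ^ 2 := by
    intro t ht w hw
    refine hball ?_ w ⟨hw.1.le, hw.2.le⟩
    rw [dist_zero_right, Real.norm_eq_abs, abs_lt]
    exact ⟨by linarith [ht.1], by linarith [ht.2]⟩
  refine ⟨η, q, q₁, q₂, hm0, hm3, hq.mono (prod_mono hsub hdom), hq₁.mono (prod_mono hsub hdom),
    fun t ht => ⟨?_, fun w hw => (hD t (hsub t ht) w (hdom w hw)).1,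
      fun w hw => (hD t (hsub t ht) w (hdom w hw)).2.1,
      fun w hw => (hD t (hsub t ht) w (hdom w hw)).2.2,
      fun w hw => (hgood t ht w hw).1, fun w hw => (hgood t ht w hw).2.2⟩,
    fun t ht w hw => (hgood t ht w hw).2.1, h0, h01, hp, hr, hr₁⟩
  exact hq.comp (f := fun w : ℝ => (t, w)) (by fun_prop) fun w hw => ⟨hsub t ht, hdom w hw⟩

/-! ### The generating curves. -/

lemma hasDerivAt_profile_cos {q q₁ q₂ : ℝ → ℝ} (h : Profile q q₁ q₂) {φ : ℝ}
    (hφ : 1 - Real.cos φ ∈ profileDomain) :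
    HasDerivAt (fun φ => √(q (1 - Real.cos φ)))
      (q₁ (1 - Real.cos φ) / (2 * √(q (1 - Real.cos φ))) * Real.sin φ) φ := by
  have := (h.hasDerivAt_sqrt hφ).comp φ ((Real.hasDerivAt_cos φ).const_sub 1)
  exact this.congr_deriv (by ring)

lemma exists_orientationReversing_subinterval {f : ℝ → ℝ} {x y c δ₀ : ℝ} (hδ₀ : 0 < δ₀)
    (hf : ContDiffOn ℝ ∞ f (Ioo (x - δ₀) (x + δ₀))) (hx : f x = y) (hc : c < 0)
    (hd : HasDerivAt f c x) : ∃ δ₁ > 0, ∀ δ, 0 < δ → δ ≤ δ₁ → ∃ a > 0, ∃ b > 0,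
      IsOrientationReversingDiffeo f (Ioo (x - δ) (x + δ)) (Ioo (y - a) (y + b)) := by
  subst hx
  exact exists_isOrientationReversingDiffeo hδ₀ hf (by rwa [hd.deriv])

/-- The parameter is changed to `t = h ^ 2 - 4`, so that the radius at the pole is `√(4 + t) = h`.
The factor `4 = dt/dh` at `h = 2` cancels against `2 √4`, and the derivatives in `h` at the rim are
the negative constants of `rim` and `rim₁`. -/
theorem ProfileFamily.generating_curves {ε : ℝ} {q q₁ q₂ : ℝ → ℝ → ℝ}
    (F : ProfileFamily ε q q₁ q₂) : ∃ (δ a₀ b₀ a₁ b₁ : ℝ) (ρ : ℝ → ℝ → ℝ),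
      0 < δ ∧ 0 < a₀ ∧ 0 < b₀ ∧ 0 < a₁ ∧ 0 < b₁ ∧
      SmoothOnNhd (fun q : ℝ × ℝ => ρ q.1 q.2)
        (Ioo (2 - δ) (2 + δ) ×ˢ Icc 0 (Real.pi / 2)) ∧
      (∀ h ∈ Ioo (2 - δ) (2 + δ), ∀ φ ∈ Icc 0 (Real.pi / 2), 0 < ρ h φ) ∧
      (∀ φ ∈ Icc 0 (Real.pi / 2), ρ 2 φ = 2) ∧
      (∀ h ∈ Ioo (2 - δ) (2 + δ), ρ h 0 = h ∧ deriv (ρ h) 0 = 0) ∧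
      IsOrientationReversingDiffeo (fun h => ρ h (Real.pi / 2))
        (Ioo (2 - δ) (2 + δ)) (Ioo (2 - a₀) (2 + b₀)) ∧
      IsOrientationReversingDiffeo (fun h => deriv (ρ h) (Real.pi / 2))
        (Ioo (2 - δ) (2 + δ)) (Ioo (-a₁) b₁) ∧
      ∀ h ∈ Ioo (2 - δ) (2 + δ),
        IsSurfaceWithBoundary (revolution (ρ h)) ∅ ∧ IsSelfShrinker (revolution (ρ h)) ∅ := by
  have hε := F.pos
  have hε1 := F.le_one
  -- For `|h - 2| < ε / 6` and `ε ≤ 1`, `|h ^ 2 - 4| ≤ |h - 2| (4 + |h - 2|) < ε`.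
  set δ₀ := ε / 6 with hδ₀
  have ht : ∀ h ∈ Ioo (2 - δ₀) (2 + δ₀), h ^ 2 - 4 ∈ Ioo (-ε) ε := by
    rintro h ⟨h1, h2⟩
    constructor <;> nlinarith
  have hφ : ∀ φ ∈ Icc 0 (Real.pi / 2), 1 - Real.cos φ ∈ Icc (0 : ℝ) 1 := fun φ hφ =>
    ⟨by linarith [Real.cos_le_one φ],
      by linarith [Real.cos_nonneg_of_mem_Icc ⟨by linarith [hφ.1, Real.pi_pos], hφ.2⟩]⟩
  have hdom : Icc (0 : ℝ) 1 ⊆ profileDomain := fun w hw => Profile.mem_profileDomain_of_Icc hw.1 hw.2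
  set ρ : ℝ → ℝ → ℝ := fun h φ => √(q (h ^ 2 - 4) (1 - Real.cos φ)) with hρ
  have hderiv : ∀ h ∈ Ioo (2 - δ₀) (2 + δ₀), ∀ φ ∈ Icc 0 (Real.pi / 2), deriv (ρ h) φ =
      q₁ (h ^ 2 - 4) (1 - Real.cos φ) / (2 * √(q (h ^ 2 - 4) (1 - Real.cos φ))) * Real.sin φ :=
    fun h hh φ hφ' =>
      (hasDerivAt_profile_cos (F.profile _ (ht h hh)) (hdom (hφ φ hφ'))).deriv
  have hpi : Real.pi / 2 ∈ Icc 0 (Real.pi / 2) := ⟨by linarith [Real.pi_pos], le_rfl⟩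
  have h0pi : (0 : ℝ) ∈ Icc 0 (Real.pi / 2) := ⟨le_rfl, by linarith [Real.pi_pos]⟩
  have h22 : (2 : ℝ) ^ 2 - 4 = 0 := by norm_num
  have h1dom : (1 : ℝ) ∈ profileDomain := hdom ⟨zero_le_one, le_rfl⟩
  have hsq : HasDerivAt (fun h : ℝ => h ^ 2 - 4) 4 2 :=
    (((hasDerivAt_id (2 : ℝ)).fun_pow 2).sub_const 4).congr_deriv (by norm_num)
  have hsm : ContDiffOn ℝ ∞ (fun h : ℝ => √(q (h ^ 2 - 4) 1)) (Ioo (2 - δ₀) (2 + δ₀)) :=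
    (F.smooth.comp (f := fun h : ℝ => (h ^ 2 - 4, (1 : ℝ))) (by fun_prop)
      fun h hh => ⟨ht h hh, h1dom⟩).sqrt fun h hh => ((F.profile _ (ht h hh)).pos _ h1dom).ne'
  have hsm₁ : ContDiffOn ℝ ∞ (fun h : ℝ => q₁ (h ^ 2 - 4) 1 / (2 * √(q (h ^ 2 - 4) 1)))
      (Ioo (2 - δ₀) (2 + δ₀)) :=
    (F.smooth₁.comp (f := fun h : ℝ => (h ^ 2 - 4, (1 : ℝ))) (by fun_prop)
      fun h hh => ⟨ht h hh, h1dom⟩).div (contDiffOn_const.mul hsm) fun h hh =>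
        (mul_pos two_pos (Real.sqrt_pos.2 ((F.profile _ (ht h hh)).pos _ h1dom))).ne'
  obtain ⟨c, hc, hcd⟩ := F.rim
  obtain ⟨c₁, hc₁, hcd₁⟩ := F.rim₁
  rw [← h22] at hcd hcd₁
  have hs2 : √(4 : ℝ) = 2 := by rw [show (4 : ℝ) = 2 ^ 2 by norm_num]; simp
  have hd : HasDerivAt (fun h : ℝ => √(q (h ^ 2 - 4) 1)) c 2 := by
    have := (hcd.comp 2 hsq).sqrt (by simp only [Function.comp_apply, h22, F.zero]; norm_num)
    refine this.congr_deriv ?_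
    simp only [Function.comp_apply, h22, F.zero, hs2]
    ring
  have hd₁ : HasDerivAt (fun h : ℝ => q₁ (h ^ 2 - 4) 1 / (2 * √(q (h ^ 2 - 4) 1))) c₁ 2 := by
    have := (hcd₁.comp 2 hsq).fun_div (hd.const_mul 2) (by rw [h22, F.zero, hs2]; norm_num)
    refine this.congr_deriv ?_
    simp only [Function.comp_apply, h22, F.zero, F.zero₁, hs2]
    ring
  obtain ⟨δ₁, hδ₁, H₁⟩ := exists_orientationReversing_subinterval (y := 2) (by positivity) hsm
    (by rw [h22, F.zero, hs2]) hc hd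
  obtain ⟨δ₂, hδ₂, H₂⟩ := exists_orientationReversing_subinterval (y := 0) (by positivity) hsm₁
    (by rw [h22, F.zero₁, zero_div]) hc₁ hd₁
  have hm0 : 0 < min δ₀ (min δ₁ δ₂) := by positivity
  obtain ⟨a₀, ha₀, b₀, hb₀, E₀⟩ := H₁ _ hm0 ((min_le_right _ _).trans (min_le_left _ _))
  obtain ⟨a₁, ha₁, b₁, hb₁, E₁⟩ := H₂ _ hm0 ((min_le_right _ _).trans (min_le_right _ _))
  have hmδ : min δ₀ (min δ₁ δ₂) ≤ δ₀ := min_le_left _ _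
  set δ := min δ₀ (min δ₁ δ₂)
  have hsub : ∀ h ∈ Ioo (2 - δ) (2 + δ), h ∈ Ioo (2 - δ₀) (2 + δ₀) := fun h hh =>
    ⟨by linarith [hh.1], by linarith [hh.2]⟩
  have hrim : (fun h => ρ h (Real.pi / 2)) = fun h : ℝ => √(q (h ^ 2 - 4) 1) := by
    funext h
    simp [hρ]
  have hrim₁ : ∀ h ∈ Ioo (2 - δ) (2 + δ), deriv (ρ h) (Real.pi / 2) =
      q₁ (h ^ 2 - 4) 1 / (2 * √(q (h ^ 2 - 4) 1)) := fun h hh => by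
    rw [hderiv h (hsub h hh) _ hpi]
    simp
  refine ⟨δ, a₀, b₀, a₁, b₁, ρ, hm0, ha₀, hb₀, ha₁, hb₁, ?_, ?_, ?_, ?_, ?_, ?_, ?_⟩
  · refine ⟨{p | p.1 ∈ Ioo (2 - δ₀) (2 + δ₀) ∧ 1 - Real.cos p.2 ∈ profileDomain}, ?_, ?_, ?_⟩
    · exact (isOpen_Ioo.preimage continuous_fst).inter
        (isOpen_profileDomain.preimage (by fun_prop))
    · exact fun p hp => ⟨hsub _ hp.1, hdom (hφ _ hp.2)⟩
    · exact (F.smooth.comp (f := fun p : ℝ × ℝ => (p.1 ^ 2 - 4, 1 - Real.cos p.2)) (by fun_prop)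
        fun p hp => ⟨ht _ hp.1, hp.2⟩).sqrt fun p hp => ((F.profile _ (ht _ hp.1)).pos _ hp.2).ne'
  · exact fun h hh φ hφ' => Real.sqrt_pos.2
      ((F.profile _ (ht _ (hsub h hh))).pos _ (hdom (hφ φ hφ')))
  · intro φ _
    simp only [hρ, h22, F.zero, hs2]
  · intro h hh
    constructor
    · have : 0 ≤ h := by linarith [(hsub h hh).1]
      simp only [hρ, Real.cos_zero, sub_self, F.pole]
      rw [add_sub_cancel, Real.sqrt_sq this]
    · rw [hderiv h (hsub h hh) 0 h0pi, Real.sin_zero, mul_zero]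
  · rw [hrim]
    exact E₀
  · rw [zero_sub, zero_add] at E₁
    refine ⟨E₁.1.congr hrim₁, E₁.2.1.congr fun h hh => (hrim₁ h hh).symm, fun h hh => ?_⟩
    have : (fun h => deriv (ρ h) (Real.pi / 2)) =ᶠ[nhds h]
        fun h => q₁ (h ^ 2 - 4) 1 / (2 * √(q (h ^ 2 - 4) 1)) := by
      filter_upwards [isOpen_Ioo.mem_nhds hh] with k hk using hrim₁ k hk
    rw [this.deriv_eq]
    exact E₁.2.2 h hh
  · intro h hh
    exact (F.profile _ (ht _ (hsub h hh))).isSurface_revolution fun φ _ => rfl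

/-! ### The contact angle as a parameter -/

/-- The map `t ↦ arctan (q₁ / (2 q))` at `w = 1` has derivative `c₁ / 8 < 0` at `0`, because `q = 4`
and `q₁ = 0` there. So it is locally invertible, and `τ θ` is its inverse at `-θ`. -/
lemma ProfileFamily.exists_angle {ε : ℝ} {q q₁ q₂ : ℝ → ℝ → ℝ} (F : ProfileFamily ε q q₁ q₂) :
    ∃ (δ : ℝ) (τ : ℝ → ℝ), 0 < δ ∧ δ < Real.pi / 2 ∧ ContDiffOn ℝ ∞ τ (Ioo (-δ) δ) ∧ τ 0 = 0 ∧
      ∀ θ ∈ Ioo (-δ) δ, τ θ ∈ Ioo (-ε) ε ∧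
        Real.tan θ = -q₁ (τ θ) 1 / (2 * q (τ θ) 1) := by
  have h1dom : (1 : ℝ) ∈ profileDomain := Profile.mem_profileDomain_of_Icc zero_le_one le_rfl
  set f : ℝ → ℝ := fun t => Real.arctan (q₁ t 1 / (2 * q t 1)) with hf
  have hf0 : f 0 = 0 := by simp [hf, F.zero₁]
  have hsm : ContDiffOn ℝ ∞ f (Ioo (0 - ε) (0 + ε)) := by
    rw [zero_sub, zero_add]
    exact ((F.smooth₁.comp (f := fun t : ℝ => (t, (1 : ℝ))) (by fun_prop)
      fun t ht => ⟨ht, h1dom⟩).div (contDiffOn_const.mul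
        (F.smooth.comp (f := fun t : ℝ => (t, (1 : ℝ))) (by fun_prop)
          fun t ht => ⟨ht, h1dom⟩)) fun t ht =>
        (mul_pos two_pos ((F.profile t ht).pos _ h1dom)).ne').arctan
  obtain ⟨c, hc, hcd⟩ := F.rim
  obtain ⟨c₁, hc₁, hcd₁⟩ := F.rim₁
  have hd : HasDerivAt f (c₁ / 8) 0 := by
    have := (hcd₁.fun_div (hcd.const_mul 2) (by rw [F.zero]; norm_num)).arctan
    refine this.congr_deriv ?_
    simp only [F.zero, F.zero₁]
    ring
  obtain ⟨δ₁, hδ₁, H⟩ := exists_orientationReversing_subinterval F.pos hsm hf0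
    (by linarith : c₁ / 8 < 0) hd
  have hm0 : 0 < min ε δ₁ := lt_min F.pos hδ₁
  have hmε : min ε δ₁ ≤ ε := min_le_left _ _
  obtain ⟨a, ha, b, hb, E₀, E₁, E₂⟩ := H _ hm0 (min_le_right _ _)
  simp only [zero_sub, zero_add] at E₀ E₁ E₂
  obtain ⟨-, g, hg, hgf⟩ := exists_smooth_inverse isOpen_Ioo E₀ E₁.injOn fun t ht => by
    have hne := (E₂ t ht).ne
    intro v w hvw
    rw [fderiv_eq_smul_deriv, fderiv_eq_smul_deriv] at hvw
    exact mul_right_cancel₀ hne hvw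
  rw [E₁.image_eq] at hg
  have hδ0 : 0 < min (min a b) 1 := by positivity
  have hδa : min (min a b) 1 ≤ a := (min_le_left _ _).trans (min_le_left _ _)
  have hδb : min (min a b) 1 ≤ b := (min_le_left _ _).trans (min_le_right _ _)
  have hδ1 : min (min a b) 1 ≤ 1 := min_le_right _ _
  set δ := min (min a b) 1
  have hmem : ∀ θ ∈ Ioo (-δ) δ, -θ ∈ Ioo (-a) b := fun θ hθ =>
    ⟨by linarith [hθ.2], by linarith [hθ.1]⟩
  refine ⟨δ, fun θ => g (-θ), hδ0, by linarith [Real.pi_gt_three],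
    hg.comp (by fun_prop) hmem, ?_, fun θ hθ => ?_⟩
  · have := hgf 0 ⟨by linarith, hm0⟩
    simpa [hf0] using this
  · obtain ⟨t, ht, hft⟩ := E₁.surjOn (hmem θ hθ)
    have htg : g (-θ) = t := by rw [← hft, hgf t ht]
    simp only [htg]
    refine ⟨⟨by linarith [ht.1], by linarith [ht.2]⟩, ?_⟩
    have : Real.tan (-θ) = q₁ t 1 / (2 * q t 1) := by rw [← hft, hf, Real.tan_arctan]
    rw [Real.tan_neg] at this
    rw [neg_div, ← this, neg_neg]

/-! ### Conformal parametrizations of a cap -/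

/-- The curve `(x, y)` is the meridian of the cap with profile `q`, from its rim to its pole,
parametrized so that the parametrization of the cap by revolution is conformal; `w s` is the
argument of the profile at the parameter value `s`. -/
structure ConformalMeridian (q q₁ x y w : ℝ → ℝ) : Prop where
  mem : ∀ s, 0 ≤ s → w s ∈ Ioc 0 1
  hasDerivAt : ∀ s, 0 ≤ s → HasDerivAt w (-(w s * (2 - w s)) /
    √(1 + w s * (2 - w s) * (q₁ (w s) / (2 * q (w s))) ^ 2)) s
  -- The identity is required near `s`, not only for nonnegative parameters, so that it can be
  -- differentiated at `s = 0` as well.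
  x_eq : ∀ s, 0 ≤ s → ∀ᶠ s' in nhds s, x s' = √(q (w s')) * √(w s' * (2 - w s'))
  y_eq : ∀ s, 0 ≤ s → ∀ᶠ s' in nhds s, y s' = √(q (w s')) * (1 - w s')
  zero : w 0 = 1
  injOn : InjOn w (Ici 0)
  surj : ∀ w₀ ∈ Ioc (0 : ℝ) 1, ∃ s, 0 ≤ s ∧ w s = w₀

lemma revParam_image_eq {x y : ℝ → ℝ} {s : ℝ} (hx : 0 < x s) :
    revParam x y '' {p | p 0 = s} = circleY (y s) (x s) := by
  ext X
  constructor
  · rintro ⟨p, rfl, rfl⟩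
    refine ⟨rfl, ?_⟩
    simp only [revParam, Matrix.cons_val_zero, Matrix.cons_val]
    linear_combination x (p 0) ^ 2 * Real.sin_sq_add_cos_sq (p 1)
  · rintro ⟨h1, h2⟩
    obtain ⟨z, hz0, hz2⟩ := exists_polar (X 0) (X 2)
    rw [h2, Real.sqrt_sq hx.le] at hz0 hz2
    exact ⟨!₂[s, z], rfl, ext_E3 hz0.symm h1.symm hz2.symm⟩

lemma exists_int_of_cos_sin_eq {a b : ℝ} (hc : Real.cos a = Real.cos b)
    (hs : Real.sin a = Real.sin b) : ∃ n : ℤ, b = a + 2 * Real.pi * n := by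
  obtain ⟨n, hn⟩ := Real.Angle.angle_eq_iff_two_pi_dvd_sub.1 (Real.Angle.cos_sin_inj hc hs).symm
  exact ⟨n, by linarith⟩

namespace ConformalMeridian

variable {q q₁ q₂ x y w : ℝ → ℝ}

lemma x_apply (M : ConformalMeridian q q₁ x y w) {s : ℝ} (hs : 0 ≤ s) :
    x s = √(q (w s)) * √(w s * (2 - w s)) := (M.x_eq s hs).self_of_nhds

lemma y_apply (M : ConformalMeridian q q₁ x y w) {s : ℝ} (hs : 0 ≤ s) :
    y s = √(q (w s)) * (1 - w s) := (M.y_eq s hs).self_of_nhds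

lemma mem_profileDomain (M : ConformalMeridian q q₁ x y w) {s : ℝ} (hs : 0 ≤ s) :
    w s ∈ profileDomain :=
  Profile.mem_profileDomain_of_Icc (M.mem s hs).1.le (M.mem s hs).2

lemma latitude_pos (M : ConformalMeridian q q₁ x y w) {s : ℝ} (hs : 0 ≤ s) :
    0 < w s * (2 - w s) := mul_pos (M.mem s hs).1 (by linarith [(M.mem s hs).2])

lemma x_pos (M : ConformalMeridian q q₁ x y w) (h : Profile q q₁ q₂) {s : ℝ} (hs : 0 ≤ s) :
    0 < x s := by
  rw [M.x_apply hs]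
  exact mul_pos (Real.sqrt_pos.2 (h.pos _ (M.mem_profileDomain hs)))
    (Real.sqrt_pos.2 (M.latitude_pos hs))

lemma x_zero (M : ConformalMeridian q q₁ x y w) : x 0 = √(q 1) := by
  rw [M.x_apply le_rfl, M.zero]
  norm_num

lemma y_zero (M : ConformalMeridian q q₁ x y w) : y 0 = 0 := by
  rw [M.y_apply le_rfl, M.zero, sub_self, mul_zero]

lemma sq_add_sq (M : ConformalMeridian q q₁ x y w) {s : ℝ} (hs : 0 ≤ s) :
    x s ^ 2 + y s ^ 2 = √(q (w s)) ^ 2 := by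
  rw [M.x_apply hs, M.y_apply hs]
  linear_combination √(q (w s)) ^ 2 * Real.sq_sqrt (M.latitude_pos hs).le

/-- The image point determines the distance to the axis and the height, hence `√q`, hence `w`
through `y = √q (1 - w)`, and finally `s` by injectivity of `w`; what is left is the angle modulo
`2π`. -/
lemma eq_iff (M : ConformalMeridian q q₁ x y w) (h : Profile q q₁ q₂) {p p' : E2}
    (hp : p ∈ halfPlane) (hp' : p' ∈ halfPlane) : revParam x y p = revParam x y p' ↔
      p 0 = p' 0 ∧ ∃ n : ℤ, p' 1 = p 1 + 2 * Real.pi * n := by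
  constructor
  · intro heq
    have e0 : x (p 0) * Real.cos (p 1) = x (p' 0) * Real.cos (p' 1) :=
      congrArg (fun X : E3 => X 0) heq
    have e1 : y (p 0) = y (p' 0) := congrArg (fun X : E3 => X 1) heq
    have e2 : x (p 0) * Real.sin (p 1) = x (p' 0) * Real.sin (p' 1) :=
      congrArg (fun X : E3 => X 2) heq
    have hx := M.x_pos h hp
    have hx' := M.x_pos h hp'
    have ex : x (p 0) = x (p' 0) := by
      rw [← sq_eq_sq₀ hx.le hx'.le]
      linear_combination (x (p 0) * Real.cos (p 1) + x (p' 0) * Real.cos (p' 1)) * e0 +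
        (x (p 0) * Real.sin (p 1) + x (p' 0) * Real.sin (p' 1)) * e2 -
        x (p 0) ^ 2 * Real.sin_sq_add_cos_sq (p 1) + x (p' 0) ^ 2 * Real.sin_sq_add_cos_sq (p' 1)
    have hR : √(q (w (p 0))) = √(q (w (p' 0))) := by
      rw [← sq_eq_sq₀ (Real.sqrt_nonneg _) (Real.sqrt_nonneg _), ← M.sq_add_sq hp,
        ← M.sq_add_sq hp', ex, e1]
    have hR0 := Real.sqrt_pos.2 (h.pos _ (M.mem_profileDomain hp'))
    rw [M.y_apply hp, M.y_apply hp', hR] at e1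
    have hw : w (p 0) = w (p' 0) := by linarith [mul_left_cancel₀ hR0.ne' e1]
    rw [ex] at e0 e2
    exact ⟨M.injOn hp hp' hw, exists_int_of_cos_sin_eq (mul_left_cancel₀ hx'.ne' e0)
      (mul_left_cancel₀ hx'.ne' e2)⟩
  · rintro ⟨h0, n, hn⟩
    rw [revParam, revParam, h0, hn, mul_comm (2 * Real.pi), Real.cos_add_int_mul_two_pi,
      Real.sin_add_int_mul_two_pi]

/-- As `s` runs through `[0, ∞)`, `w` takes exactly the values in `(0, 1]`. The missing value `0` is
the pole, the only point of the cap on the axis. -/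
lemma image_halfPlane (M : ConformalMeridian q q₁ x y w) (h : Profile q q₁ q₂) :
    revParam x y '' halfPlane = capSet q \ yAxis := by
  ext X
  constructor
  · rintro ⟨p, hp, rfl⟩
    have hR := Real.sqrt_pos.2 (h.pos _ (M.mem_profileDomain hp))
    have hn : ‖revParam x y p‖ = √(q (w (p 0))) := by
      rw [← sq_eq_sq₀ (norm_nonneg _) hR.le, ← M.sq_add_sq hp, norm_sq_E3]
      simp only [revParam, Matrix.cons_val_zero, Matrix.cons_val_one, Matrix.cons_val]
      linear_combination x (p 0) ^ 2 * Real.sin_sq_add_cos_sq (p 1)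
    have hy : revParam x y p 1 = √(q (w (p 0))) * (1 - w (p 0)) := M.y_apply hp
    refine ⟨⟨?_, ?_, ?_⟩, ?_⟩
    · rw [← norm_pos_iff, hn]
      exact hR
    · rw [hy]
      exact mul_nonneg hR.le (by linarith [(M.mem _ hp).2])
    · rw [hn, hy, Real.sq_sqrt (h.pos _ (M.mem_profileDomain hp)).le,
        mul_div_cancel_left₀ _ hR.ne', sub_sub_cancel]
    · rintro ⟨h0, h2⟩
      have e0 : x (p 0) * Real.cos (p 1) = 0 := h0
      have e2 : x (p 0) * Real.sin (p 1) = 0 := h2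
      have hx := M.x_pos h hp
      have hc := (mul_eq_zero.1 e0).resolve_left hx.ne'
      have hs := (mul_eq_zero.1 e2).resolve_left hx.ne'
      have := Real.sin_sq_add_cos_sq (p 1)
      rw [hc, hs] at this
      norm_num at this
  · rintro ⟨⟨h0, h1, h2⟩, hax⟩
    have hn : 0 < ‖X‖ := norm_pos_iff.2 h0
    have hnsq := norm_sq_E3 X
    have hd : 0 < X 0 ^ 2 + X 2 ^ 2 := by
      by_contra hneg
      exact hax ⟨by nlinarith [sq_nonneg (X 0), sq_nonneg (X 2)],
        by nlinarith [sq_nonneg (X 0), sq_nonneg (X 2)]⟩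
    have hlt : X 1 < ‖X‖ := by nlinarith
    obtain ⟨s, hs, hws⟩ := M.surj (1 - X 1 / ‖X‖)
      ⟨by rw [sub_pos, div_lt_one hn]; exact hlt, by linarith [div_nonneg h1 hn.le]⟩
    have hR : √(q (w s)) = ‖X‖ := by rw [hws, ← h2, Real.sqrt_sq hn.le]
    have hy : y s = X 1 := by
      rw [M.y_apply hs, hR, hws]
      field_simp
      ring
    have hx : x s = √(X 0 ^ 2 + X 2 ^ 2) := by
      rw [← sq_eq_sq₀ (M.x_pos h hs).le (Real.sqrt_nonneg _), Real.sq_sqrt hd.le]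
      have := M.sq_add_sq hs
      rw [hR, hy, hnsq] at this
      linarith
    obtain ⟨z, hz0, hz2⟩ := exists_polar (X 0) (X 2)
    rw [← hx] at hz0 hz2
    exact ⟨!₂[s, z], hs, ext_E3 hz0.symm hy hz2.symm⟩

lemma image_edge (M : ConformalMeridian q q₁ x y w) (h : Profile q q₁ q₂) :
    revParam x y '' edge = circleY 0 (√(q 1)) := by
  have := revParam_image_eq (y := y) (M.x_pos h le_rfl)
  rwa [M.x_zero, M.y_zero] at this

/-- In polar coordinates the meridian has speed `√q · stretch` in `φ`. The equation for `w` means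
`dφ/ds = -sin φ / stretch`, so the speed in `s` is `√q sin φ`, the distance to the axis. -/
lemma exists_hasDerivAt (M : ConformalMeridian q q₁ x y w) (h : Profile q q₁ q₂) {s : ℝ}
    (hs : 0 ≤ s) : ∃ x' y' : ℝ, HasDerivAt x x' s ∧ HasDerivAt y y' s ∧
      x' ^ 2 + y' ^ 2 = x s ^ 2 := by
  have hdom := M.mem_profileDomain hs
  have hl := M.latitude_pos hs
  have hw := M.hasDerivAt s hs
  have hR := (h.hasDerivAt_sqrt hdom).comp s hw
  have hσ := ((hw.fun_mul (hw.const_sub 2)).sqrt hl.ne')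
  have hx := (hR.fun_mul hσ).congr_of_eventuallyEq (M.x_eq s hs)
  have hy := (hR.fun_mul (hw.const_sub 1)).congr_of_eventuallyEq (M.y_eq s hs)
  refine ⟨_, _, hx, hy, ?_⟩
  have hq := h.pos _ hdom
  have hsp := h.speed_pos _ hdom
  rw [M.x_apply hs]
  simp only [Function.comp_apply]
  generalize q₁ (w s) = b at *
  have hR0 := Real.sqrt_pos.2 hq
  have hR2 := Real.sq_sqrt hq.le
  generalize √(q (w s)) = R at *
  rw [← hR2] at hsp ⊢
  generalize w s = v at *
  have hσ0 := Real.sqrt_pos.2 hl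
  have hσ2 := Real.sq_sqrt hl.le
  generalize √(v * (2 - v)) = σ at *
  have hP : 0 < 1 + v * (2 - v) * (b / (2 * R ^ 2)) ^ 2 := by
    have : 1 + v * (2 - v) * (b / (2 * R ^ 2)) ^ 2 =
        (4 * (R ^ 2) ^ 2 + v * (2 - v) * b ^ 2) / (4 * (R ^ 2) ^ 2) := by
      field_simp
      ring
    rw [this]
    positivity
  have hP0 := Real.sqrt_pos.2 hP
  have hP2 := Real.sq_sqrt hP.le
  generalize √(1 + v * (2 - v) * (b / (2 * R ^ 2)) ^ 2) = P at *
  have hP2' : 2 ^ 2 * R ^ 4 * P ^ 2 = 2 ^ 2 * R ^ 4 + v * (2 - v) * b ^ 2 := by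
    rw [hP2]
    field_simp
  field_simp
  rw [show σ ^ 4 = (σ ^ 2) ^ 2 by ring, hσ2]
  linear_combination -(v * (2 - v)) ^ 2 * hP2'

lemma inner_fderiv (M : ConformalMeridian q q₁ x y w) (h : Profile q q₁ q₂) {p : E2}
    (hp : p ∈ halfPlane) (hd : DifferentiableAt ℝ (revParam x y) p) (v v' : E2) :
    ⟪fderiv ℝ (revParam x y) p v, fderiv ℝ (revParam x y) p v'⟫ =
      ((revParam x y p 0) ^ 2 + (revParam x y p 2) ^ 2) * ⟪v, v'⟫ := by
  obtain ⟨x', y', hx, hy, heq⟩ := M.exists_hasDerivAt h hp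
  have hfd : ∀ v : E2, fderiv ℝ (revParam x y) p v =
      v 0 • !₂[x' * Real.cos (p 1), y', x' * Real.sin (p 1)] +
      v 1 • !₂[-(x (p 0) * Real.sin (p 1)), 0, x (p 0) * Real.cos (p 1)] := by
    intro v
    rw [← pd_zero_revParam hd hx hy, ← pd_one_revParam hd, pd, pd, ← map_smul, ← map_smul,
      ← map_add]
    congr 1
    ext i
    fin_cases i <;> simp
  have hv : ⟪v, v'⟫ = v 0 * v' 0 + v 1 * v' 1 := by
    rw [PiLp.inner_apply, Fin.sum_univ_two]
    simp [mul_comm]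
  rw [hfd, hfd, inner_E3, hv]
  simp only [PiLp.add_apply, PiLp.smul_apply, smul_eq_mul, revParam, Matrix.cons_val_zero,
    Matrix.cons_val_one, Matrix.cons_val]
  linear_combination (v 0 * v' 0) * heq +
    (v 0 * v' 0 * x' ^ 2 - v 0 * v' 0 * x (p 0) ^ 2) * Real.sin_sq_add_cos_sq (p 1)

end ConformalMeridian

/-! ### Construction of the conformal meridians -/

/-- Rescaling the path from `w₀` to `w` to the fixed interval `[0, 1]` turns the upper limit into a
parameter of the integrand, and joint smoothness is then `contDiffOn_integral`. -/
lemma exists_smooth_antideriv {b : ℝ → ℝ → ℝ} {I J : Set ℝ} {w₀ : ℝ} (hI : IsOpen I) (hJ : IsOpen J)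
    (hJc : Convex ℝ J) (hw₀ : w₀ ∈ J)
    (hb : ContDiffOn ℝ ∞ (fun p : ℝ × ℝ => b p.1 p.2) (I ×ˢ J)) :
    ∃ B : ℝ → ℝ → ℝ, ContDiffOn ℝ ∞ (fun p : ℝ × ℝ => B p.1 p.2) (I ×ˢ J) ∧
      (∀ t ∈ I, ∀ w ∈ J, HasDerivAt (B t) (b t w) w) ∧ ∀ t, B t w₀ = 0 := by
  have hseg : ∀ w ∈ J, ∀ s ∈ Icc (0 : ℝ) 1, w₀ + (w - w₀) * s ∈ J := fun w hw s hs => by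
    have := hJc hw₀ hw (sub_nonneg.2 hs.2) hs.1 (by ring)
    rw [smul_eq_mul, smul_eq_mul] at this
    convert this using 1
    ring
  have heq : ∀ t w, (∫ s in (0 : ℝ)..1, (w - w₀) * b t (w₀ + (w - w₀) * s)) =
      ∫ v in w₀..w, b t v := fun t w => by
    rw [intervalIntegral.integral_const_mul, intervalIntegral.mul_integral_comp_add_mul]
    congr 1 <;> ring
  refine ⟨fun t w => ∫ s in (0 : ℝ)..1, (w - w₀) * b t (w₀ + (w - w₀) * s), ?_,
    fun t ht w hw => ?_, fun t => by simp⟩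
  · refine contDiffOn_integral (F := fun z : (ℝ × ℝ) × ℝ => (z.1.2 - w₀) *
      b z.1.1 (w₀ + (z.1.2 - w₀) * z.2)) (hI.prod hJ) fun p hp s hs => ?_
    have hmem : (p.1, w₀ + (p.2 - w₀) * s) ∈ I ×ˢ J := ⟨hp.1, hseg _ hp.2 s hs⟩
    have hc := hb.contDiffAt ((hI.prod hJ).mem_nhds hmem)
    have h1 : ContDiffAt ℝ ∞ (fun z : (ℝ × ℝ) × ℝ => (z.1.1, w₀ + (z.1.2 - w₀) * z.2)) (p, s) := by
      fun_prop
    have h2 : ContDiffAt ℝ ∞ (fun z : (ℝ × ℝ) × ℝ => z.1.2 - w₀) (p, s) := by fun_prop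
    exact h2.mul (ContDiffAt.comp (g := fun p : ℝ × ℝ => b p.1 p.2) (p, s) hc h1)
  · have hcont : ContinuousOn (b t) J :=
      hb.continuousOn.comp (f := fun w : ℝ => (t, w)) (by fun_prop) fun w hw => ⟨ht, hw⟩
    refine HasDerivAt.congr_of_eventuallyEq ?_ (Filter.Eventually.of_forall (heq t))
    have hsub : uIcc w₀ w ⊆ J := hJc.ordConnected.uIcc_subset hw₀ hw
    exact intervalIntegral.integral_hasDerivAt_right
      ((hcont.mono hsub).intervalIntegrable)
      (hcont.stronglyMeasurableAtFilter hJ w hw) (hcont.continuousAt (hJ.mem_nhds hw))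

/-- Apply `exists_smooth_inverse` to `(t, w) ↦ (t, T t w)`. Its derivative is triangular with
positive diagonal entry `T'`, and it is injective because each `T t` is strictly increasing. -/
lemma exists_smooth_inverse_snd {T T' : ℝ → ℝ → ℝ} {I J : Set ℝ} (hI : IsOpen I) (hJ : IsOpen J)
    (hJc : Convex ℝ J) (hT : ContDiffOn ℝ ∞ (fun p : ℝ × ℝ => T p.1 p.2) (I ×ˢ J))
    (hd : ∀ t ∈ I, ∀ w ∈ J, HasDerivAt (T t) (T' t w) w)
    (hpos : ∀ t ∈ I, ∀ w ∈ J, 0 < T' t w) :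
    ∃ (O : Set (ℝ × ℝ)) (W : ℝ → ℝ → ℝ), IsOpen O ∧
      ContDiffOn ℝ ∞ (fun p : ℝ × ℝ => W p.1 p.2) O ∧
      (∀ t ∈ I, ∀ w ∈ J, (t, T t w) ∈ O ∧ W t (T t w) = w) ∧
      ∀ t τ, (t, τ) ∈ O → t ∈ I ∧ W t τ ∈ J ∧ T t (W t τ) = τ := by
  have hmono : ∀ t ∈ I, StrictMonoOn (T t) J := fun t ht =>
    strictMonoOn_of_deriv_pos hJc (fun w hw => (hd t ht w hw).continuousAt.continuousWithinAt)
      fun w hw => by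
        rw [hJ.interior_eq] at hw
        rw [(hd t ht w hw).deriv]
        exact hpos t ht w hw
  have hopen := hI.prod hJ
  obtain ⟨hO, g, hg, hgT⟩ := exists_smooth_inverse (G := fun p : ℝ × ℝ => (p.1, T p.1 p.2)) hopen
    (contDiffOn_fst.prodMk hT) (by
      rintro ⟨t, w⟩ ⟨ht, hw⟩ ⟨t', w'⟩ ⟨-, hw'⟩ heq
      obtain ⟨rfl, h2⟩ := Prod.mk.inj heq
      exact Prod.ext rfl ((hmono t ht).injOn hw hw' h2)) (by
      rintro ⟨t, w⟩ ⟨ht, hw⟩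
      have hTd := ((hT.contDiffAt (hopen.mem_nhds ⟨ht, hw⟩)).differentiableAt
        (by simp)).hasFDerivAt
      have hfd := (hasFDerivAt_fst (𝕜 := ℝ) (p := (t, w))).prodMk hTd
      rw [hfd.fderiv, injective_iff_map_eq_zero]
      rintro ⟨v, v'⟩ hv
      obtain ⟨h1, h2⟩ := Prod.mk.inj hv
      have hv0 : v = 0 := h1
      subst hv0
      have hline : HasDerivAt (fun w : ℝ => (t, w)) ((0 : ℝ), (1 : ℝ)) w :=
        (hasDerivAt_const w t).prodMk (hasDerivAt_id w)
      have hpart := (hTd.comp_hasDerivAt (f := fun w : ℝ => (t, w)) w hline).unique (hd t ht w hw)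
      have : ((0 : ℝ), v') = v' • ((0 : ℝ), (1 : ℝ)) := by simp
      have h3 : fderiv ℝ (fun p : ℝ × ℝ => T p.1 p.2) (t, w) (0, v') = 0 := h2
      rw [this, map_smul, hpart, smul_eq_mul] at h3
      rw [(mul_eq_zero.1 h3).resolve_right (hpos t ht w hw).ne']
      rfl)
  refine ⟨_, fun t τ => (g (t, τ)).2, hO, hg.snd, fun t ht w hw => ⟨⟨(t, w), ⟨ht, hw⟩, rfl⟩, ?_⟩, ?_⟩
  · have := hgT (t, w) ⟨ht, hw⟩
    simp only at this ⊢
    rw [this]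
  · rintro t τ ⟨⟨t', w⟩, ⟨ht, hw⟩, heq⟩
    obtain ⟨rfl, rfl⟩ := Prod.mk.inj heq
    have := hgT (t', w) ⟨ht, hw⟩
    simp only at this ⊢
    rw [this]
    exact ⟨ht, hw, rfl⟩

lemma convex_profileDomain : Convex ℝ profileDomain := convex_Ioo _ _

namespace Profile

variable {q q₁ q₂ : ℝ → ℝ}

lemma one_add_slope_sq_pos (h : Profile q q₁ q₂) {w : ℝ} (hw : w ∈ profileDomain) :
    0 < 1 + w * (2 - w) * (q₁ w / (2 * q w)) ^ 2 := by
  have hq := h.pos w hw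
  have hs := h.speed_pos w hw
  have : 1 + w * (2 - w) * (q₁ w / (2 * q w)) ^ 2 =
      (4 * q w ^ 2 + w * (2 - w) * q₁ w ^ 2) / (4 * q w ^ 2) := by
    field_simp
    ring
  rw [this]
  positivity

end Profile

/-- The ratio of the arc length elements of a cap and of the unit circle. -/
def stretch (q q₁ : ℝ → ℝ) (w : ℝ) : ℝ := √(1 + w * (2 - w) * (q₁ w / (2 * q w)) ^ 2)

/-- The logarithmic derivative of the quotient of `exp (-2 s)` by `w`, where `s` is the conformal
parameter. -/
def logSlope (q q₁ : ℝ → ℝ) (w : ℝ) : ℝ :=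
  1 / (2 - w) + 2 * (q₁ w / (2 * q w)) ^ 2 / (1 + stretch q q₁ w)

/-- `logSlope` is `2 stretch / (w (2 - w))` with the pole `1 / w` removed. The singularity
disappears because `stretch² - 1` is divisible by `w`. -/
lemma Profile.one_add_mul_logSlope {q q₁ q₂ : ℝ → ℝ} (h : Profile q q₁ q₂) {w : ℝ}
    (hw : w ∈ profileDomain) : 1 + w * logSlope q q₁ w = 2 * stretch q q₁ w / (2 - w) := by
  have h2 : 0 < 2 - w := by linarith [hw.2]
  have hsq : stretch q q₁ w ^ 2 = _ := Real.sq_sqrt (h.one_add_slope_sq_pos hw).le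
  have h0 : 0 < stretch q q₁ w := Real.sqrt_pos.2 (h.one_add_slope_sq_pos hw)
  rw [logSlope]
  generalize q₁ w / (2 * q w) = a at *
  generalize stretch q q₁ w = P at *
  field_simp
  linear_combination -2 * hsq

namespace ProfileFamily

variable {ε : ℝ} {q q₁ q₂ : ℝ → ℝ → ℝ}

lemma smooth_logSlope (F : ProfileFamily ε q q₁ q₂) :
    ContDiffOn ℝ ∞ (fun p : ℝ × ℝ => logSlope (q p.1) (q₁ p.1) p.2)
      (Ioo (-ε) ε ×ˢ profileDomain) := by
  have ha : ContDiffOn ℝ ∞ (fun p : ℝ × ℝ => q₁ p.1 p.2 / (2 * q p.1 p.2))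
      (Ioo (-ε) ε ×ˢ profileDomain) := F.smooth₁.div (contDiffOn_const.mul F.smooth)
    fun p hp => (mul_pos two_pos ((F.profile _ hp.1).pos _ hp.2)).ne'
  have h2 : ContDiffOn ℝ ∞ (fun p : ℝ × ℝ => 2 - p.2) (Ioo (-ε) ε ×ˢ profileDomain) := by fun_prop
  have hP : ContDiffOn ℝ ∞ (fun p : ℝ × ℝ => stretch (q p.1) (q₁ p.1) p.2)
      (Ioo (-ε) ε ×ˢ profileDomain) :=
    (contDiffOn_const.add ((contDiffOn_snd.mul h2).mul (ha.pow 2))).sqrt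
      fun p hp => ((F.profile _ hp.1).one_add_slope_sq_pos hp.2).ne'
  exact (contDiffOn_const.div h2 fun p hp => by linarith [hp.2.2]).add
    ((contDiffOn_const.mul (ha.pow 2)).div (contDiffOn_const.add hP)
      fun p hp => (add_pos_of_pos_of_nonneg one_pos (Real.sqrt_nonneg _)).ne')

/-- Separating variables in the equation for `w` gives `T t w = exp(-2 s)` with `T t w = w exp(B t
w)`. This `T t` increases with positive derivative across `w = 0` and fixes `0` and `1`, so `w` is
smooth in `exp(-2 s)` up to the value `0`, which is the end of the cylinder. -/
theorem exists_conformalMeridian (F : ProfileFamily ε q q₁ q₂) :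
    ∃ (O : Set (ℝ × ℝ)) (α β : ℝ → ℝ → ℝ), IsOpen O ∧
      (∀ t ∈ Ioo (-ε) ε, ∀ τ ∈ Icc (0 : ℝ) 1, (t, τ) ∈ O) ∧
      ContDiffOn ℝ ∞ (fun p : ℝ × ℝ => α p.1 p.2) O ∧
      ContDiffOn ℝ ∞ (fun p : ℝ × ℝ => β p.1 p.2) O ∧
      ∀ t ∈ Ioo (-ε) ε, ∃ w : ℝ → ℝ, ConformalMeridian (q t) (q₁ t)
        (fun s => Real.exp (-s) * α t (Real.exp (-s) ^ 2)) (fun s => β t (Real.exp (-s) ^ 2)) w := by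
  have h0dom : (0 : ℝ) ∈ profileDomain := Profile.mem_profileDomain_of_Icc le_rfl zero_le_one
  have h1dom : (1 : ℝ) ∈ profileDomain := Profile.mem_profileDomain_of_Icc zero_le_one le_rfl
  obtain ⟨B, hB, hBd, hB1⟩ := exists_smooth_antideriv
    (b := fun t w => logSlope (q t) (q₁ t) w) isOpen_Ioo isOpen_profileDomain
    convex_profileDomain h1dom F.smooth_logSlope
  set T : ℝ → ℝ → ℝ := fun t w => w * Real.exp (B t w) with hTdef
  set T' : ℝ → ℝ → ℝ := fun t w =>
    Real.exp (B t w) * (2 * stretch (q t) (q₁ t) w / (2 - w)) with hT'def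
  have hT : ContDiffOn ℝ ∞ (fun p : ℝ × ℝ => T p.1 p.2) (Ioo (-ε) ε ×ˢ profileDomain) :=
    contDiffOn_snd.mul hB.exp
  have hTd : ∀ t ∈ Ioo (-ε) ε, ∀ w ∈ profileDomain, HasDerivAt (T t) (T' t w) w := by
    intro t ht w hw
    refine ((hasDerivAt_id w).fun_mul (hBd t ht w hw).exp).congr_deriv ?_
    simp only [hT'def, ← (F.profile t ht).one_add_mul_logSlope hw, id]
    ring
  have hTpos : ∀ t ∈ Ioo (-ε) ε, ∀ w ∈ profileDomain, 0 < T' t w := by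
    intro t ht w hw
    have h2 : 0 < 2 - w := by linarith [hw.2]
    have h0 : 0 < stretch (q t) (q₁ t) w :=
      Real.sqrt_pos.2 ((F.profile t ht).one_add_slope_sq_pos hw)
    simp only [hT'def]
    positivity
  have hT0 : ∀ t, T t 0 = 0 := fun t => zero_mul _
  have hT1 : ∀ t, T t 1 = 1 := fun t => by simp only [hTdef, hB1, Real.exp_zero, mul_one]
  have hmono : ∀ t ∈ Ioo (-ε) ε, StrictMonoOn (T t) profileDomain := fun t ht =>
    strictMonoOn_of_deriv_pos convex_profileDomain
      (fun w hw => (hTd t ht w hw).continuousAt.continuousWithinAt) fun w hw => by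
        rw [isOpen_profileDomain.interior_eq] at hw
        rw [(hTd t ht w hw).deriv]
        exact hTpos t ht w hw
  have hcont : ∀ t ∈ Ioo (-ε) ε, ContinuousOn (T t) (Icc 0 1) := fun t ht w hw =>
    (hTd t ht w (Profile.mem_profileDomain_of_Icc hw.1 hw.2)).continuousAt.continuousWithinAt
  obtain ⟨O, W, hO, hW, hWT, hTW⟩ := exists_smooth_inverse_snd isOpen_Ioo isOpen_profileDomain
    convex_profileDomain hT hTd hTpos
  have hmemO : ∀ t ∈ Ioo (-ε) ε, ∀ τ ∈ Icc (0 : ℝ) 1, (t, τ) ∈ O := by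
    intro t ht τ hτ
    rw [← hT0 t, ← hT1 t] at hτ
    obtain ⟨w, hw, rfl⟩ := intermediate_value_Icc zero_le_one (hcont t ht) hτ
    exact (hWT t ht w (Profile.mem_profileDomain_of_Icc hw.1 hw.2)).1
  have hpair : ContDiffOn ℝ ∞ (fun p : ℝ × ℝ => (p.1, W p.1 p.2)) O := contDiffOn_fst.prodMk hW
  have hmaps : MapsTo (fun p : ℝ × ℝ => (p.1, W p.1 p.2)) O (Ioo (-ε) ε ×ˢ profileDomain) :=
    fun p hp => ⟨(hTW p.1 p.2 hp).1, (hTW p.1 p.2 hp).2.1⟩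
  have hR : ContDiffOn ℝ ∞ (fun p : ℝ × ℝ => √(q p.1 (W p.1 p.2))) O :=
    (F.smooth.comp hpair hmaps).sqrt fun p hp =>
      ((F.profile _ (hmaps hp).1).pos _ (hmaps hp).2).ne'
  have hE : ContDiffOn ℝ ∞ (fun p : ℝ × ℝ => B p.1 (W p.1 p.2)) O := hB.comp hpair hmaps
  -- Since `√w = exp(-s) exp(-B/2)`, the distance `√q √w √(2 - w)` to the axis is `exp(-s)` times
  -- this function of `τ = exp(-2 s)`.
  refine ⟨O, fun t τ => √(q t (W t τ)) * Real.exp (-(B t (W t τ) / 2)) * √(2 - W t τ),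
    fun t τ => √(q t (W t τ)) * (1 - W t τ), hO, hmemO,
    (hR.mul (hE.div_const 2).neg.exp).mul ((contDiffOn_const.sub hW).sqrt fun p hp => ?_),
    hR.mul (contDiffOn_const.sub hW), fun t ht => ?_⟩
  · have := (hTW p.1 p.2 hp).2.1.2
    linarith
  have hexp : ∀ s : ℝ, 0 ≤ s → Real.exp (-s) ^ 2 ∈ Ioc (0 : ℝ) 1 := fun s hs =>
    ⟨by positivity, pow_le_one₀ (Real.exp_pos _).le (Real.exp_le_one_iff.2 (by linarith))⟩
  have hS : ∀ s : ℝ, 0 ≤ s → (t, Real.exp (-s) ^ 2) ∈ O := fun s hs =>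
    hmemO t ht _ ⟨(hexp s hs).1.le, (hexp s hs).2⟩
  have hline : Continuous fun s : ℝ => (t, Real.exp (-s) ^ 2) := by fun_prop
  have hSev : ∀ s : ℝ, 0 ≤ s → ∀ᶠ s' in nhds s, (t, Real.exp (-s') ^ 2) ∈ O := fun s hs =>
    hline.continuousAt.eventually (hO.mem_nhds (hS s hs))
  set w : ℝ → ℝ := fun s => W t (Real.exp (-s) ^ 2) with hw
  have hTw : ∀ s, (t, Real.exp (-s) ^ 2) ∈ O → w s ∈ profileDomain ∧
      w s * Real.exp (B t (w s)) = Real.exp (-s) ^ 2 := fun s hs => (hTW _ _ hs).2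
  have hwmem : ∀ s, 0 ≤ s → w s ∈ Ioc (0 : ℝ) 1 := fun s hs => by
    obtain ⟨h1, h2⟩ := hTw s (hS s hs)
    refine ⟨?_, ?_⟩
    · refine (pos_iff_pos_of_mul_pos ?_).2 (Real.exp_pos (B t (w s)))
      rw [h2]
      exact (hexp s hs).1
    · rw [← (hmono t ht).le_iff_le h1 h1dom, hT1]
      exact h2.le.trans (hexp s hs).2
  refine ⟨w, hwmem, fun s hs => ?_, fun s hs => ?_, fun s _ => Filter.Eventually.of_forall
    fun s' => rfl, ?_, fun s hs s' hs' heq => ?_, fun w₀ hw₀ => ?_⟩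
  · have hwd : DifferentiableAt ℝ w s := ((hW.contDiffAt (hO.mem_nhds (hS s hs))).differentiableAt
      (by simp)).comp s (f := fun s : ℝ => (t, Real.exp (-s) ^ 2)) (by fun_prop)
    obtain ⟨h1, h2⟩ := hTw s (hS s hs)
    have hc := (hTd t ht _ h1).comp s hwd.hasDerivAt
    have he : HasDerivAt (fun s : ℝ => Real.exp (-s) ^ 2) (-2 * Real.exp (-s) ^ 2) s := by
      refine ((hasDerivAt_neg s).exp.fun_pow 2).congr_deriv ?_
      norm_num
      ring
    have hd := hc.unique (he.congr_of_eventuallyEq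
      ((hSev s hs).mono fun s' hs' => (hTw s' hs').2))
    have hP : 0 < stretch (q t) (q₁ t) (w s) :=
      Real.sqrt_pos.2 ((F.profile t ht).one_add_slope_sq_pos h1)
    have h2' : 0 < 2 - w s := by linarith [h1.2]
    have hexp0 := Real.exp_pos (B t (w s))
    refine hwd.hasDerivAt.congr_deriv ?_
    change deriv w s = -(w s * (2 - w s)) / stretch (q t) (q₁ t) (w s)
    simp only [hT'def, ← h2] at hd
    rw [eq_div_iff hP.ne']
    field_simp at hd
    linear_combination hd
  · filter_upwards [hSev s hs] with s' hs'
    have h1 := (hTw s' hs').2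
    have hsq : w s' = (Real.exp (-s') * Real.exp (-(B t (w s') / 2))) ^ 2 := by
      rw [mul_pow, ← h1, ← Real.exp_nat_mul, mul_assoc, ← Real.exp_add]
      push_cast
      rw [show B t (w s') + 2 * -(B t (w s') / 2) = 0 by ring, Real.exp_zero, mul_one]
    have hw0 : 0 ≤ w s' := by
      rw [hsq]
      positivity
    have hroot : √(w s') = Real.exp (-s') * Real.exp (-(B t (w s') / 2)) := by
      rw [Real.sqrt_eq_iff_mul_self_eq_of_pos (by positivity), ← sq, ← hsq]
    rw [Real.sqrt_mul hw0, hroot]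
    change Real.exp (-s') * (√(q t (w s')) * Real.exp (-(B t (w s') / 2)) * √(2 - w s')) = _
    ring
  · have := (hWT t ht 1 h1dom).2
    rw [hT1] at this
    simpa [hw] using this
  · have h1 := (hTw s (hS s hs)).2
    rw [heq, (hTw s' (hS s' hs')).2] at h1
    have h2 := Real.exp_injective
      ((pow_left_inj₀ (Real.exp_pos _).le (Real.exp_pos _).le two_ne_zero).1 h1)
    linarith
  · have hd := Profile.mem_profileDomain_of_Icc hw₀.1.le hw₀.2
    have h1 : 0 < T t w₀ := mul_pos hw₀.1 (Real.exp_pos _)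
    have h2 : T t w₀ ≤ 1 := by
      rw [← hT1 t]
      exact (hmono t ht).monotoneOn hd h1dom hw₀.2
    refine ⟨-(Real.log (T t w₀) / 2), by linarith [Real.log_nonpos h1.le h2], ?_⟩
    have : Real.exp (- -(Real.log (T t w₀) / 2)) ^ 2 = T t w₀ := by
      rw [neg_neg, ← Real.exp_nat_mul]
      push_cast
      rw [mul_div_cancel₀ _ (two_ne_zero' ℝ), Real.exp_log h1]
    simp only [hw, this]
    exact (hWT t ht w₀ hd).2

end ProfileFamily

/-! ### Extension of the conformal parametrizations to the disc -/

/-- The map of the disc whose composition with `cyl` is a parametrization by revolution. -/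
def discParam (α β : ℝ → ℝ → ℝ) (τ : ℝ → ℝ) (p : ℝ × ℂ) : E3 :=
  !₂[p.2.re * α (τ p.1) (p.2.re ^ 2 + p.2.im ^ 2), β (τ p.1) (p.2.re ^ 2 + p.2.im ^ 2),
    p.2.im * α (τ p.1) (p.2.re ^ 2 + p.2.im ^ 2)]

lemma re_cyl (u : E2) : (cyl u).re = Real.exp (-u 0) * Real.cos (u 1) := by
  rw [cyl, Complex.exp_re]
  simp

lemma im_cyl (u : E2) : (cyl u).im = Real.exp (-u 0) * Real.sin (u 1) := by
  rw [cyl, Complex.exp_im]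
  simp

/-- The real and imaginary parts of `cyl u` are `exp(-s) cos z` and `exp(-s) sin z`, with sum of
squares `exp(-s) ^ 2`. -/
lemma discParam_cyl (α β : ℝ → ℝ → ℝ) (τ : ℝ → ℝ) (θ : ℝ) (u : E2) :
    discParam α β τ (θ, cyl u) = revParam (fun s => Real.exp (-s) * α (τ θ) (Real.exp (-s) ^ 2))
      (fun s => β (τ θ) (Real.exp (-s) ^ 2)) u := by
  have h : (cyl u).re ^ 2 + (cyl u).im ^ 2 = Real.exp (-u 0) ^ 2 := by
    rw [re_cyl, im_cyl]
    linear_combination Real.exp (-u 0) ^ 2 * Real.sin_sq_add_cos_sq (u 1)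
  rw [discParam, revParam]
  simp only [h]
  rw [re_cyl, im_cyl]
  refine ext_E3 ?_ rfl ?_
  · change _ * _ * _ = _ * _ * _
    ring
  · change _ * _ * _ = _ * _ * _
    ring

lemma exists_smooth_discParam {α β : ℝ → ℝ → ℝ} {τ : ℝ → ℝ} {O : Set (ℝ × ℝ)} {δ : ℝ} {I : Set ℝ}
    (hO : IsOpen O) (hα : ContDiffOn ℝ ∞ (fun p : ℝ × ℝ => α p.1 p.2) O)
    (hβ : ContDiffOn ℝ ∞ (fun p : ℝ × ℝ => β p.1 p.2) O) (hτ : ContDiffOn ℝ ∞ τ (Ioo (-δ) δ))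
    (hmem : ∀ t ∈ I, ∀ v ∈ Icc (0 : ℝ) 1, (t, v) ∈ O) (hτI : ∀ θ ∈ Ioo (-δ) δ, τ θ ∈ I) :
    ∃ O' : Set (ℝ × ℂ), IsOpen O' ∧ Ioo (-δ) δ ×ˢ Metric.closedBall 0 1 ⊆ O' ∧
      ContDiffOn ℝ ∞ (discParam α β τ) O' := by
  set g : ℝ × ℂ → ℝ × ℝ := fun p => (τ p.1, p.2.re ^ 2 + p.2.im ^ 2) with hg
  have hre : ContDiff ℝ ∞ fun p : ℝ × ℂ => p.2.re := Complex.reCLM.contDiff.comp contDiff_snd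
  have him : ContDiff ℝ ∞ fun p : ℝ × ℂ => p.2.im := Complex.imCLM.contDiff.comp contDiff_snd
  have hgs : ContDiffOn ℝ ∞ g (Ioo (-δ) δ ×ˢ univ) :=
    (hτ.comp contDiffOn_fst fun p hp => hp.1).prodMk ((hre.pow 2).add (him.pow 2)).contDiffOn
  have hO' := hgs.continuousOn.isOpen_inter_preimage (isOpen_Ioo.prod isOpen_univ) hO
  refine ⟨_, hO', fun p hp => ⟨⟨hp.1, mem_univ _⟩, hmem _ (hτI _ hp.1) _ ⟨by positivity, ?_⟩⟩, ?_⟩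
  · have h1 : ‖p.2‖ ≤ 1 := by simpa using hp.2
    have h2 : p.2.re ^ 2 + p.2.im ^ 2 = ‖p.2‖ ^ 2 := by
      rw [Complex.sq_norm, Complex.normSq_apply]
      ring
    rw [h2]
    exact pow_le_one₀ (norm_nonneg _) h1
  · intro p hp
    have hgp := hgs.contDiffAt ((isOpen_Ioo.prod isOpen_univ).mem_nhds hp.1)
    have ha : ContDiffAt ℝ ∞ (fun p => α (g p).1 (g p).2) p :=
      (hα.contDiffAt (hO.mem_nhds hp.2)).comp p hgp
    have hb : ContDiffAt ℝ ∞ (fun p => β (g p).1 (g p).2) p :=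
      (hβ.contDiffAt (hO.mem_nhds hp.2)).comp p hgp
    exact (contDiffAt_mk3 (hre.contDiffAt.mul ha) hb (him.contDiffAt.mul ha)).contDiffWithinAt

lemma deriv_fst_eq_fderiv {F : ℝ × ℂ → E3} {O : Set (ℝ × ℂ)} (hO : IsOpen O)
    (hF : ContDiffOn ℝ ∞ F O) {p : ℝ × ℂ} (hp : p ∈ O) :
    deriv (fun t => F (t, p.2)) p.1 = fderiv ℝ F p (1, 0) := by
  have h1 := ((hF.contDiffAt (hO.mem_nhds hp)).differentiableAt (by simp)).hasFDerivAt
  have hline : HasDerivAt (fun t : ℝ => (t, p.2)) ((1 : ℝ), (0 : ℂ)) p.1 :=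
    (hasDerivAt_id _).prodMk (hasDerivAt_const _ _)
  exact (h1.comp_hasDerivAt (f := fun t : ℝ => (t, p.2)) p.1 hline).deriv

/-- The derivative in `θ` is again a map smooth near the closed disc composed with `cyl`, so
`exists_bound_iteratedFDeriv` applies to it as well. -/
lemma exists_bound_deriv_comp_cyl {F : ℝ × ℂ → E3} {O : Set (ℝ × ℂ)} {δ : ℝ} (hO : IsOpen O)
    (hF : ContDiffOn ℝ ∞ F O) (hsub : Icc (-δ) δ ×ˢ Metric.closedBall 0 1 ⊆ O) (k : ℕ) :
    ∃ C, ∀ θ ∈ Icc (-δ) δ, ∀ p ∈ halfPlane,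
      ‖iteratedFDeriv ℝ k (fun u => F (θ, cyl u)) p‖ ≤ C ∧
      ‖iteratedFDeriv ℝ k (fun u => deriv (fun t => F (t, cyl u)) θ) p‖ ≤ C := by
  have hF' : ContDiffOn ℝ ∞ (fun p => fderiv ℝ F p (1, 0)) O :=
    (hF.fderiv_of_isOpen hO (by simp)).clm_apply contDiffOn_const
  obtain ⟨C₁, h₁⟩ := exists_bound_iteratedFDeriv hO hF hsub k
  obtain ⟨C₂, h₂⟩ := exists_bound_iteratedFDeriv hO hF' hsub k
  refine ⟨max C₁ C₂, fun θ hθ p hp => ⟨(h₁ θ hθ p hp).trans (le_max_left _ _), ?_⟩⟩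
  have hmem : (θ, cyl p) ∈ O := hsub ⟨hθ, by simpa using norm_cyl_le hp⟩
  have hev : (fun u => deriv (fun t => F (t, cyl u)) θ) =ᶠ[nhds p]
      fun u => fderiv ℝ F (θ, cyl u) (1, 0) := by
    have hc : ContinuousAt (fun u => (θ, cyl u)) p :=
      continuousAt_const.prodMk contDiff_cyl.continuous.continuousAt
    filter_upwards [hc.eventually (hO.mem_nhds hmem)] with u hu using
      deriv_fst_eq_fderiv hO hF hu
  rw [(hev.iteratedFDeriv ℝ k).self_of_nhds]
  exact (h₂ θ hθ p hp).trans (le_max_right _ _)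

/-! ### The family of caps -/

lemma capSet_const_four : capSet (fun _ => 4) = hemisphere := by
  ext X
  constructor
  · rintro ⟨-, h1, h2⟩
    refine ⟨?_, h1⟩
    rw [← sq_eq_sq₀ (norm_nonneg _) zero_le_two, h2]
    norm_num
  · rintro ⟨h1, h2⟩
    refine ⟨fun h0 => ?_, h2, by rw [h1]; norm_num⟩
    rw [h0, norm_zero] at h1
    norm_num at h1

end

end ShrinkerCaps

/-! ### Assembly of the two families. -/

theorem mainTheorem8 :
    -- the generating curves
    (∃ (δ a₀ b₀ a₁ b₁ : ℝ) (ρ : ℝ → ℝ → ℝ),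
      0 < δ ∧ 0 < a₀ ∧ 0 < b₀ ∧ 0 < a₁ ∧ 0 < b₁ ∧
      SmoothOnNhd (fun q : ℝ × ℝ => ρ q.1 q.2)
        (Ioo (2 - δ) (2 + δ) ×ˢ Icc 0 (Real.pi / 2)) ∧
      (∀ h ∈ Ioo (2 - δ) (2 + δ), ∀ φ ∈ Icc 0 (Real.pi / 2), 0 < ρ h φ) ∧
      (∀ φ ∈ Icc 0 (Real.pi / 2), ρ 2 φ = 2) ∧
      (∀ h ∈ Ioo (2 - δ) (2 + δ), ρ h 0 = h ∧ deriv (ρ h) 0 = 0) ∧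
      IsOrientationReversingDiffeo (fun h => ρ h (Real.pi / 2))
        (Ioo (2 - δ) (2 + δ)) (Ioo (2 - a₀) (2 + b₀)) ∧
      IsOrientationReversingDiffeo (fun h => deriv (ρ h) (Real.pi / 2))
        (Ioo (2 - δ) (2 + δ)) (Ioo (-a₁) b₁) ∧
      ∀ h ∈ Ioo (2 - δ) (2 + δ),
        IsSurfaceWithBoundary (revolution (ρ h)) ∅ ∧ IsSelfShrinker (revolution (ρ h)) ∅) ∧
    -- the family of caps and its conformal parametrizations
    (∃ (δ : ℝ) (K : ℝ → Set E3) (f : ℝ → E3 → ℝ) (r : ℝ → ℝ) (κ : ℝ → E2 → E3) (C : ℕ → ℝ),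
      0 < δ ∧
      SmoothOnNhd (fun q : ℝ × E3 => f q.1 q.2) (Icc (-δ) δ ×ˢ hemisphere) ∧
      SmoothOnNhd (fun q : ℝ × E2 => κ q.1 q.2) (Icc (-δ) δ ×ˢ halfPlane) ∧
      K 0 = hemisphere ∧
      ∀ θ ∈ Icc (-δ) δ,
        -- smooth surfaces with boundary a circle, satisfying the self-shrinker equation
        0 < r θ ∧
        IsSurfaceWithBoundary (K θ) (circleY 0 (r θ)) ∧
        IsSelfShrinker (K θ) (circleY 0 (r θ)) ∧
        -- normal graphs
        (∀ X ∈ hemisphere, |f θ X| < 2) ∧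
        K θ = normalGraph hemisphere sphereNormal (f θ) ∧
        -- rotational invariance
        (∀ α : ℝ, rotY α '' K θ = K θ) ∧
        -- the co-normal
        (∃ η : E3, IsInwardConormal (K θ) (circleY 0 (r θ)) !₂[r θ, 0, 0] η ∧
          ⟪η, EuclideanSpace.single (0 : Fin 3) (1 : ℝ)⟫ = Real.sin θ ∧
          InnerProductGeometry.angle η (EuclideanSpace.single (0 : Fin 3) (1 : ℝ)) =
            Real.pi / 2 - θ) ∧
        -- the parametrization by the cylinder
        (∀ p ∈ halfPlane, ∀ q ∈ halfPlane,
          κ θ p = κ θ q ↔ p 0 = q 0 ∧ ∃ n : ℤ, q 1 = p 1 + 2 * Real.pi * n) ∧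
        κ θ '' halfPlane = K θ \ yAxis ∧
        (∀ s : ℝ, 0 ≤ s → ∃ c R : ℝ, 0 < R ∧ κ θ '' {p | p 0 = s} = circleY c R) ∧
        κ θ '' edge = circleY 0 (r θ) ∧
        (∀ p ∈ halfPlane, ∀ v w : E2,
          ⟪fderiv ℝ (κ θ) p v, fderiv ℝ (κ θ) p w⟫ =
            ((κ θ p 0) ^ 2 + (κ θ p 2) ^ 2) * ⟪v, w⟫) ∧
        ∀ (k : ℕ), ∀ p ∈ halfPlane,
          ‖iteratedFDeriv ℝ k (κ θ) p‖ ≤ C k ∧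
          ‖iteratedFDeriv ℝ k (fun q => deriv (fun t => κ t q) θ) p‖ ≤ C k) := by
  obtain ⟨ε, q, q₁, q₂, F⟩ := exists_profileFamily
  refine ⟨F.generating_curves, ?_⟩
  obtain ⟨δ₀, τ, hδ₀, hδ₀π, hτ, hτ0, hang⟩ := F.exists_angle
  obtain ⟨O, α, β, hO, hmem, hα, hβ, hM⟩ := F.exists_conformalMeridian
  obtain ⟨O', hO', hsub', hD⟩ := exists_smooth_discParam hO hα hβ hτ hmem fun θ hθ => (hang θ hθ).1
  -- Halving `δ₀` gives a compact range of angles inside the open one, as needed for uniform bounds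
  -- and for smoothness on a neighbourhood.
  have hθ₀ : ∀ θ ∈ Icc (-(δ₀ / 2)) (δ₀ / 2), θ ∈ Ioo (-δ₀) δ₀ := fun θ hθ =>
    ⟨by linarith [hθ.1], by linarith [hθ.2]⟩
  have hsub : Icc (-(δ₀ / 2)) (δ₀ / 2) ×ˢ Metric.closedBall 0 1 ⊆ O' := fun p hp =>
    hsub' ⟨hθ₀ _ hp.1, hp.2⟩
  choose C hC using exists_bound_deriv_comp_cyl hO' hD hsub
  have hcoord : ∀ X ∈ hemisphere, 1 - X 1 / 2 ∈ profileDomain := fun X hX => by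
    have h1 := coord_one_le_norm X
    have h2 := hX.2
    rw [hX.1] at h1
    exact Profile.mem_profileDomain_of_Icc (by linarith) (by linarith)
  have hcyl : ContDiff ℝ ∞ fun p : ℝ × E2 => (p.1, cyl p.2) :=
    contDiff_fst.prodMk (contDiff_cyl.comp contDiff_snd)
  have hcyl_mem : ∀ θ ∈ Icc (-(δ₀ / 2)) (δ₀ / 2), ∀ p ∈ halfPlane, (θ, cyl p) ∈ O' :=
    fun θ hθ p hp => hsub ⟨hθ, by simpa using norm_cyl_le hp⟩
  refine ⟨δ₀ / 2, fun θ => capSet (q (τ θ)), fun θ X => √(q (τ θ) (1 - X 1 / 2)) - 2,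
    fun θ => √(q (τ θ) 1), fun θ u => discParam α β τ (θ, cyl u), C, by positivity, ?_, ?_, ?_,
    fun θ hθ => ?_⟩
  · have hy : ContDiff ℝ ∞ fun p : ℝ × E3 => 1 - p.2 1 / 2 :=
      contDiff_const.sub (((contDiff_coord 1).comp contDiff_snd).div_const 2)
    refine ⟨{p | p.1 ∈ Ioo (-δ₀) δ₀ ∧ 1 - p.2 1 / 2 ∈ profileDomain},
      (isOpen_Ioo.preimage continuous_fst).inter (isOpen_profileDomain.preimage hy.continuous),
      fun p hp => ⟨hθ₀ _ hp.1, hcoord _ hp.2⟩, ?_⟩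
    have hpair : ContDiffOn ℝ ∞ (fun p : ℝ × E3 => (τ p.1, 1 - p.2 1 / 2))
        {p | p.1 ∈ Ioo (-δ₀) δ₀ ∧ 1 - p.2 1 / 2 ∈ profileDomain} :=
      (hτ.comp contDiffOn_fst fun p hp => hp.1).prodMk hy.contDiffOn
    exact ((F.smooth.comp hpair fun p hp => ⟨(hang _ hp.1).1, hp.2⟩).sqrt fun p hp =>
      ((F.profile _ (hang _ hp.1).1).pos _ hp.2).ne').sub contDiffOn_const
  · exact ⟨_, hO'.preimage hcyl.continuous, fun p hp => hcyl_mem _ hp.1 _ hp.2,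
      hD.comp hcyl.contDiffOn fun p hp => hp⟩
  · simp only [hτ0]
    rw [funext F.zero, capSet_const_four]
  · obtain ⟨ht, htan⟩ := hang θ (hθ₀ θ hθ)
    have hP := F.profile _ ht
    obtain ⟨w, M⟩ := hM _ ht
    have h1dom : (1 : ℝ) ∈ profileDomain := Profile.mem_profileDomain_of_Icc zero_le_one le_rfl
    have hr : 0 < √(q (τ θ) 1) := Real.sqrt_pos.2 (hP.pos 1 h1dom)
    have hrq : √(q (τ θ) 1) ^ 2 = q (τ θ) 1 := Real.sq_sqrt (hP.pos 1 h1dom).le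
    have hκ := funext (discParam_cyl α β τ θ)
    have hκd : ∀ p ∈ halfPlane, DifferentiableAt ℝ (fun u => discParam α β τ (θ, cyl u)) p :=
      fun p hp => ((hD.contDiffAt (hO'.mem_nhds (hcyl_mem θ hθ p hp))).differentiableAt
        (by simp)).comp p (f := fun u => (θ, cyl u))
        ((differentiableAt_const θ).prodMk (contDiff_cyl.contDiffAt.differentiableAt (by simp)))
    refine ⟨hr, hP.isSurfaceWithBoundary_cap hr hrq, hP.isSelfShrinker_cap hr hrq, ?_,
      (normalGraph_eq_capSet (fun w hw => hP.pos w (Profile.mem_profileDomain_of_Icc hw.1 hw.2))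
        fun X _ => rfl).symm, rotY_image_capSet _,
      hP.exists_conormal hr hrq ⟨by linarith [(hθ₀ θ hθ).1], by linarith [(hθ₀ θ hθ).2]⟩ htan,
      ?_, ?_, ?_, ?_, ?_, fun k p hp => hC k θ hθ p hp⟩
    · intro X hX
      have h1 := Real.sqrt_pos.2 (hP.pos _ (hcoord X hX))
      -- This and positivity put `√q - 2` strictly between `-2` and `2`.
      have h2 : √(q (τ θ) (1 - X 1 / 2)) < 4 := by
        rw [Real.sqrt_lt' (by norm_num)]
        norm_num
        exact F.lt _ ht _ (hcoord X hX)
      rw [abs_lt]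
      constructor <;> linarith
    · intro p hp p' hp'
      simp only [discParam_cyl]
      exact M.eq_iff hP hp hp'
    · simp only [hκ]
      exact M.image_halfPlane hP
    · intro s hs
      simp only [hκ]
      exact ⟨_, _, M.x_pos hP hs, revParam_image_eq (M.x_pos hP hs)⟩
    · simp only [hκ]
      exact M.image_edge hP
    · intro p hp v v'
      have hd := hκd p hp
      simp only [discParam_cyl] at hd ⊢
      exact M.inner_fderiv hP hp hd v v'
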